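/- \textbf{Setting.} Let $(\Omega,\mathcal F)$ be a non-empty measurable space, $(\mathcal F_t)_{t\ge 0}$ a filtration with $\mathcal F_0=\{\emptyset,\Omega\}$, and $S^1,\dots,S^d:[0,\infty)\times\Omega\to\mathbb R$ ($d\ge 1$) adapted with all trajectories continuous. A sequence of stopping times $(\tau_n)_{n\ge0}$ is \emph{proper} if $0\equiv\tau_0\le\tau_1\le\cdots$ and for each $\omega$ either $\tau_n(\omega)\to+\infty$ or $\tau_n(\omega)$ is eventually constant. A \emph{simple trading strategy} $G=(c,(\tau_n),(g_n))$ consists of $c\in\mathbb R$, a proper sequence $(\tau_n)$ and bounded real $\mathcal F_{\tau_n}$-measurable $g_n$ with $g_n=0$ on $\{\tau_n=\infty\}$, and $(G\cdot S)_t=c+\sum_{n\ge1}g_{n-1}(S_{\tau_n\wedge t}-S_{\tau_{n-1}\wedge t})$. \emph{Simple capital processes} are the sums $\sum_{j=1}^d G^j\cdot S^j$. The class $\mathcal C$ of \emph{nonnegative supermartingales} is the smallest class of maps $[0,\infty)\times\Omega\to[0,\infty]$ that contains all nonnegative simple capital processes, contains $X+Y$ whenever $X\in\mathcal C$, $Y$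 is a simple capital process and $X+Y\ge0$, and is closed under pointwise $\liminf$ of sequences. A set $E\subseteq[0,\infty)\times\Omega$ is \emph{instantly enforceable} (holds w.i.e.) if some $X\in\mathcal C$ has $X_0=1$ and $X_t(\omega)=+\infty$ for all $(t,\omega)\notin E$; its complement is then \emph{instantly blockable}. Assume (Assumption A) that for every $t\ge 0$ and every instantly blockable $B$, the projection of $B\cap([0,t]\times\Omega)$ onto $\Omega$ belongs to $\mathcal F_t$. For any $Y:[0,\infty)\times\Omega\to[-\infty,\infty]$ put $$\overline{\mathbb E}\,Y=\inf\{X_0: X\in\mathcal C,\ X_t(\omega)\ge Y_t(\omega)\text{ for all }(t,\omega)\},\qquad Y^*_t(\omega)=\sup_{0\le s\le t}|Y_s(\omega)| .$$ The class of \emph{martingales} is the smallest class of adapted $[-\infty,\infty]$-valued processes, real w.i.e., that contains all simple capital processes and contains every such process $X$ for which there are martingales $X^n$ with $\sup_{s\le t}|X_s(\omega)-X^n_s(\omega)|\to0$ for w.i.e. $(t,\omega)$ (\emph{locally uniform convergence w.i.e.}). A \emph{fine cover} of $X$ with accuracy $\delta>0$ w.i.e. is a non-decreasing sequence of stopping times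 $(\tau_n)$, $\tau_0\equiv 0$, such that for $(t,\omega)$ in an instantly enforceable set only finitely many $\tau_n(\omega)$ are $\le t$ and $\sup X_s(\omega)-\inf X_s(\omega)\le\delta$ over $s\in[\tau_n(\omega)\wedge t,\tau_{n+1}(\omega)\wedge t]$, for every $n$. A \emph{quadratic variation} $[X]$ of a martingale $X$ is an adapted process, real and continuous w.i.e., to which $[X]^{\sigma^m}_t:=\sum_{n\ge1}(X_{\sigma^m_n\wedge t}-X_{\sigma^m_{n-1}\wedge t})^2$ converge locally uniformly w.i.e. for all positive $\delta_m$ with $\sum_m\delta_m<\infty$ and all fine covers $\sigma^m$ of $X$ with accuracy $\delta_m$ w.i.e. \textbf{Proposition 104 (BDG inequalities for quadratic variation).} Let $X$ be a martingale and $[X]$ its quadratic variation. For any $p\ge1$ there are finite positive constants $c_p,C_p$, depending only on $p$, such that $$c_p\,\overline{\mathbb E}\,[X]^{p/2}\le\overline{\mathbb E}\big((X-X_0)^*\big)^p\le C_p\,\overline{\mathbb E}\,[X]^{p/2}.$$ One may take $C_p=6^p(p-1)^{p-1}$ and $c_p=1/C_p$ for $p>1$, and $C_1=6$, $c_1=1/3$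 for $p=1$. -/

import Mathlib

open MeasureTheory Filter Topology
open scoped NNReal ENNReal

noncomputable section

namespace ModelFree

/-- A martingale space `(Ω, F, (F_t), J, (S^j))` with `J` a set of `d` indices: a filtration with
trivial `F_0`, and adapted real processes (the basic martingales), all of whose trajectories are
continuous. -/
structure MartingaleSpace (Ω : Type*) [m : MeasurableSpace Ω] (d : ℕ) where
  /-- the filtration -/
  ℱ : Filtration ℝ≥0 m
  /-- the basic continuous martingales -/
  S : Fin d → ℝ≥0 → Ω → ℝ
  trivial_zero : ℱ 0 = ⊥
  adapted : ∀ j t, Measurable[ℱ t] (S j t)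
  continuous_path : ∀ j ω, Continuous fun t => S j t ω

variable {Ω : Type*} [m : MeasurableSpace Ω] {d : ℕ}

/-- A proper sequence of stopping times: non-decreasing, starting at `0`, and for each `ω`
divergent to `+∞` or eventually constant (with values in `[0, +∞]`). -/
structure IsProper (ℱ : Filtration ℝ≥0 m) (τ : ℕ → Ω → WithTop ℝ≥0) : Prop where
  stopping : ∀ n, IsStoppingTime ℱ (τ n)
  mono : ∀ n ω, τ n ω ≤ τ (n + 1) ω
  zero : ∀ ω, τ 0 ω = 0
  diverges_or_const : ∀ ω,
    (∀ K : ℝ≥0, ∃ N, ∀ n ≥ N, (K : WithTop ℝ≥0) < τ n ω) ∨ (∃ N, ∀ n ≥ N, τ n ω = τ N ω)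

/-- A simple trading strategy `(c, (τ_n), (g_n))`. -/
structure SimpleStrategy (ℱ : Filtration ℝ≥0 m) where
  /-- the initial capital -/
  c : ℝ
  /-- the trading times -/
  τ : ℕ → Ω → WithTop ℝ≥0
  /-- the positions -/
  g : ℕ → Ω → ℝ
  proper : IsProper ℱ τ
  bounded : ∀ n, ∃ K : ℝ, ∀ ω, |g n ω| ≤ K
  measurable : ∀ n, Measurable[(proper.stopping n).measurableSpace] (g n)
  zero_of_top : ∀ n ω, τ n ω = ⊤ → g n ω = 0

/-- `(G · X)_t = c + ∑_{n ≥ 1} g_{n-1} (X_{τ_n ∧ t} - X_{τ_{n-1} ∧ t})`; since `(τ_n)` is proper,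
only finitely many summands are nonzero. -/
def SimpleStrategy.integral {ℱ : Filtration ℝ≥0 m} (G : SimpleStrategy ℱ) (X : ℝ≥0 → Ω → ℝ)
    (t : ℝ≥0) (ω : Ω) : ℝ :=
  G.c + ∑' n, G.g n ω * (stoppedProcess X (G.τ (n + 1)) t ω - stoppedProcess X (G.τ n) t ω)

namespace MartingaleSpace

variable (𝓜 : MartingaleSpace Ω d)

/-- The simple capital process of a vector of simple trading strategies. -/
def capital (G : Fin d → SimpleStrategy 𝓜.ℱ) (t : ℝ≥0) (ω : Ω) : ℝ :=
  ∑ j, (G j).integral (𝓜.S j) t ω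

/-- The class `𝒞` of nonnegative supermartingales: the smallest class that contains the nonnegative
simple capital processes, is stable under addition of a simple capital process as long as
the sum is nonnegative, and is closed under pointwise lower limits of sequences. -/
inductive NonnegSupermartingale : (ℝ≥0 → Ω → EReal) → Prop
  | simple (G : Fin d → SimpleStrategy 𝓜.ℱ) (h : ∀ t ω, 0 ≤ 𝓜.capital G t ω) :
      NonnegSupermartingale (fun t ω => (𝓜.capital G t ω : EReal))
  | add (X : ℝ≥0 → Ω → EReal) (G : Fin d → SimpleStrategy 𝓜.ℱ)
      (hX : NonnegSupermartingale X) (h : ∀ t ω, 0 ≤ X t ω + (𝓜.capital G t ω : EReal)) :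
      NonnegSupermartingale (fun t ω => X t ω + (𝓜.capital G t ω : EReal))
  | liminf (X : ℕ → ℝ≥0 → Ω → EReal) (hX : ∀ n, NonnegSupermartingale (X n)) :
      NonnegSupermartingale (fun t ω => Filter.liminf (fun n => X n t ω) atTop)

/-- The property `E` of `(t, ω)` is instantly enforceable (holds w.i.e.). -/
def InstantlyEnforceable (E : Set (ℝ≥0 × Ω)) : Prop :=
  ∃ X, 𝓜.NonnegSupermartingale X ∧ (∀ ω, X 0 ω = 1) ∧ ∀ t ω, (t, ω) ∉ E → X t ω = ⊤

/-- Complements of instantly enforceable properties are instantly blockable. -/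
def InstantlyBlockable (B : Set (ℝ≥0 × Ω)) : Prop :=
  𝓜.InstantlyEnforceable Bᶜ

/-- The standing assumption on the filtration: for each instantly blockable `B`, the projection of
`B ∩ ([0, t] × Ω)` onto `Ω` belongs to `F_t`. -/
def AssumptionA : Prop :=
  ∀ (t : ℝ≥0) (B : Set (ℝ≥0 × Ω)), 𝓜.InstantlyBlockable B →
    MeasurableSet[𝓜.ℱ t] {ω | ∃ s, s ≤ t ∧ (s, ω) ∈ B}

/-- The upper expectation of a generalized process: the infimum of the (deterministic) initial
values of the nonnegative supermartingales that dominate it everywhere. -/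
def upperExpectation (Y : ℝ≥0 → Ω → EReal) : EReal :=
  sInf {x | ∃ X, 𝓜.NonnegSupermartingale X ∧ (∀ ω, X 0 ω = x) ∧ ∀ t ω, Y t ω ≤ X t ω}

/-- A process: extended real variables `Y_t` which are `F_t`-measurable. -/
def AdaptedExt (Y : ℝ≥0 → Ω → EReal) : Prop :=
  ∀ t, Measurable[𝓜.ℱ t] (Y t)

/-- A process which is real w.i.e. -/
def RealWIE (Y : ℝ≥0 → Ω → EReal) : Prop :=
  𝓜.InstantlyEnforceable {q | Y q.1 q.2 ≠ ⊥ ∧ Y q.1 q.2 ≠ ⊤}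

/-- A process whose trajectories are real and continuous w.i.e. -/
def ContinuousWIE (Y : ℝ≥0 → Ω → EReal) : Prop :=
  𝓜.InstantlyEnforceable
    {q | (Y q.1 q.2 ≠ ⊥ ∧ Y q.1 q.2 ≠ ⊤) ∧ ContinuousAt (fun s => Y s q.2) q.1}

/-- Locally uniform convergence w.i.e.: `sup_{s ∈ [0, t]} |Y^n_s(ω) - Y_s(ω)| → 0` for `(t, ω)` in
an instantly enforceable set. A difference in which one of the terms is infinite has the absolute
value `∞` here, also if both are. -/
def LocallyUniformWIE (Yn : ℕ → ℝ≥0 → Ω → EReal) (Y : ℝ≥0 → Ω → EReal) : Prop :=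
  𝓜.InstantlyEnforceable
    {q | Tendsto (fun n => ⨆ s ∈ Set.Icc 0 q.1, (Y s q.2 - Yn n s q.2).abs) atTop (𝓝 0)}

/-- The class of martingales: the smallest class of processes, real w.i.e., that contains the simple
capital processes and is closed under locally uniform convergence w.i.e. -/
inductive IsMartingale : (ℝ≥0 → Ω → EReal) → Prop
  | simple (G : Fin d → SimpleStrategy 𝓜.ℱ) :
      IsMartingale (fun t ω => (𝓜.capital G t ω : EReal))
  | lim (Xn : ℕ → ℝ≥0 → Ω → EReal) (X : ℝ≥0 → Ω → EReal) (hXn : ∀ n, IsMartingale (Xn n))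
      (hX : 𝓜.AdaptedExt X) (hreal : 𝓜.RealWIE X) (hlim : 𝓜.LocallyUniformWIE Xn X) :
      IsMartingale X

/-- A non-decreasing sequence of stopping times `(τ_n)`, `τ_0 = 0`, is a fine cover of `X` with
accuracy `δ` w.i.e.: for `(t, ω)` in an instantly enforceable set, only finitely many `τ_n(ω)`
are at most `t`, and `X` oscillates by at most `δ` on each `[τ_n(ω) ∧ t, τ_{n+1}(ω) ∧ t]`. -/
structure IsFineCover (X : ℝ≥0 → Ω → EReal) (δ : ℝ) (τ : ℕ → Ω → WithTop ℝ≥0) : Prop where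
  stopping : ∀ n, IsStoppingTime 𝓜.ℱ (τ n)
  mono : ∀ n ω, τ n ω ≤ τ (n + 1) ω
  zero : ∀ ω, τ 0 ω = 0
  covers : ∃ E : Set (ℝ≥0 × Ω), 𝓜.InstantlyEnforceable E ∧ ∀ q ∈ E,
    {n | τ n q.2 ≤ (q.1 : WithTop ℝ≥0)}.Finite ∧
    ∀ n, (⨆ s ∈ {s : ℝ≥0 | min (τ n q.2) q.1 ≤ s ∧ s ≤ min (τ (n + 1) q.2) q.1}, X s q.2) -
      (⨅ s ∈ {s : ℝ≥0 | min (τ n q.2) q.1 ≤ s ∧ s ≤ min (τ (n + 1) q.2) q.1}, X s q.2) ≤ (δ : EReal)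

end MartingaleSpace

/-- The simple quadratic variation `[X]^τ_t = ∑_{n ≥ 1} (X_{τ_n ∧ t} - X_{τ_{n-1} ∧ t})²`. -/
def simpleQV (X : ℝ≥0 → Ω → EReal) (τ : ℕ → Ω → WithTop ℝ≥0) (t : ℝ≥0) (ω : Ω) : ℝ≥0∞ :=
  ∑' n, (stoppedProcess X (τ (n + 1)) t ω - stoppedProcess X (τ n) t ω).abs ^ 2

/-- `V` is a quadratic variation of `X`: a process, real and continuous w.i.e., to which the simple
quadratic variations of `X` along fine covers with summable accuracies converge locally
uniformly w.i.e. -/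
structure MartingaleSpace.IsQuadraticVariation (𝓜 : MartingaleSpace Ω d)
    (X V : ℝ≥0 → Ω → EReal) : Prop where
  process : 𝓜.AdaptedExt V
  continuous : 𝓜.ContinuousWIE V
  tendsto : ∀ (δ : ℕ → ℝ) (σ : ℕ → ℕ → Ω → WithTop ℝ≥0), (∀ k, 0 < δ k) → Summable δ →
    (∀ k, 𝓜.IsFineCover X (δ k) (σ k)) →
    𝓜.LocallyUniformWIE (fun k t ω => (simpleQV X (σ k) t ω : EReal)) V

/-- The supremum process `Y^*_t = sup_{0 ≤ s ≤ t} |Y_s|`. -/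
def supProcess (Y : ℝ≥0 → Ω → EReal) (t : ℝ≥0) (ω : Ω) : ℝ≥0∞ :=
  ⨆ s ∈ Set.Icc 0 t, (Y s ω).abs

/-- The constant `C_p`. -/
def bdgUpper (p : ℝ) : ℝ := if p = 1 then 6 else 6 ^ p * (p - 1) ^ (p - 1)

/-- The constant `c_p`. -/
def bdgLower (p : ℝ) : ℝ := if p = 1 then 1 / 3 else 1 / bdgUpper p

end ModelFree

end

/-!
The inequalities hold path by path, and for sequences. Let `x` be a real sequence that starts at `0`
and has small increments, and let `M` and `Q` be its running maximum and the running sum of its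
squared increments. Then `Q ^ (p / 2)` is at most a multiple of `M ^ p` plus a small constant plus
a discrete stochastic integral `∑ H_k (x_{k+1} - x_k)`, in which `H_k` is a continuous function of
`x_k`, `M_k` and `Q_k`; the same is true with the roles of `M ^ p` and `Q ^ (p / 2)` exchanged
(`exists_weight_qv_le`, `exists_weight_max_le`). The proofs use the gauge `W = max(M, √Q, ε)`.
For the first inequality, `W ^ (p - 2)` is the weight of the squared increments, and one sums by
parts. For the second, the potential `|x| ^ (2 p) / W ^ p` pays for the growth of `W ^ p` whenever
it is due to a new maximum, and the Taylor remainders of the potential are absorbed in `Q`.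
The small constant comes from `ε`, and the bound on the increments depends on it.

To pass to a martingale `X`, sample it along the times at which it has moved by `r`; with
a nonnegative supermartingale that dominates the right-hand side as initial endowment, the discrete
integral is then a trading strategy in `X` that superhedges the left-hand side. Three points need
an argument.

* A martingale is only a limit of capital processes. By induction over the class of
  martingales, the gains of elementary integrals can nevertheless be superhedged at no cost up to
  an arbitrarily small amount (`IsMartingale.exists_isExceptional`): one trades in an approximating
  martingale until the two integrals differ by `ε`. The amount `ε`, which is set aside, keeps the
  capital nonnegative, and for all but finitely many approximations this does
  not happen before time `t`.
* Everything holds outside instantly blockable sets only. By Assumption A a blockable set can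
  be enlarged to one that is closed under passing to later times and whose sections have only
  measurable subsets (`InstantlyBlockable.exists_isExceptional`). Outside of such a set, martingales
  and quadratic variations are continuous real processes, so that hitting times are stopping times.
  A small multiple of a blocking supermartingale takes care of the set itself.
* The quadratic variation `[X]` is only the limit of the sums of squares along fine covers.
  As the cover is refined, the lower limit of the hedging supermartingales superhedges the limit of
  the left-hand sides. When `[X] ^ (p / 2)` is on the right-hand side, one stops trading if the sum
  of squares exceeds `[X]` by a small constant; again this does not happen before `t` in the limit.

This compares the initial values of dominating supermartingales up to arbitrarily small errors
(`upperExpectation_qv_le`, `upperExpectation_max_le`).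
-/

noncomputable section

namespace ModelFree

/-! ### Power inequalities -/

lemma rpow_sub_two_mul_sq {a : ℝ} (ha : 0 < a) (p : ℝ) : a ^ (p - 2) * a ^ 2 = a ^ p := by
  rw [← Real.rpow_natCast a 2, ← Real.rpow_add ha]; norm_num

lemma sq_rpow_half {a : ℝ} (ha : 0 ≤ a) (p : ℝ) : (a ^ 2) ^ (p / 2) = a ^ p := by
  rw [← Real.rpow_natCast a 2, ← Real.rpow_mul ha]; congr 1; push_cast; ring

/-- The tangent at `b²` of the convex function `s ↦ s ^ (p / 2)`. -/
lemma rpow_tangent_of_two_le {a b p : ℝ} (ha : 0 ≤ a) (hb : 0 < b) (hp : 2 ≤ p) :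
    b ^ p - a ^ p ≤ p / 2 * (b ^ (p - 2) * (b ^ 2 - a ^ 2)) := by
  have h := one_add_mul_self_le_rpow_one_add (s := a ^ 2 / b ^ 2 - 1)
    (by have : 0 ≤ a ^ 2 / b ^ 2 := by positivity
        linarith) (p := p / 2) (by linarith)
  have e1 : 1 + (a ^ 2 / b ^ 2 - 1) = (a / b) ^ 2 := by rw [div_pow]; ring
  rw [e1, sq_rpow_half (by positivity), Real.div_rpow ha hb.le] at h
  have hbp : 0 < b ^ p := Real.rpow_pos_of_pos hb p
  have h2 := mul_le_mul_of_nonneg_left h hbp.le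
  rw [mul_div_cancel₀ _ hbp.ne'] at h2
  have e2 : b ^ p * (a ^ 2 / b ^ 2 - 1) = b ^ (p - 2) * (a ^ 2 - b ^ 2) := by
    rw [← rpow_sub_two_mul_sq hb p]; field_simp
  nlinarith

/-- The tangent at `b²` of the concave function `s ↦ s ^ (p / 2)`. -/
lemma rpow_tangent_of_le_two {a b p : ℝ} (ha : 0 ≤ a) (hb : 0 < b) (hp : 0 ≤ p) (hp2 : p ≤ 2) :
    p / 2 * (b ^ (p - 2) * (b ^ 2 - a ^ 2)) ≤ b ^ p - a ^ p := by
  have h := rpow_one_add_le_one_add_mul_self (s := a ^ 2 / b ^ 2 - 1)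
    (by have : 0 ≤ a ^ 2 / b ^ 2 := by positivity
        linarith) (p := p / 2) (by linarith) (by linarith)
  have e1 : 1 + (a ^ 2 / b ^ 2 - 1) = (a / b) ^ 2 := by rw [div_pow]; ring
  rw [e1, sq_rpow_half (by positivity), Real.div_rpow ha hb.le] at h
  have hbp : 0 < b ^ p := Real.rpow_pos_of_pos hb p
  have h2 := mul_le_mul_of_nonneg_left h hbp.le
  rw [mul_div_cancel₀ _ hbp.ne'] at h2
  have e2 : b ^ p * (a ^ 2 / b ^ 2 - 1) = b ^ (p - 2) * (a ^ 2 - b ^ 2) := by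
    rw [← rpow_sub_two_mul_sq hb p]; field_simp
  nlinarith

/-- Absorption of a mixed term, by Young's inequality with exponents `p / (p - 2)` and `p / 2`. -/
lemma rpow_le_of_le_mixed {W M p κ R : ℝ} (hW : 0 < W) (hM : 0 ≤ M) (hp : 2 ≤ p) (hκ : 0 ≤ κ)
    (h : W ^ p ≤ κ * (W ^ (p - 2) * M ^ 2) + R) :
    W ^ p ≤ (2 * κ) ^ (p / 2) * M ^ p + 2 * R := by
  have key : 2 * κ * (W ^ (p - 2) * M ^ 2) ≤ W ^ p + (2 * κ) ^ (p / 2) * M ^ p := by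
    have h0 : 0 ≤ W ^ (p - 2) := by positivity
    have hL : 0 ≤ (2 * κ) ^ (p / 2) * M ^ p := by positivity
    rcases le_total (2 * κ * M ^ 2) (W ^ 2) with hc | hc
    · have := mul_le_mul_of_nonneg_left hc h0
      rw [rpow_sub_two_mul_sq hW] at this
      nlinarith
    · have hpos : 0 < 2 * κ * M ^ 2 := lt_of_lt_of_le (by positivity) hc
      set s := 2 * κ * M ^ 2 with hs
      have e : W ^ (p - 2) ≤ s ^ (p / 2 - 1) := by
        have : W ^ (p - 2) = (W ^ 2) ^ (p / 2 - 1) := by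
          rw [show p / 2 - 1 = (p - 2) / 2 by ring, sq_rpow_half hW.le]
        rw [this]
        exact Real.rpow_le_rpow (by positivity) hc (by linarith)
      have e2 : s ^ (p / 2 - 1) * s = s ^ (p / 2) := by
        rw [Real.rpow_sub_one hpos.ne']; field_simp
      have e3 : s ^ (p / 2) = (2 * κ) ^ (p / 2) * M ^ p := by
        rw [hs, Real.mul_rpow (by positivity) (by positivity), sq_rpow_half hM]
      have hWp : 0 ≤ W ^ p := by positivity
      have := mul_le_mul_of_nonneg_right e hpos.le
      rw [e2, e3] at this
      calc _ = W ^ (p - 2) * s := by rw [hs]; ring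
        _ ≤ _ := by linarith
  linarith

/-- `z ↦ |z| ^ (r - 1) z` is Lipschitz on `[-m, m]`; only increments to the right are needed. -/
lemma abs_rpow_mul_sub_le {r m u v : ℝ} (hr : 1 ≤ r) (huv : u ≤ v) (hu : |u| ≤ m) (hv : |v| ≤ m) :
    |v| ^ (r - 1) * v - |u| ^ (r - 1) * u ≤ r * m ^ (r - 1) * (v - u) := by
  have hm : 0 ≤ m := (abs_nonneg u).trans hu
  have hmu : |u| ^ (r - 1) ≤ m ^ (r - 1) := Real.rpow_le_rpow (abs_nonneg _) hu (by linarith)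
  have hmv : |v| ^ (r - 1) ≤ m ^ (r - 1) := Real.rpow_le_rpow (abs_nonneg _) hv (by linarith)
  have hmm : 0 ≤ m ^ (r - 1) := by positivity
  have pos : ∀ {a b : ℝ}, 0 ≤ a → a ≤ b → b ^ (r - 1) ≤ m ^ (r - 1) →
      b ^ (r - 1) * b - a ^ (r - 1) * a ≤ r * m ^ (r - 1) * (b - a) := by
    intro a b ha hab hb'
    rcases (ha.trans hab).eq_or_lt with hb0 | hb
    · have : a = 0 := le_antisymm (hb0 ▸ hab) ha
      simp [← hb0, this]
    have e : ∀ {c : ℝ}, 0 ≤ c → c ^ (r - 1) * c = c ^ r := by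
      intro c hc
      rcases hc.eq_or_lt with h0 | h0
      · rw [← h0, mul_zero, Real.zero_rpow (by linarith)]
      · rw [Real.rpow_sub_one h0.ne']; field_simp
    have h := one_add_mul_self_le_rpow_one_add (s := a / b - 1)
      (by have : 0 ≤ a / b := by positivity
          linarith) hr
    rw [add_sub_cancel, Real.div_rpow ha hb.le] at h
    have hbr : 0 < b ^ r := Real.rpow_pos_of_pos hb r
    have h2 := mul_le_mul_of_nonneg_left h hbr.le
    rw [mul_div_cancel₀ _ hbr.ne'] at h2
    have e2 : b ^ r * (a / b - 1) = b ^ (r - 1) * (a - b) := by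
      rw [← e hb.le]; field_simp
    rw [e ha, e hb.le]
    have h3 : r * b ^ (r - 1) * (b - a) ≤ r * m ^ (r - 1) * (b - a) := by
      have : 0 ≤ b - a := by linarith
      gcongr
    nlinarith
  rcases le_total 0 u with h0u | h0u
  · have h0v := h0u.trans huv
    rw [abs_of_nonneg h0u, abs_of_nonneg h0v] at *
    exact pos h0u huv hmv
  · rcases le_total 0 v with h0v | h0v
    · have h1 : |v| ^ (r - 1) * v ≤ m ^ (r - 1) * v := by gcongr
      have h2 : |u| ^ (r - 1) * (-u) ≤ m ^ (r - 1) * (-u) := by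
        have : 0 ≤ -u := by linarith
        gcongr
      have h3 : 0 ≤ (r - 1) * (m ^ (r - 1) * (v - u)) := by
        have : 0 ≤ v - u := by linarith
        have : 0 ≤ r - 1 := by linarith
        positivity
      nlinarith
    · rw [abs_of_nonpos h0u, abs_of_nonpos h0v] at *
      have := pos (a := -v) (b := -u) (by linarith) (by linarith) hmu
      linarith

/-- The second order Taylor bound for `z ↦ |z| ^ b`. -/
lemma abs_rpow_taylor {b m x y : ℝ} (hb : 2 ≤ b) (hx : |x| ≤ m) (hy : |y| ≤ m) :
    |y| ^ b - |x| ^ b ≤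
      b * (|x| ^ (b - 2) * x) * (y - x) + b * (b - 1) / 2 * m ^ (b - 2) * (y - x) ^ 2 := by
  set D := b * (|x| ^ (b - 2) * x) with hD
  set C := b * (b - 1) / 2 * m ^ (b - 2) with hC
  let φ : ℝ → ℝ := fun z => |z| ^ b - D * (z - x) - C * (z - x) ^ 2
  have hφ : ∀ z, HasDerivAt φ (b * (|z| ^ (b - 2) * z) - D - C * (2 * (z - x))) z := by
    intro z
    have h1 := hasDerivAt_abs_rpow z (p := b) (by linarith)
    have h2 := ((hasDerivAt_id z).sub_const x)
    have := (h1.sub (h2.const_mul D)).sub ((h2.pow 2).const_mul C)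
    refine this.congr_deriv ?_
    simp; ring
  have hL : ∀ u v : ℝ, u ≤ v → |u| ≤ m → |v| ≤ m →
      b * (|v| ^ (b - 2) * v) - b * (|u| ^ (b - 2) * u) ≤ C * (2 * (v - u)) := by
    intro u v huv hu hv
    have h := abs_rpow_mul_sub_le (r := b - 1) (by linarith) huv hu hv
    rw [show b - 1 - 1 = b - 2 by ring] at h
    have := mul_le_mul_of_nonneg_left h (show 0 ≤ b by linarith)
    rw [hC]; nlinarith
  have hcont : Continuous φ := continuous_iff_continuousAt.2 fun z => (hφ z).continuousAt
  suffices φ y ≤ φ x by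
    have e : φ x = |x| ^ b := by simp [φ]
    have e' : φ y = |y| ^ b - D * (y - x) - C * (y - x) ^ 2 := rfl
    linarith
  rw [abs_le] at hx hy
  rcases le_total x y with hxy | hxy
  · refine antitoneOn_of_deriv_nonpos (convex_Icc x y) hcont.continuousOn
      (fun z _ => (hφ z).differentiableAt.differentiableWithinAt) ?_
      ⟨le_rfl, hxy⟩ ⟨hxy, le_rfl⟩ hxy
    intro z hz
    rw [interior_Icc] at hz
    rw [(hφ z).deriv]
    have := hL x z hz.1.le (abs_le.2 hx) (abs_le.2 ⟨by linarith [hz.1], by linarith [hz.2]⟩)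
    linarith
  · refine monotoneOn_of_deriv_nonneg (convex_Icc y x) hcont.continuousOn
      (fun z _ => (hφ z).differentiableAt.differentiableWithinAt) ?_
      ⟨le_rfl, hxy⟩ ⟨hxy, le_rfl⟩ hxy
    intro z hz
    rw [interior_Icc] at hz
    rw [(hφ z).deriv]
    have := hL z x hz.2.le (abs_le.2 ⟨by linarith [hz.1], by linarith [hz.2]⟩) (abs_le.2 hx)
    nlinarith

/-! ### Constants -/

lemma six_mul_sub_one_le_bdgUpper {p : ℝ} (hp : 1 ≤ p) : 6 * p - 1 ≤ bdgUpper p := by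
  unfold bdgUpper
  split_ifs with h
  · subst h; norm_num
  have hu : 0 < p - 1 := by
    rcases hp.eq_or_lt with h' | h'
    · exact absurd h'.symm h
    · linarith
  set u := p - 1 with hudef
  have e : (6 : ℝ) ^ p * u ^ u = 6 * Real.exp (u * Real.log (6 * u)) := by
    rw [show p = 1 + u by rw [hudef]; ring, Real.rpow_add (by norm_num), Real.rpow_one, mul_assoc,
      ← Real.mul_rpow (by norm_num) hu.le, Real.rpow_def_of_pos (by positivity), mul_comm u]
  rw [e]
  -- `v log v ≥ v - 1` at `v = 6 u`
  have h1 : 6 * u - 1 ≤ 6 * u * Real.log (6 * u) := by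
    have := Real.one_sub_inv_le_log_of_pos (show 0 < 6 * u by positivity)
    have h2 := mul_le_mul_of_nonneg_left this (show 0 ≤ 6 * u by positivity)
    have : 6 * u * (6 * u)⁻¹ = 1 := mul_inv_cancel₀ (by positivity)
    linarith
  have h2 := Real.add_one_le_exp (u * Real.log (6 * u))
  have : p = u + 1 := by rw [hudef]; ring
  linarith

lemma three_mul_rpow_le_bdgUpper {p : ℝ} (hp : 2 ≤ p) : (3 * p) ^ p ≤ bdgUpper p := by
  unfold bdgUpper
  rw [if_neg (by linarith)]
  have hu : 0 < p - 1 := by linarith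
  -- midpoint convexity of `s log s` between `1` and `p - 1`
  have hc := Real.convexOn_mul_log.2 (show p - 1 ∈ Set.Ici (0 : ℝ) from Set.mem_Ici.2 hu.le)
    (show (1 : ℝ) ∈ Set.Ici (0 : ℝ) from Set.mem_Ici.2 zero_le_one) 
    (show (0 : ℝ) ≤ 1 / 2 by norm_num) (show (0 : ℝ) ≤ 1 / 2 by norm_num) (by norm_num)
  simp only [smul_eq_mul, Real.log_one, mul_zero, mul_one, add_zero] at hc
  rw [show 1 / 2 * (p - 1) + 1 / 2 = p / 2 by ring] at hc
  have h1 : (p / 2) ^ p ≤ (p - 1) ^ (p - 1) := by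
    rw [Real.rpow_def_of_pos (by linarith), Real.rpow_def_of_pos hu, Real.exp_le_exp]
    linarith
  calc (3 * p) ^ p = (6 * (p / 2)) ^ p := by congr 1; ring
    _ = 6 ^ p * (p / 2) ^ p := Real.mul_rpow (by norm_num) (by linarith)
    _ ≤ _ := by gcongr

lemma bdgUpper_pos {p : ℝ} (hp : 1 ≤ p) : 0 < bdgUpper p := by
  linarith [six_mul_sub_one_le_bdgUpper hp]

lemma bdgLower_pos {p : ℝ} (hp : 1 ≤ p) : 0 < bdgLower p := by
  unfold bdgLower
  split_ifs
  · norm_num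
  · exact one_div_pos.2 (bdgUpper_pos hp)

lemma three_le_inv_bdgLower {p : ℝ} (hp : 1 ≤ p) : 3 ≤ (bdgLower p)⁻¹ := by
  unfold bdgLower
  split_ifs
  · norm_num
  · rw [one_div, inv_inv]; linarith [six_mul_sub_one_le_bdgUpper hp]

lemma inv_bdgLower_of_two_le {p : ℝ} (hp : 2 ≤ p) : (bdgLower p)⁻¹ = bdgUpper p := by
  unfold bdgLower
  rw [if_neg (by linarith), one_div, inv_inv]

/-! ### Pathwise BDG inequalities for real sequences -/

/-- The running maximum `max_{k ≤ n} |x_k|`. -/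
def runMax (x : ℕ → ℝ) : ℕ → ℝ
  | 0 => |x 0|
  | n + 1 => max (runMax x n) |x (n + 1)|

/-- The sum `∑_{k < n} (x_{k+1} - x_k)²` of the squared increments. -/
def runQV (x : ℕ → ℝ) (n : ℕ) : ℝ := ∑ k ∈ Finset.range n, (x (k + 1) - x k) ^ 2

/-- The common size `max(M, √Q, ε)` of a running maximum `M` and a quadratic variation `Q`,
bounded away from `0` by `ε`. -/
def gauge (ε M Q : ℝ) : ℝ := max (max M (√Q)) ε

lemma abs_le_runMax (x : ℕ → ℝ) (n : ℕ) : |x n| ≤ runMax x n := by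
  cases n with
  | zero => exact le_rfl
  | succ n => exact le_max_right _ _

lemma runMax_nonneg (x : ℕ → ℝ) (n : ℕ) : 0 ≤ runMax x n :=
  (abs_nonneg _).trans (abs_le_runMax x n)

lemma runMax_le_succ (x : ℕ → ℝ) (n : ℕ) : runMax x n ≤ runMax x (n + 1) := le_max_left _ _

lemma abs_le_runMax_of_le (x : ℕ → ℝ) {k n : ℕ} (h : k ≤ n) : |x k| ≤ runMax x n :=
  (abs_le_runMax x k).trans (monotone_nat_of_le_succ (runMax_le_succ x) h)

lemma runMax_le {x : ℕ → ℝ} {n : ℕ} {c : ℝ} (h : ∀ k ≤ n, |x k| ≤ c) : runMax x n ≤ c := by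
  induction n with
  | zero => exact h 0 le_rfl
  | succ n ih => exact max_le (ih fun k hk => h k (hk.trans n.le_succ)) (h _ le_rfl)

lemma runQV_nonneg (x : ℕ → ℝ) (n : ℕ) : 0 ≤ runQV x n :=
  Finset.sum_nonneg fun _ _ => sq_nonneg _

lemma runQV_succ (x : ℕ → ℝ) (n : ℕ) : runQV x (n + 1) = runQV x n + (x (n + 1) - x n) ^ 2 :=
  Finset.sum_range_succ _ _

lemma runQV_mono (x : ℕ → ℝ) : Monotone (runQV x) :=
  monotone_nat_of_le_succ fun n => by rw [runQV_succ]; linarith [sq_nonneg (x (n + 1) - x n)]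

lemma runMax_congr {x y : ℕ → ℝ} {n : ℕ} (h : ∀ k ≤ n, x k = y k) : runMax x n = runMax y n := by
  induction n with
  | zero => simp [runMax, h 0 le_rfl]
  | succ n ih =>
    simp only [runMax]
    rw [ih fun k hk => h k (hk.trans n.le_succ), h _ le_rfl]

lemma runQV_congr {x y : ℕ → ℝ} {n : ℕ} (h : ∀ k ≤ n, x k = y k) : runQV x n = runQV y n :=
  Finset.sum_congr rfl fun k hk => by
    have := Finset.mem_range.1 hk
    rw [h k this.le, h (k + 1) this]

section Steps

variable {x : ℕ → ℝ} {ε θ p : ℝ}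

/-- The process `max(M_n, √Q_n, ε)` of a sequence. -/
def runGauge (x : ℕ → ℝ) (ε : ℝ) (n : ℕ) : ℝ := gauge ε (runMax x n) (runQV x n)

lemma le_runGauge (n : ℕ) : ε ≤ runGauge x ε n := le_max_right _ _

lemma runMax_le_runGauge (n : ℕ) : runMax x n ≤ runGauge x ε n :=
  (le_max_left _ _).trans (le_max_left _ _)

lemma sqrt_runQV_le_runGauge (n : ℕ) : √(runQV x n) ≤ runGauge x ε n :=
  (le_max_right _ _).trans (le_max_left _ _)

lemma runGauge_le_succ (n : ℕ) : runGauge x ε n ≤ runGauge x ε (n + 1) :=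
  max_le_max (max_le_max (runMax_le_succ x n) (Real.sqrt_le_sqrt (runQV_mono x n.le_succ))) le_rfl

lemma runGauge_zero (h0 : x 0 = 0) (hε : 0 < ε) : runGauge x ε 0 = ε := by
  simp [runGauge, gauge, runMax, runQV, h0, hε.le]

lemma runGauge_succ_le (hε : 0 < ε) (hθ : 0 ≤ θ) (hx : ∀ k, |x (k + 1) - x k| ≤ θ * ε) (n : ℕ) :
    runGauge x ε (n + 1) ≤ (1 + θ) * runGauge x ε n := by
  have h1 : ε ≤ runGauge x ε n := le_runGauge n
  have h2 : θ * ε ≤ θ * runGauge x ε n := by gcongr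
  have hW : 0 ≤ runGauge x ε n := hε.le.trans h1
  refine max_le (max_le (max_le ?_ ?_) ?_) ?_
  · nlinarith [runMax_le_runGauge (x := x) (ε := ε) n]
  · have h3 := abs_sub_abs_le_abs_sub (x (n + 1)) (x n)
    linarith [hx n, abs_le_runMax x n, runMax_le_runGauge (x := x) (ε := ε) n]
  · have h3 : √(runQV x (n + 1)) ≤ √(runQV x n) + |x (n + 1) - x n| := by
      rw [runQV_succ, Real.sqrt_le_left (by positivity)]
      have := Real.sq_sqrt (runQV_nonneg x n)
      have h5 := sq_abs (x (n + 1) - x n)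
      have : 0 ≤ √(runQV x n) * |x (n + 1) - x n| := by positivity
      nlinarith
    linarith [hx n, sqrt_runQV_le_runGauge (x := x) (ε := ε) n]
  · nlinarith

/-- Where the running maximum increases, it is attained. -/
lemma runGauge_sq_succ_sub_le (hε : 0 < ε) (n : ℕ) :
    runGauge x ε (n + 1) ^ 2 - runGauge x ε n ^ 2 ≤
      (runMax x (n + 1) ^ 2 - runMax x n ^ 2) + (x (n + 1) - x n) ^ 2 := by
  have hM0 := runMax_nonneg x n
  have hM1 := runMax_le_succ x n
  have hMW := runMax_le_runGauge (x := x) (ε := ε) n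
  have hQW := sqrt_runQV_le_runGauge (x := x) (ε := ε) n
  have hεW := le_runGauge (x := x) (ε := ε) n
  have hd : 0 ≤ runMax x (n + 1) ^ 2 - runMax x n ^ 2 := by nlinarith
  have hΔ := sq_nonneg (x (n + 1) - x n)
  have key : runGauge x ε (n + 1) = runMax x (n + 1) ∨
      runGauge x ε (n + 1) = √(runQV x (n + 1)) ∨ runGauge x ε (n + 1) = ε := by
    unfold runGauge gauge
    rcases max_choice (max (runMax x (n + 1)) (√(runQV x (n + 1)))) ε with h | h
    · rw [h]
      rcases max_choice (runMax x (n + 1)) (√(runQV x (n + 1))) with h | h <;> simp [h]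
    · simp [h]
  rcases key with h | h | h
  · rw [h]; nlinarith
  · rw [h, Real.sq_sqrt (runQV_nonneg _ _), runQV_succ]
    have := Real.sq_sqrt (runQV_nonneg x n)
    have := Real.sqrt_nonneg (runQV x n)
    nlinarith
  · rw [h]; nlinarith

lemma rpow_gauge_antitone (hε : 0 < ε) (hp : p ≤ 2) (n : ℕ) :
    runGauge x ε (n + 1) ^ (p - 2) ≤ runGauge x ε n ^ (p - 2) :=
  Real.rpow_le_rpow_of_nonpos (hε.trans_le (le_runGauge n)) (runGauge_le_succ n) (by linarith)

lemma rpow_gauge_monotone (hε : 0 < ε) (hp : 2 ≤ p) (n : ℕ) :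
    runGauge x ε n ^ (p - 2) ≤ runGauge x ε (n + 1) ^ (p - 2) :=
  Real.rpow_le_rpow (hε.le.trans (le_runGauge n)) (runGauge_le_succ n) (by linarith)

lemma rpow_gauge_le_of_le_two (hε : 0 < ε) (hθ : 0 ≤ θ) (hx : ∀ k, |x (k + 1) - x k| ≤ θ * ε)
    (hp : p ≤ 2) (n : ℕ) :
    runGauge x ε n ^ (p - 2) ≤ (1 + θ) ^ (2 - p) * runGauge x ε (n + 1) ^ (p - 2) := by
  have hW : 0 < runGauge x ε n := hε.trans_le (le_runGauge n)
  have h := Real.rpow_le_rpow_of_nonpos (hε.trans_le (le_runGauge (x := x) (n + 1)))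
    (runGauge_succ_le hε hθ hx n) (show p - 2 ≤ 0 by linarith)
  rw [Real.mul_rpow (by linarith) hW.le] at h
  have h1 : (1 + θ) ^ (2 - p) * (1 + θ) ^ (p - 2) = 1 := by
    rw [← Real.rpow_add (by linarith)]; simp
  have h2 := mul_le_mul_of_nonneg_left h (show 0 ≤ (1 + θ) ^ (2 - p) by positivity)
  rwa [← mul_assoc, h1, one_mul] at h2

lemma rpow_gauge_succ_le {r : ℝ} (hε : 0 < ε) (hθ : 0 ≤ θ)
    (hx : ∀ k, |x (k + 1) - x k| ≤ θ * ε) (hr : 0 ≤ r) (n : ℕ) :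
    runGauge x ε (n + 1) ^ r ≤ (1 + θ) ^ r * runGauge x ε n ^ r := by
  have hW : 0 < runGauge x ε n := hε.trans_le (le_runGauge n)
  rw [← Real.mul_rpow (by linarith) hW.le]
  exact Real.rpow_le_rpow (hε.le.trans (le_runGauge (n + 1))) (runGauge_succ_le hε hθ hx n) hr

/-- Summation by parts for `∑ W^{p-2} x Δx`, `p ≤ 2`: the term `W^{p-2} (M² - x²)` absorbs the
decrease of the weights. -/
lemma qv_potential_of_le_two (h0 : x 0 = 0) (hε : 0 < ε) (hθ : 0 ≤ θ)
    (hx : ∀ k, |x (k + 1) - x k| ≤ θ * ε) (hp1 : 1 ≤ p) (hp2 : p ≤ 2) (N : ℕ) :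
    2 / p * (runGauge x ε N ^ p - ε ^ p) +
        2 * ∑ k ∈ Finset.range N, x k * runGauge x ε k ^ (p - 2) * (x (k + 1) - x k) +
        runGauge x ε N ^ (p - 2) * (runMax x N ^ 2 - x N ^ 2) ≤
      4 / p * (1 + θ) * runMax x N ^ p := by
  have hp0 : 0 < p := by linarith
  induction N with
  | zero => simp [runGauge_zero h0 hε, runMax, h0, Real.zero_rpow hp0.ne']
  | succ n ih =>
    rw [Finset.sum_range_succ]
    have hW : 0 < runGauge x ε n := hε.trans_le (le_runGauge n)
    have hW' : 0 < runGauge x ε (n + 1) := hε.trans_le (le_runGauge (n + 1))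
    have hφ := rpow_gauge_antitone (x := x) hε hp2 n
    have hφ0 : 0 ≤ runGauge x ε n ^ (p - 2) := by positivity
    have hM0 := runMax_nonneg x n
    have hM1 := runMax_le_succ x n
    have hsq := runGauge_sq_succ_sub_le (x := x) hε n
    -- the increment of `W^p` is at most that of its tangent
    have t1 : 2 / p * (runGauge x ε (n + 1) ^ p - runGauge x ε n ^ p) ≤
        runGauge x ε n ^ (p - 2) * (runGauge x ε (n + 1) ^ 2 - runGauge x ε n ^ 2) := by
      have := rpow_tangent_of_le_two (a := runGauge x ε (n + 1)) hW'.le hW hp0.le hp2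
      rw [div_mul_eq_mul_div, div_le_iff₀ hp0]
      nlinarith
    have t2 : runGauge x ε n ^ (p - 2) * (runMax x (n + 1) ^ 2 - runMax x n ^ 2) ≤
        2 / p * (1 + θ) * (runMax x (n + 1) ^ p - runMax x n ^ p) := by
      rcases hM1.eq_or_lt with h | h
      · rw [h]; simp
      have hM' : 0 < runMax x (n + 1) := hM0.trans_lt h
      have a1 := rpow_gauge_le_of_le_two hε hθ hx hp2 n
      have a2 : (1 + θ) ^ (2 - p) ≤ 1 + θ := by
        conv_rhs => rw [← Real.rpow_one (1 + θ)]
        exact Real.rpow_le_rpow_of_exponent_le (by linarith) (by linarith)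
      have a3 : runGauge x ε (n + 1) ^ (p - 2) ≤ runMax x (n + 1) ^ (p - 2) :=
        Real.rpow_le_rpow_of_nonpos hM' (runMax_le_runGauge _) (by linarith)
      have a4 := rpow_tangent_of_le_two hM0 hM' hp0.le hp2
      have a5 : 0 ≤ runMax x (n + 1) ^ 2 - runMax x n ^ 2 := by nlinarith
      calc _ ≤ ((1 + θ) * runMax x (n + 1) ^ (p - 2)) *
            (runMax x (n + 1) ^ 2 - runMax x n ^ 2) := by
              gcongr
              exact a1.trans (by gcongr)
        _ = 2 / p * (1 + θ) * (p / 2 * (runMax x (n + 1) ^ (p - 2) *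
            (runMax x (n + 1) ^ 2 - runMax x n ^ 2))) := by field_simp
        _ ≤ _ := by gcongr
    have t3 : runGauge x ε (n + 1) ^ (p - 2) * (runMax x (n + 1) ^ 2 - x (n + 1) ^ 2) ≤
        runGauge x ε n ^ (p - 2) * (runMax x (n + 1) ^ 2 - x (n + 1) ^ 2) := by
      refine mul_le_mul_of_nonneg_right hφ ?_
      have := abs_le_runMax x (n + 1)
      rw [← sq_abs (x (n + 1))]
      nlinarith [abs_nonneg (x (n + 1))]
    have t4 := mul_le_mul_of_nonneg_left hsq hφ0
    have e : 4 / p * (1 + θ) * runMax x (n + 1) ^ p = 4 / p * (1 + θ) * runMax x n ^ p +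
        2 * (2 / p * (1 + θ) * (runMax x (n + 1) ^ p - runMax x n ^ p)) := by ring
    rw [e]
    nlinarith

/-- Summation by parts for `∑ W^{p-2} x Δx`, `p ≥ 2`. -/
lemma qv_potential_of_two_le (h0 : x 0 = 0) (hε : 0 < ε) (hθ : 0 ≤ θ)
    (hx : ∀ k, |x (k + 1) - x k| ≤ θ * ε) (hp : 2 ≤ p) (N : ℕ) :
    2 / p * (runGauge x ε N ^ p - ε ^ p) / (1 + θ) ^ (p - 2) +
        2 * ∑ k ∈ Finset.range N, x k * runGauge x ε k ^ (p - 2) * (x (k + 1) - x k) ≤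
      runGauge x ε N ^ (p - 2) * (runMax x N ^ 2 + x N ^ 2) := by
  have hp0 : 0 < p := by linarith
  induction N with
  | zero => simp [runGauge_zero h0 hε, runMax, h0]
  | succ n ih =>
    rw [Finset.sum_range_succ]
    have hW : 0 < runGauge x ε n := hε.trans_le (le_runGauge n)
    have hW' : 0 < runGauge x ε (n + 1) := hε.trans_le (le_runGauge (n + 1))
    have hφ := rpow_gauge_monotone (x := x) hε hp n
    have hφ0 : 0 ≤ runGauge x ε n ^ (p - 2) := by positivity
    have hsq := runGauge_sq_succ_sub_le (x := x) hε n
    have hc : 0 < (1 + θ) ^ (p - 2) := by positivity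
    have t1 : 2 / p * (runGauge x ε (n + 1) ^ p - runGauge x ε n ^ p) / (1 + θ) ^ (p - 2) ≤
        runGauge x ε n ^ (p - 2) * (runGauge x ε (n + 1) ^ 2 - runGauge x ε n ^ 2) := by
      have a1 := rpow_tangent_of_two_le hW.le hW' hp
      have a2 := rpow_gauge_succ_le (x := x) hε hθ hx (show 0 ≤ p - 2 by linarith) n
      have a3 : 0 ≤ runGauge x ε (n + 1) ^ 2 - runGauge x ε n ^ 2 := by
        nlinarith [runGauge_le_succ (x := x) (ε := ε) n]
      have a4 := mul_le_mul_of_nonneg_right a2 a3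
      rw [div_le_iff₀ hc, div_mul_eq_mul_div, div_le_iff₀ hp0]
      nlinarith
    have t3 : runGauge x ε n ^ (p - 2) * (runMax x (n + 1) ^ 2 + x (n + 1) ^ 2) ≤
        runGauge x ε (n + 1) ^ (p - 2) * (runMax x (n + 1) ^ 2 + x (n + 1) ^ 2) :=
      mul_le_mul_of_nonneg_right hφ (by positivity)
    have t4 := mul_le_mul_of_nonneg_left hsq hφ0
    have e : 2 / p * (runGauge x ε (n + 1) ^ p - ε ^ p) / (1 + θ) ^ (p - 2) =
        2 / p * (runGauge x ε (n + 1) ^ p - runGauge x ε n ^ p) / (1 + θ) ^ (p - 2) +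
        2 / p * (runGauge x ε n ^ p - ε ^ p) / (1 + θ) ^ (p - 2) := by ring
    rw [e]
    nlinarith

/-- The potential `|x|^{2p} / W^p`: when the gauge `W` grows through the running maximum,
`|x|^p = W^p`. -/
lemma max_potential (h0 : x 0 = 0) (hε : 0 < ε) (hp : 0 < p) (N : ℕ) :
    runGauge x ε N ^ p - ε ^ p + (|x N| ^ (2 * p)) / runGauge x ε N ^ p ≤
      runQV x N ^ (p / 2) + ∑ k ∈ Finset.range N,
        (|x (k + 1)| ^ (2 * p) - |x k| ^ (2 * p)) / runGauge x ε k ^ p := by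
  induction N with
  | zero =>
    simp [runGauge_zero h0 hε, runQV, h0, Real.zero_rpow (show 2 * p ≠ 0 by positivity),
      Real.zero_rpow (show p / 2 ≠ 0 by positivity)]
  | succ n ih =>
    rw [Finset.sum_range_succ]
    have hW : 0 < runGauge x ε n := hε.trans_le (le_runGauge n)
    have hW' : 0 < runGauge x ε (n + 1) := hε.trans_le (le_runGauge (n + 1))
    have hw : 0 < runGauge x ε n ^ p := by positivity
    have hw' : 0 < runGauge x ε (n + 1) ^ p := by positivity
    have hww : runGauge x ε n ^ p ≤ runGauge x ε (n + 1) ^ p :=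
      Real.rpow_le_rpow hW.le (runGauge_le_succ n) hp.le
    have hQ : runQV x n ^ (p / 2) ≤ runQV x (n + 1) ^ (p / 2) :=
      Real.rpow_le_rpow (runQV_nonneg x n) (runQV_mono x n.le_succ) (by positivity)
    set w := runGauge x ε n ^ p with hwdef
    set w' := runGauge x ε (n + 1) ^ p with hwdef'
    set y := |x (n + 1)| ^ (2 * p) with hy
    have hy0 : 0 ≤ y := by positivity
    have hyw : y / w' ≤ y / w := by gcongr
    have key : w' - w ≤ runQV x (n + 1) ^ (p / 2) - runQV x n ^ (p / 2) + (y / w - y / w') := by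
      rcases (runGauge_le_succ (x := x) (ε := ε) n).eq_or_lt with he | hlt
      · have : w' = w := by rw [hwdef, hwdef', he]
        linarith
      have hcase : runGauge x ε (n + 1) = √(runQV x (n + 1)) ∨
          runGauge x ε (n + 1) = |x (n + 1)| := by
        have hMW := runMax_le_runGauge (x := x) (ε := ε) n
        have hεW := le_runGauge (x := x) (ε := ε) n
        by_contra! hcon
        have h1 : runGauge x ε (n + 1) ≤ max (max (runMax x n) |x (n + 1)|)
          (√(runQV x (n + 1))) ∨ runGauge x ε (n + 1) ≤ ε := le_max_iff.1 le_rfl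
        rcases h1 with h1 | h1
        · rcases le_max_iff.1 h1 with h1 | h1
          · rcases le_max_iff.1 h1 with h1 | h1
            · linarith
            · exact hcon.2 (h1.antisymm ((abs_le_runMax x _).trans (runMax_le_runGauge _)))
          · exact hcon.1 (h1.antisymm (sqrt_runQV_le_runGauge _))
        · linarith
      have hQp : ∀ k, runQV x k ^ (p / 2) = √(runQV x k) ^ p := fun k => by
        rw [Real.sqrt_eq_rpow, ← Real.rpow_mul (runQV_nonneg x k)]; congr 1; ring
      rcases hcase with h | h
      · have h1 : w' = runQV x (n + 1) ^ (p / 2) := by rw [hwdef', h, hQp]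
        have h2 : runQV x n ^ (p / 2) ≤ w := by
          rw [hQp]
          exact Real.rpow_le_rpow (Real.sqrt_nonneg _) (sqrt_runQV_le_runGauge _) hp.le
        linarith
      · have h1 : y = w' * w' := by
          rw [hy, hwdef', ← h, two_mul, Real.rpow_add hW']
        have h2 : y / w' = w' := by rw [h1]; field_simp
        have h3 : 2 * w' - w ≤ y / w := by
          rw [le_div_iff₀ hw, h1]; nlinarith [sq_nonneg (w' - w)]
        linarith
    have e : (y - |x n| ^ (2 * p)) / w = y / w - |x n| ^ (2 * p) / w := sub_div _ _ _
    rw [e]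
    linarith

/-- The Taylor remainders in `max_potential`. -/
lemma rpow_gauge_le_sum (h0 : x 0 = 0) (hε : 0 < ε) (hθ : 0 ≤ θ)
    (hx : ∀ k, |x (k + 1) - x k| ≤ θ * ε) (hp : 1 ≤ p) (N : ℕ) :
    runGauge x ε N ^ p ≤ ε ^ p + runQV x N ^ (p / 2) +
      ∑ k ∈ Finset.range N, 2 * p * (|x k| ^ (2 * p - 2) * x k) * runGauge x ε k ^ (-p) *
        (x (k + 1) - x k) +
      p * (2 * p - 1) * (1 + θ) ^ (2 * p - 2) *
        ∑ k ∈ Finset.range N, runGauge x ε k ^ (p - 2) * (x (k + 1) - x k) ^ 2 := by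
  have hpot := max_potential h0 hε (show 0 < p by linarith) N
  have hN : 0 ≤ (|x N| ^ (2 * p)) / runGauge x ε N ^ p := by
    have : 0 ≤ runGauge x ε N := hε.le.trans (le_runGauge N)
    positivity
  have hsum : ∑ k ∈ Finset.range N,
      (|x (k + 1)| ^ (2 * p) - |x k| ^ (2 * p)) / runGauge x ε k ^ p ≤
      ∑ k ∈ Finset.range N, (2 * p * (|x k| ^ (2 * p - 2) * x k) * runGauge x ε k ^ (-p) *
        (x (k + 1) - x k) + p * (2 * p - 1) * (1 + θ) ^ (2 * p - 2) *
        (runGauge x ε k ^ (p - 2) * (x (k + 1) - x k) ^ 2)) := by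
    refine Finset.sum_le_sum fun k _ => ?_
    have hW : 0 < runGauge x ε k := hε.trans_le (le_runGauge k)
    have hT := abs_rpow_taylor (b := 2 * p) (m := runGauge x ε (k + 1)) (x := x k)
      (y := x (k + 1)) (by linarith)
      ((abs_le_runMax x k).trans ((runMax_le_runGauge k).trans (runGauge_le_succ k)))
      ((abs_le_runMax x _).trans (runMax_le_runGauge _))
    have hm := rpow_gauge_succ_le (x := x) hε hθ hx (show 0 ≤ 2 * p - 2 by linarith) k
    have e1 : runGauge x ε k ^ (2 * p - 2) * runGauge x ε k ^ (-p) =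
        runGauge x ε k ^ (p - 2) := by
      rw [← Real.rpow_add hW]; congr 1; ring
    rw [div_eq_mul_inv, ← Real.rpow_neg hW.le]
    have hw : 0 ≤ runGauge x ε k ^ (-p) := by positivity
    have hpp : 0 ≤ 2 * p * (2 * p - 1) / 2 := by
      have : 0 ≤ 2 * p - 1 := by linarith
      positivity
    have hT2 : |x (k + 1)| ^ (2 * p) - |x k| ^ (2 * p) ≤
        2 * p * (|x k| ^ (2 * p - 2) * x k) * (x (k + 1) - x k) +
        2 * p * (2 * p - 1) / 2 * ((1 + θ) ^ (2 * p - 2) * runGauge x ε k ^ (2 * p - 2)) *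
          (x (k + 1) - x k) ^ 2 := hT.trans (by gcongr)
    have := mul_le_mul_of_nonneg_right hT2 hw
    refine this.trans (le_of_eq ?_)
    rw [← e1]; ring
  rw [Finset.sum_add_distrib, ← Finset.mul_sum] at hsum
  linarith

lemma sum_rpow_gauge_mul_sq_le (hε : 0 < ε) (hθ : 0 ≤ θ)
    (hx : ∀ k, |x (k + 1) - x k| ≤ θ * ε) (hp : 1 ≤ p) (hp2 : p ≤ 2) (N : ℕ) :
    ∑ k ∈ Finset.range N, runGauge x ε k ^ (p - 2) * (x (k + 1) - x k) ^ 2 ≤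
      (1 + θ) ^ (2 - p) * (2 / p) * runQV x N ^ (p / 2) := by
  have hp0 : 0 < p := by linarith
  induction N with
  | zero => simp only [Finset.range_zero, Finset.sum_empty]; have := runQV_nonneg x 0; positivity
  | succ n ih =>
    rw [Finset.sum_range_succ]
    suffices runGauge x ε n ^ (p - 2) * (x (n + 1) - x n) ^ 2 ≤ (1 + θ) ^ (2 - p) * (2 / p) *
        (runQV x (n + 1) ^ (p / 2) - runQV x n ^ (p / 2)) by linarith
    have hQ0 := runQV_nonneg x n
    rcases (runQV_mono x n.le_succ).eq_or_lt with he | hlt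
    · have : (x (n + 1) - x n) ^ 2 = 0 := by have := runQV_succ x n; simp at he; linarith
      rw [Nat.succ_eq_add_one] at he
      rw [this, he]; simp
    have hQ' : 0 < √(runQV x (n + 1)) := Real.sqrt_pos.2 (hQ0.trans_lt hlt)
    have a1 := rpow_gauge_le_of_le_two hε hθ hx hp2 n
    have a3 : runGauge x ε (n + 1) ^ (p - 2) ≤ √(runQV x (n + 1)) ^ (p - 2) :=
      Real.rpow_le_rpow_of_nonpos hQ' (sqrt_runQV_le_runGauge _) (by linarith)
    have a4 := rpow_tangent_of_le_two (Real.sqrt_nonneg (runQV x n)) hQ' hp0.le hp2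
    have hQp : ∀ k, runQV x k ^ (p / 2) = √(runQV x k) ^ p := fun k => by
      rw [Real.sqrt_eq_rpow, ← Real.rpow_mul (runQV_nonneg x k)]; congr 1; ring
    rw [Real.sq_sqrt hQ0, Real.sq_sqrt (runQV_nonneg _ _), runQV_succ, add_sub_cancel_left,
      ← runQV_succ, ← hQp, ← hQp] at a4
    calc _ ≤ ((1 + θ) ^ (2 - p) * √(runQV x (n + 1)) ^ (p - 2)) * (x (n + 1) - x n) ^ 2 := by
          gcongr
          exact a1.trans (by gcongr)
      _ = (1 + θ) ^ (2 - p) * (2 / p) *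
          (p / 2 * (√(runQV x (n + 1)) ^ (p - 2) * (x (n + 1) - x n) ^ 2)) := by field_simp
      _ ≤ _ := by gcongr

lemma sum_rpow_gauge_mul_sq_le_of_two_le (hε : 0 < ε) (hp : 2 ≤ p) (N : ℕ) :
    ∑ k ∈ Finset.range N, runGauge x ε k ^ (p - 2) * (x (k + 1) - x k) ^ 2 ≤
      runGauge x ε N ^ (p - 2) * runQV x N := by
  unfold runQV
  rw [Finset.mul_sum]
  refine Finset.sum_le_sum fun k hk => ?_
  have : runGauge x ε k ^ (p - 2) ≤ runGauge x ε N ^ (p - 2) :=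
    Real.rpow_le_rpow (hε.le.trans (le_runGauge k))
      (monotone_nat_of_le_succ runGauge_le_succ (Finset.mem_range.1 hk).le) (by linarith)
  gcongr

end Steps

lemma continuous_gauge_rpow {ε : ℝ} (hε : 0 < ε) (r : ℝ) :
    Continuous fun z : ℝ × ℝ × ℝ => gauge ε z.2.1 z.2.2 ^ r := by
  refine Continuous.rpow_const ?_ fun z => Or.inl (hε.trans_le (le_max_right _ _)).ne'
  unfold gauge
  fun_prop

/-- A step size for which the powers of `1 + θ` in the estimates cost at most a factor `3 / 2`. -/
lemma exists_step_size {p : ℝ} (hp : 1 ≤ p) : ∃ θ : ℝ, 0 < θ ∧ (1 + θ) ^ (2 * p) ≤ 3 / 2 := by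
  refine ⟨(3 / 2) ^ (1 / (2 * p)) - 1, ?_, ?_⟩
  · have := Real.one_lt_rpow (show (1 : ℝ) < 3 / 2 by norm_num)
      (show 0 < 1 / (2 * p) by positivity)
    linarith
  · rw [add_sub_cancel, ← Real.rpow_mul (by norm_num), one_div_mul_cancel (by positivity),
      Real.rpow_one]

/-- Pathwise BDG inequality: the quadratic variation is bounded by the maximum and a discrete
stochastic integral, for sequences with small increments. The bound `δ` on the increments
and the additive error `η` disappear in the limit of continuous time. -/
theorem exists_weight_qv_le {p η : ℝ} (hp : 1 ≤ p) (hη : 0 < η) :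
    ∃ δ > 0, ∃ H : ℝ × ℝ × ℝ → ℝ, Continuous H ∧ ∀ x : ℕ → ℝ, x 0 = 0 →
      (∀ k, |x (k + 1) - x k| ≤ δ) → ∀ N, runQV x N ^ (p / 2) ≤
        (bdgLower p)⁻¹ * runMax x N ^ p + η +
          ∑ k ∈ Finset.range N, H (x k, runMax x k, runQV x k) * (x (k + 1) - x k) := by
  have hp0 : 0 < p := by linarith
  obtain ⟨θ, hθ, hθp⟩ := exists_step_size hp
  have hpow : ∀ r, r ≤ 2 * p → (1 + θ) ^ r ≤ 3 / 2 := fun r hr =>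
    (Real.rpow_le_rpow_of_exponent_le (by linarith) hr).trans hθp
  obtain ⟨ε, hε, hεη⟩ : ∃ ε : ℝ, 0 < ε ∧ ε ^ p = η / 2 := by
    refine ⟨(η / 2) ^ (1 / p), by positivity, ?_⟩
    rw [← Real.rpow_mul (by positivity), one_div_mul_cancel hp0.ne', Real.rpow_one]
  have hQp : ∀ (x : ℕ → ℝ) k, runQV x k ^ (p / 2) ≤ runGauge x ε k ^ p := fun x k => by
    have : runQV x k ^ (p / 2) = √(runQV x k) ^ p := by
      rw [Real.sqrt_eq_rpow, ← Real.rpow_mul (runQV_nonneg x k)]; congr 1; ring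
    rw [this]
    exact Real.rpow_le_rpow (Real.sqrt_nonneg _) (sqrt_runQV_le_runGauge _) hp0.le
  have hMp : ∀ (x : ℕ → ℝ) k, 0 ≤ runMax x k ^ p := fun x k => by
    have := runMax_nonneg x k
    positivity
  have hcts : ∀ c : ℝ, Continuous fun z : ℝ × ℝ × ℝ =>
      c * (z.1 * gauge ε z.2.1 z.2.2 ^ (p - 2)) := fun c =>
    continuous_const.mul (continuous_fst.mul (continuous_gauge_rpow hε _))
  have hsum : ∀ (c : ℝ) (x : ℕ → ℝ) N, ∑ k ∈ Finset.range N,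
      (c * (x k * gauge ε (runMax x k) (runQV x k) ^ (p - 2))) * (x (k + 1) - x k) =
      c * ∑ k ∈ Finset.range N, x k * runGauge x ε k ^ (p - 2) * (x (k + 1) - x k) := by
    intro c x N
    rw [Finset.mul_sum]
    exact Finset.sum_congr rfl fun k _ => by simp only [runGauge]; ring
  rcases le_total p 2 with hp2 | hp2
  · refine ⟨θ * ε, by positivity, _, hcts (-p), fun x h0 hx N => ?_⟩
    rw [hsum]
    have h := qv_potential_of_le_two h0 hε hθ.le hx hp hp2 N
    have h1 : 0 ≤ runGauge x ε N ^ (p - 2) * (runMax x N ^ 2 - x N ^ 2) := by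
      have h3 := abs_le_runMax x N
      have : 0 ≤ runGauge x ε N := hε.le.trans (le_runGauge N)
      refine mul_nonneg (by positivity) ?_
      rw [← sq_abs (x N)]
      nlinarith [abs_nonneg (x N)]
    set s := ∑ k ∈ Finset.range N, x k * runGauge x ε k ^ (p - 2) * (x (k + 1) - x k)
    have h2 : runGauge x ε N ^ p - ε ^ p + p * s ≤ 2 * (1 + θ) * runMax x N ^ p := by
      have h4 : 2 / p * (runGauge x ε N ^ p - ε ^ p) + 2 * s ≤
        4 / p * (1 + θ) * runMax x N ^ p := by linarith
      have h5 := mul_le_mul_of_nonneg_left h4 (show 0 ≤ p / 2 by positivity)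
      have e1 : p / 2 * (2 / p * (runGauge x ε N ^ p - ε ^ p) + 2 * s) =
        runGauge x ε N ^ p - ε ^ p + p * s := by field_simp
      have e2 : p / 2 * (4 / p * (1 + θ) * runMax x N ^ p) = 2 * (1 + θ) * runMax x N ^ p := by
        field_simp; ring
      rwa [e1, e2] at h5
    have h3 : (1 + θ) ≤ 3 / 2 := by simpa using hpow 1 (by linarith)
    have h4 := mul_le_mul_of_nonneg_right (three_le_inv_bdgLower hp) (hMp x N)
    have h5 := mul_le_mul_of_nonneg_right h3 (hMp x N)
    linarith [hQp x N]
  · refine ⟨θ * ε, by positivity, _, hcts (-(2 * (1 + θ) ^ (p - 2) * p)), fun x h0 hx N => ?_⟩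
    rw [hsum]
    have h := qv_potential_of_two_le h0 hε hθ.le hx hp2 N
    set s := ∑ k ∈ Finset.range N, x k * runGauge x ε k ^ (p - 2) * (x (k + 1) - x k)
    have hW : 0 < runGauge x ε N := hε.trans_le (le_runGauge N)
    set c := (1 + θ) ^ (p - 2) with hc
    have hc0 : 0 < c := by positivity
    have hc2 : c ≤ 3 / 2 := hpow _ (by linarith)
    have hx2 : x N ^ 2 ≤ runMax x N ^ 2 := by
      have h3 := abs_le_runMax x N
      rw [← sq_abs (x N)]
      nlinarith [abs_nonneg (x N)]
    have hT : 0 ≤ runGauge x ε N ^ (p - 2) := by positivity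
    have hT2 : 0 ≤ runGauge x ε N ^ (p - 2) * runMax x N ^ 2 := by positivity
    have h2 : runGauge x ε N ^ p ≤ 2 * p * (runGauge x ε N ^ (p - 2) * runMax x N ^ 2) +
        (ε ^ p - c * p * s) := by
      have h4 : 2 / p * (runGauge x ε N ^ p - ε ^ p) / c + 2 * s ≤
          2 * (runGauge x ε N ^ (p - 2) * runMax x N ^ 2) :=
        h.trans (by nlinarith)
      have h5 := mul_le_mul_of_nonneg_left h4 (show 0 ≤ c * p / 2 by positivity)
      have e1 : c * p / 2 * (2 / p * (runGauge x ε N ^ p - ε ^ p) / c + 2 * s) =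
        runGauge x ε N ^ p - ε ^ p + c * p * s := by field_simp
      rw [e1] at h5
      have : c * p ≤ 2 * p := by nlinarith
      have := mul_le_mul_of_nonneg_right this hT2
      linarith
    have h3 := rpow_le_of_le_mixed hW (runMax_nonneg x N) hp2 (by positivity) h2
    have h4 : (2 * (2 * p)) ^ (p / 2) ≤ bdgUpper p := by
      refine le_trans ?_ (three_mul_rpow_le_bdgUpper hp2)
      rw [← sq_rpow_half (by positivity : 0 ≤ 3 * p)]
      exact Real.rpow_le_rpow (by positivity) (by nlinarith) (by positivity)
    rw [inv_bdgLower_of_two_le hp2]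
    have h5 := mul_le_mul_of_nonneg_right h4 (hMp x N)
    linarith [hQp x N]

/-- Pathwise BDG inequality: the maximum is bounded by the quadratic variation and a discrete
stochastic integral, for sequences with small increments. -/
theorem exists_weight_max_le {p η : ℝ} (hp : 1 ≤ p) (hη : 0 < η) :
    ∃ δ > 0, ∃ H : ℝ × ℝ × ℝ → ℝ, Continuous H ∧ ∀ x : ℕ → ℝ, x 0 = 0 →
      (∀ k, |x (k + 1) - x k| ≤ δ) → ∀ N, runMax x N ^ p ≤
        bdgUpper p * runQV x N ^ (p / 2) + η +
          ∑ k ∈ Finset.range N, H (x k, runMax x k, runQV x k) * (x (k + 1) - x k) := by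
  have hp0 : 0 < p := by linarith
  obtain ⟨θ, hθ, hθp⟩ := exists_step_size hp
  have hpow : ∀ r, r ≤ 2 * p → (1 + θ) ^ r ≤ 3 / 2 := fun r hr =>
    (Real.rpow_le_rpow_of_exponent_le (by linarith) hr).trans hθp
  obtain ⟨ε, hε, hεη⟩ : ∃ ε : ℝ, 0 < ε ∧ ε ^ p = η / 2 := by
    refine ⟨(η / 2) ^ (1 / p), by positivity, ?_⟩
    rw [← Real.rpow_mul (by positivity), one_div_mul_cancel hp0.ne', Real.rpow_one]
  have hMp : ∀ (x : ℕ → ℝ) k, runMax x k ^ p ≤ runGauge x ε k ^ p := fun x k =>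
    Real.rpow_le_rpow (runMax_nonneg x k) (runMax_le_runGauge _) hp0.le
  have hQp : ∀ (x : ℕ → ℝ) k, 0 ≤ runQV x k ^ (p / 2) := fun x k => by
    have := runQV_nonneg x k
    positivity
  have hcts : ∀ c : ℝ, Continuous fun z : ℝ × ℝ × ℝ =>
      c * (2 * p * (|z.1| ^ (2 * p - 2) * z.1) * gauge ε z.2.1 z.2.2 ^ (-p)) := fun c =>
    continuous_const.mul ((continuous_const.mul
      ((continuous_fst.abs.rpow_const fun _ => Or.inr (by linarith)).mul continuous_fst)).mul
      (continuous_gauge_rpow hε _))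
  have hsum : ∀ (c : ℝ) (x : ℕ → ℝ) N, ∑ k ∈ Finset.range N,
      (c * (2 * p * (|x k| ^ (2 * p - 2) * x k) * gauge ε (runMax x k) (runQV x k) ^ (-p))) *
        (x (k + 1) - x k) =
      c * ∑ k ∈ Finset.range N, 2 * p * (|x k| ^ (2 * p - 2) * x k) * runGauge x ε k ^ (-p) *
        (x (k + 1) - x k) := by
    intro c x N
    rw [Finset.mul_sum]
    exact Finset.sum_congr rfl fun k _ => by simp only [runGauge]; ring
  rcases le_total p 2 with hp2 | hp2
  · refine ⟨θ * ε, by positivity, _, hcts 1, fun x h0 hx N => ?_⟩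
    rw [hsum]
    have h := rpow_gauge_le_sum h0 hε hθ.le hx hp N
    have h1 := sum_rpow_gauge_mul_sq_le hε hθ.le hx hp hp2 N
    set s := ∑ k ∈ Finset.range N, 2 * p * (|x k| ^ (2 * p - 2) * x k) * runGauge x ε k ^ (-p) *
      (x (k + 1) - x k)
    have hc : (1 + θ) ^ (2 * p - 2) * (1 + θ) ^ (2 - p) ≤ 3 / 2 := by
      rw [← Real.rpow_add (by linarith)]
      exact hpow _ (by linarith)
    have h2p : 0 ≤ p * (2 * p - 1) := by nlinarith
    have h3 : p * (2 * p - 1) * (1 + θ) ^ (2 * p - 2) *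
        ∑ k ∈ Finset.range N, runGauge x ε k ^ (p - 2) * (x (k + 1) - x k) ^ 2 ≤
        (6 * p - 3) * runQV x N ^ (p / 2) := by
      calc _ ≤ p * (2 * p - 1) * (1 + θ) ^ (2 * p - 2) *
            ((1 + θ) ^ (2 - p) * (2 / p) * runQV x N ^ (p / 2)) := by gcongr
        _ = (2 * (2 * p - 1) * runQV x N ^ (p / 2)) *
            ((1 + θ) ^ (2 * p - 2) * (1 + θ) ^ (2 - p)) := by field_simp
        _ ≤ (2 * (2 * p - 1) * runQV x N ^ (p / 2)) * (3 / 2) := by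
            have := hQp x N
            have : 0 ≤ 2 * p - 1 := by linarith
            gcongr
        _ = _ := by ring
    have h4 := mul_le_mul_of_nonneg_right (six_mul_sub_one_le_bdgUpper hp) (hQp x N)
    linarith [hMp x N, hQp x N]
  · refine ⟨θ * ε, by positivity, _, hcts 2, fun x h0 hx N => ?_⟩
    rw [hsum]
    have h := rpow_gauge_le_sum h0 hε hθ.le hx hp N
    have h1 := sum_rpow_gauge_mul_sq_le_of_two_le (x := x) hε hp2 N
    set s := ∑ k ∈ Finset.range N, 2 * p * (|x k| ^ (2 * p - 2) * x k) * runGauge x ε k ^ (-p) *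
      (x (k + 1) - x k)
    have hW : 0 < runGauge x ε N := hε.trans_le (le_runGauge N)
    have hQ0 := runQV_nonneg x N
    have hsq : √(runQV x N) ^ 2 = runQV x N := Real.sq_sqrt hQ0
    have h2 : runQV x N ^ (p / 2) ≤ runGauge x ε N ^ (p - 2) * runQV x N := by
      calc runQV x N ^ (p / 2) = runQV x N ^ (p / 2 - 1 + 1) := by congr 1; ring
        _ = runQV x N ^ (p / 2 - 1) * runQV x N := by
            rw [Real.rpow_add_of_nonneg hQ0 (by linarith) zero_le_one, Real.rpow_one]
        _ ≤ _ := by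
            gcongr
            rw [show p / 2 - 1 = (p - 2) / 2 by ring, ← hsq, sq_rpow_half (Real.sqrt_nonneg _)]
            exact Real.rpow_le_rpow (Real.sqrt_nonneg _) (sqrt_runQV_le_runGauge _)
              (by linarith)
    have hc : (1 + θ) ^ (2 * p - 2) ≤ 3 / 2 := hpow _ (by linarith)
    set T := runGauge x ε N ^ (p - 2) * runQV x N
    have hT : 0 ≤ T := by positivity
    have h2p : 0 ≤ p * (2 * p - 1) := by nlinarith
    have h3 : p * (2 * p - 1) * (1 + θ) ^ (2 * p - 2) *
        ∑ k ∈ Finset.range N, runGauge x ε k ^ (p - 2) * (x (k + 1) - x k) ^ 2 ≤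
        p * (2 * p - 1) * (3 / 2) * T := by
      refine mul_le_mul (mul_le_mul_of_nonneg_left hc h2p) h1
        (Finset.sum_nonneg fun k _ => ?_) (by positivity)
      have : 0 < runGauge x ε k := hε.trans_le (le_runGauge k)
      positivity
    have h5 : runGauge x ε N ^ p ≤ 9 * p ^ 2 / 2 * (runGauge x ε N ^ (p - 2) *
        √(runQV x N) ^ 2) + (ε ^ p + s) := by
      rw [hsq]
      have : (1 + p * (2 * p - 1) * (3 / 2)) * T ≤ 9 * p ^ 2 / 2 * T := by
        gcongr
        nlinarith
      linarith
    have h6 := rpow_le_of_le_mixed hW (Real.sqrt_nonneg _) hp2 (by positivity) h5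
    rw [← sq_rpow_half (Real.sqrt_nonneg _), hsq] at h6
    have h7 : (2 * (9 * p ^ 2 / 2)) ^ (p / 2) ≤ bdgUpper p := by
      refine le_trans (le_of_eq ?_) (three_mul_rpow_le_bdgUpper hp2)
      rw [← sq_rpow_half (by positivity : 0 ≤ 3 * p)]
      congr 1; ring
    have h8 := mul_le_mul_of_nonneg_right h7 (hQp x N)
    linarith [hMp x N]

end ModelFree

namespace ModelFree

/-! ### Truncated stopping times -/

section Clip

variable {Ω : Type*}

/-- The finite time `τ ∧ t`. -/
def clip (τ : Ω → WithTop ℝ≥0) (t : ℝ≥0) (ω : Ω) : ℝ≥0 := (min (t : WithTop ℝ≥0) (τ ω)).untopA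

variable {τ ρ : Ω → WithTop ℝ≥0} {t s : ℝ≥0} {ω : Ω}

lemma stoppedProcess_apply {β : Type*} (X : ℝ≥0 → Ω → β) (τ : Ω → WithTop ℝ≥0) (t : ℝ≥0) (ω : Ω) :
    stoppedProcess X τ t ω = X (clip τ t ω) ω := rfl

lemma coe_clip (τ : Ω → WithTop ℝ≥0) (t : ℝ≥0) (ω : Ω) :
    (clip τ t ω : WithTop ℝ≥0) = min (t : WithTop ℝ≥0) (τ ω) := by
  have h : min (t : WithTop ℝ≥0) (τ ω) ≠ ⊤ :=
    ne_top_of_le_ne_top WithTop.coe_ne_top (min_le_left _ _)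
  unfold clip
  rw [WithTop.untopA_eq_untop h, WithTop.coe_untop]

lemma clip_eq_iff : clip τ t ω = s ↔ min (t : WithTop ℝ≥0) (τ ω) = s := by
  rw [← coe_clip, WithTop.coe_inj]

lemma le_clip_iff : s ≤ clip τ t ω ↔ s ≤ t ∧ (s : WithTop ℝ≥0) ≤ τ ω := by
  rw [← WithTop.coe_le_coe, coe_clip, le_min_iff, WithTop.coe_le_coe]

lemma clip_le_iff : clip τ t ω ≤ s ↔ t ≤ s ∨ τ ω ≤ (s : WithTop ℝ≥0) := by
  rw [← WithTop.coe_le_coe, coe_clip, min_le_iff, WithTop.coe_le_coe]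

lemma clip_le : clip τ t ω ≤ t := clip_le_iff.2 (Or.inl le_rfl)

lemma coe_clip_le : (clip τ t ω : WithTop ℝ≥0) ≤ τ ω := by rw [coe_clip]; exact min_le_right _ _

lemma clip_of_le (h : (t : WithTop ℝ≥0) ≤ τ ω) : clip τ t ω = t :=
  clip_le.antisymm (le_clip_iff.2 ⟨le_rfl, h⟩)

lemma clip_of_eq (h : τ ω = s) (hst : s ≤ t) : clip τ t ω = s := by
  rw [clip_eq_iff, h, min_eq_right (WithTop.coe_le_coe.2 hst)]

lemma clip_mono (h : τ ω ≤ ρ ω) : clip τ t ω ≤ clip ρ t ω :=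
  le_clip_iff.2 ⟨clip_le, coe_clip_le.trans h⟩

lemma clip_min : clip (fun ω => min (τ ω) (ρ ω)) t ω = min (clip τ t ω) (clip ρ t ω) := by
  rw [clip_eq_iff, WithTop.coe_min, coe_clip, coe_clip]
  grind

lemma clip_max : clip (fun ω => max (τ ω) (ρ ω)) t ω = max (clip τ t ω) (clip ρ t ω) := by
  rw [clip_eq_iff, WithTop.coe_max, coe_clip, coe_clip]
  grind

lemma clip_clip : clip τ (clip ρ t ω) ω = min (clip τ t ω) (clip ρ t ω) := by
  rw [clip_eq_iff, WithTop.coe_min, coe_clip, coe_clip]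
  grind

lemma clip_zero_right : clip τ 0 ω = 0 := le_antisymm clip_le zero_le

lemma clip_of_eq_zero (h : τ ω = 0) : clip τ t ω = 0 := clip_of_eq h zero_le

lemma monotone_clip (τ : Ω → WithTop ℝ≥0) (ω : Ω) : Monotone fun t => clip τ t ω := fun _ _ h =>
  le_clip_iff.2 ⟨clip_le.trans h, coe_clip_le⟩

lemma continuous_clip (τ : Ω → WithTop ℝ≥0) (ω : Ω) : Continuous fun t => clip τ t ω := by
  rcases eq_or_ne (τ ω) ⊤ with h | h
  · have : (fun t => clip τ t ω) = id := funext fun t => clip_of_le (by rw [h]; exact le_top)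
    rw [this]; exact continuous_id
  · obtain ⟨a, ha⟩ := WithTop.ne_top_iff_exists.1 h
    have : (fun t => clip τ t ω) = fun t => min t a := funext fun t => by
      rw [clip_eq_iff, ← ha, WithTop.coe_min]
    rw [this]; fun_prop

end Clip

variable {Ω : Type*} [m : MeasurableSpace Ω] {d : ℕ}

/-! ### Stopping times -/

section Stopping

variable {ℱ : Filtration ℝ≥0 m} {τ ρ : Ω → WithTop ℝ≥0}

lemma measurable_indicator_stopping (hτ : IsStoppingTime ℱ τ) {g : Ω → ℝ}
    (hg : Measurable[hτ.measurableSpace] g) (t : ℝ≥0) :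
    Measurable[ℱ t] ({ω | τ ω ≤ t}.indicator g) := by
  classical
  intro s hs
  rw [Set.indicator_preimage, Set.ite]
  refine MeasurableSet.union ((hg hs).2 t) (MeasurableSet.diff ?_ (hτ t))
  exact measurable_const hs

lemma measurable_indicator_le (hτ : IsStoppingTime ℱ τ) (hρ : IsStoppingTime ℱ ρ) {g : Ω → ℝ}
    (hg : Measurable[hτ.measurableSpace] g) :
    Measurable[(hτ.min hρ).measurableSpace] ({ω | τ ω ≤ ρ ω}.indicator g) := by
  classical
  intro s hs
  rw [Set.indicator_preimage, Set.ite]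
  refine MeasurableSet.union (IsStoppingTime.measurableSet_inter_le hτ hρ _ (hg hs))
    (MeasurableSet.diff ?_ (IsStoppingTime.measurableSet_stopping_time_le_min hτ hρ))
  exact measurable_const hs

/-- A criterion for `F_τ`-measurability: agreement on each `{τ ≤ t}` with an `F_t`-measurable
function. -/
lemma measurable_stopping_of_local (hτ : IsStoppingTime ℱ τ) {g : Ω → ℝ} (G : ℝ≥0 → Ω → ℝ)
    (hG : ∀ t, Measurable[ℱ t] (G t)) (hg : ∀ (t : ℝ≥0) ω, τ ω ≤ t → g ω = G t ω)
    (htop : ∀ ω, τ ω = ⊤ → g ω = 0) : Measurable[hτ.measurableSpace] g := by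
  intro s hs
  have h1 : ∀ t : ℝ≥0, MeasurableSet[ℱ t] (g ⁻¹' s ∩ {ω | τ ω ≤ t}) := by
    intro t
    have : g ⁻¹' s ∩ {ω | τ ω ≤ t} = G t ⁻¹' s ∩ {ω | τ ω ≤ t} := by
      ext ω
      simp only [Set.mem_inter_iff, Set.mem_preimage, Set.mem_ofPred_eq]
      exact and_congr_left fun h => by rw [hg t ω h]
    rw [this]
    exact (hG t hs).inter (hτ t)
  refine ⟨?_, h1⟩
  have h2 : g ⁻¹' s = (⋃ n : ℕ, g ⁻¹' s ∩ {ω | τ ω ≤ (n : ℝ≥0)}) ∪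
      ({ω | τ ω = ⊤} ∩ {_ω | (0 : ℝ) ∈ s}) := by
    ext ω
    simp only [Set.mem_union, Set.mem_iUnion, Set.mem_inter_iff, Set.mem_preimage,
      Set.mem_ofPred_eq]
    constructor
    · intro h
      rcases eq_or_ne (τ ω) ⊤ with h' | h'
      · exact Or.inr ⟨h', htop ω h' ▸ h⟩
      · obtain ⟨a, ha⟩ := WithTop.ne_top_iff_exists.1 h'
        obtain ⟨n, hn⟩ := exists_nat_ge a
        exact Or.inl ⟨n, h, by rw [← ha]; exact WithTop.coe_le_coe.2 hn⟩
    · rintro (⟨n, h, -⟩ | ⟨h, h'⟩)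
      · exact h
      · rw [htop ω h]; exact h'
  rw [h2]
  refine MeasurableSet.union (MeasurableSet.iUnion fun n => ?_)
    (MeasurableSet.inter hτ.measurableSet_eq_top' (MeasurableSet.const _))
  exact (le_iSup (fun t => (ℱ t : MeasurableSpace Ω)) (n : ℝ≥0)) _ (h1 n)

end Stopping

/-! ### Operations on simple trading strategies -/

namespace SimpleStrategy

variable {ℱ : Filtration ℝ≥0 m}

/-- The summands of the capital. -/
def gain (G : SimpleStrategy ℱ) (X : ℝ≥0 → Ω → ℝ) (t : ℝ≥0) (ω : Ω) (n : ℕ) : ℝ :=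
  G.g n ω * (X (clip (G.τ (n + 1)) t ω) ω - X (clip (G.τ n) t ω) ω)

lemma integral_eq (G : SimpleStrategy ℱ) (X : ℝ≥0 → Ω → ℝ) (t : ℝ≥0) (ω : Ω) :
    G.integral X t ω = G.c + ∑' n, G.gain X t ω n := rfl

/-- Up to time `t` only finitely many trades take place. -/
lemma exists_gain_eq_zero (G : SimpleStrategy ℱ) (t : ℝ≥0) (ω : Ω) :
    ∃ N, ∀ n ≥ N, ∀ s ≤ t, ∀ X, G.gain X s ω n = 0 := by
  rcases G.proper.diverges_or_const ω with h | ⟨N, h⟩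
  · obtain ⟨N, hN⟩ := h t
    refine ⟨N, fun n hn s hs X => ?_⟩
    have hs' : (s : WithTop ℝ≥0) ≤ t := WithTop.coe_le_coe.2 hs
    rw [gain, clip_of_le (hs'.trans (hN _ (hn.trans n.le_succ)).le),
      clip_of_le (hs'.trans (hN _ hn).le), sub_self, mul_zero]
  · refine ⟨N, fun n hn s _ X => ?_⟩
    have : clip (G.τ (n + 1)) s ω = clip (G.τ n) s ω := by
      unfold clip; rw [h n hn, h (n + 1) (hn.trans n.le_succ)]
    rw [gain, this, sub_self, mul_zero]

lemma hasSum_gain (G : SimpleStrategy ℱ) (X : ℝ≥0 → Ω → ℝ) (t : ℝ≥0) (ω : Ω) :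
    HasSum (G.gain X t ω) (∑' n, G.gain X t ω n) := by
  obtain ⟨N, hN⟩ := G.exists_gain_eq_zero t ω
  refine (summable_of_ne_finset_zero (s := Finset.range N) fun n hn => ?_).hasSum
  exact hN n (by simpa using hn) t le_rfl X

lemma integral_zero (G : SimpleStrategy ℱ) (X : ℝ≥0 → Ω → ℝ) (ω : Ω) : G.integral X 0 ω = G.c := by
  simp [integral_eq, gain, clip_zero_right]

/-- The trivial strategy with initial capital `c`. -/
def const (ℱ : Filtration ℝ≥0 m) (c : ℝ) : SimpleStrategy ℱ where
  c := c
  τ _ _ := ((0 : ℝ≥0) : WithTop ℝ≥0)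
  g _ _ := 0
  proper :=
    { stopping := fun _ => isStoppingTime_const ℱ 0
      mono := fun _ _ => le_rfl
      zero := fun _ => rfl
      diverges_or_const := fun _ => Or.inr ⟨0, fun _ _ => rfl⟩ }
  bounded _ := ⟨0, by simp⟩
  measurable _ := measurable_const
  zero_of_top _ _ _ := rfl

lemma integral_const (c : ℝ) (X : ℝ≥0 → Ω → ℝ) (t : ℝ≥0) (ω : Ω) :
    (const ℱ c).integral X t ω = c := by
  simp [integral_eq, gain, const]

/-- The multiple `a G` of a strategy. -/
def scale (a : ℝ) (G : SimpleStrategy ℱ) : SimpleStrategy ℱ where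
  c := a * G.c
  τ := G.τ
  g n ω := a * G.g n ω
  proper := G.proper
  bounded n := by
    obtain ⟨K, hK⟩ := G.bounded n
    exact ⟨|a| * K, fun ω => by rw [abs_mul]; gcongr; exact hK ω⟩
  measurable n := (G.measurable n).const_mul a
  zero_of_top n ω h := by rw [G.zero_of_top n ω h, mul_zero]

lemma integral_scale (a : ℝ) (G : SimpleStrategy ℱ) (X : ℝ≥0 → Ω → ℝ) (t : ℝ≥0) (ω : Ω) :
    (scale a G).integral X t ω = a * G.integral X t ω := by
  rw [integral_eq, integral_eq, mul_add, ← tsum_mul_left]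
  congr 1
  exact tsum_congr fun n => mul_assoc _ _ _

/-- The strategy `G` stopped at `ρ`. -/
def stopped (G : SimpleStrategy ℱ) {ρ : Ω → WithTop ℝ≥0} (hρ : IsStoppingTime ℱ ρ) :
    SimpleStrategy ℱ where
  c := G.c
  τ n ω := min (G.τ n ω) (ρ ω)
  g n := {ω | G.τ n ω ≤ ρ ω}.indicator (G.g n)
  proper :=
    { stopping := fun n => (G.proper.stopping n).min hρ
      mono := fun n ω => min_le_min_right _ (G.proper.mono n ω)
      zero := fun ω => by rw [G.proper.zero ω]; exact min_eq_left zero_le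
      diverges_or_const := fun ω => by
        rcases G.proper.diverges_or_const ω with h | ⟨N, h⟩
        · rcases eq_or_ne (ρ ω) ⊤ with h' | h'
          · left; simpa [h'] using h
          · right
            obtain ⟨a, ha⟩ := WithTop.ne_top_iff_exists.1 h'
            obtain ⟨N, hN⟩ := h a
            refine ⟨N, fun n hn => ?_⟩
            rw [← ha, min_eq_right (hN n hn).le, min_eq_right (hN N le_rfl).le]
        · exact Or.inr ⟨N, fun n hn => by rw [h n hn]⟩ }
  bounded n := by
    obtain ⟨K, hK⟩ := G.bounded n
    refine ⟨K, fun ω => ?_⟩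
    by_cases h : ω ∈ {ω | G.τ n ω ≤ ρ ω}
    · rw [Set.indicator_of_mem h]; exact hK ω
    · rw [Set.indicator_of_notMem h, abs_zero]; exact (abs_nonneg _).trans (hK ω)
  measurable n := measurable_indicator_le (G.proper.stopping n) hρ (G.measurable n)
  zero_of_top n ω h := by
    rw [Set.indicator_apply_eq_zero]
    exact fun _ => G.zero_of_top n ω (min_eq_top.1 h).1

lemma integral_stopped (G : SimpleStrategy ℱ) {ρ : Ω → WithTop ℝ≥0} (hρ : IsStoppingTime ℱ ρ)
    (X : ℝ≥0 → Ω → ℝ) (t : ℝ≥0) (ω : Ω) :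
    (G.stopped hρ).integral X t ω = G.integral X (clip ρ t ω) ω := by
  rw [integral_eq, integral_eq]
  congr 1
  refine tsum_congr fun n => ?_
  simp only [gain, stopped, clip_min, clip_clip]
  by_cases h : G.τ n ω ≤ ρ ω
  · rw [Set.indicator_of_mem (by exact h)]
  · have h1 : clip ρ t ω ≤ clip (G.τ n) t ω := clip_mono (not_le.1 h).le
    have h2 : clip ρ t ω ≤ clip (G.τ (n + 1)) t ω :=
      h1.trans (clip_mono (G.proper.mono n ω))
    rw [min_eq_right h1, min_eq_right h2, sub_self, mul_zero, mul_zero]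

/-- The strategy that starts at the time `a`, where it takes the `F_a`-measurable multiple `g` of
the positions of `G`. A trading time `0` without position is put in front. -/
def after (G : SimpleStrategy ℱ) {a : Ω → WithTop ℝ≥0} (ha : IsStoppingTime ℱ a) {g : Ω → ℝ}
    (hg : Measurable[ha.measurableSpace] g) (hb : ∃ K : ℝ, ∀ ω, |g ω| ≤ K)
    (htop : ∀ ω, a ω = ⊤ → g ω = 0) : SimpleStrategy ℱ where
  c := 0
  τ n := match n with
    | 0 => fun _ => ((0 : ℝ≥0) : WithTop ℝ≥0)
    | n + 1 => fun ω => max (G.τ n ω) (a ω)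
  g n := match n with
    | 0 => fun _ => 0
    | n + 1 => fun ω => g ω * G.g n ω
  proper :=
    { stopping := fun n => match n with
        | 0 => isStoppingTime_const ℱ 0
        | n + 1 => (G.proper.stopping n).max ha
      mono := fun n ω => match n with
        | 0 => bot_le
        | n + 1 => max_le_max_right _ (G.proper.mono n ω)
      zero := fun _ => rfl
      diverges_or_const := fun ω => by
        rcases G.proper.diverges_or_const ω with h | ⟨N, h⟩
        · refine Or.inl fun K => ?_
          obtain ⟨N, hN⟩ := h K
          refine ⟨N + 1, fun n hn => ?_⟩
          obtain ⟨n, rfl⟩ : ∃ l, n = l + 1 := ⟨n - 1, by omega⟩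
          exact lt_max_of_lt_left (hN n (by omega))
        · refine Or.inr ⟨N + 1, fun n hn => ?_⟩
          obtain ⟨n, rfl⟩ : ∃ l, n = l + 1 := ⟨n - 1, by omega⟩
          simp only [h n (by omega)] }
  bounded n := match n with
    | 0 => ⟨0, by simp⟩
    | n + 1 => by
      obtain ⟨K, hK⟩ := G.bounded n
      obtain ⟨L, hL⟩ := hb
      refine ⟨L * K, fun ω => ?_⟩
      rw [abs_mul]
      exact mul_le_mul (hL ω) (hK ω) (abs_nonneg _) ((abs_nonneg _).trans (hL ω))
  measurable n := match n with
    | 0 => measurable_const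
    | n + 1 => (hg.mono (IsStoppingTime.measurableSpace_mono ha _ fun _ => le_max_right _ _)
        le_rfl).mul ((G.measurable n).mono
        (IsStoppingTime.measurableSpace_mono _ _ fun _ => le_max_left _ _) le_rfl)
  zero_of_top n ω h := match n with
    | 0 => rfl
    | n + 1 => by
      rcases max_eq_top.1 h with h | h
      · simp only [G.zero_of_top n ω h, mul_zero]
      · simp only [htop ω h, zero_mul]

lemma integral_after (G : SimpleStrategy ℱ) {a : Ω → WithTop ℝ≥0} (ha : IsStoppingTime ℱ a)
    {g : Ω → ℝ} (hg : Measurable[ha.measurableSpace] g) (hb : ∃ K : ℝ, ∀ ω, |g ω| ≤ K)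
    (htop : ∀ ω, a ω = ⊤ → g ω = 0) (X : ℝ≥0 → Ω → ℝ) (t : ℝ≥0) (ω : Ω) :
    (G.after ha hg hb htop).integral X t ω =
      g ω * (G.integral X t ω - G.integral X (clip a t ω) ω) := by
  have h1 := ((G.hasSum_gain X t ω).sub (G.hasSum_gain X (clip a t ω) ω)).mul_left (g ω)
  have h2 := ((G.after ha hg hb htop).hasSum_gain X t ω)
  have h3 : ∀ n, (G.after ha hg hb htop).gain X t ω (n + 1) =
      g ω * (G.gain X t ω n - G.gain X (clip a t ω) ω n) := by
    intro n
    have key : ∀ r : ℝ≥0, X (max r (clip a t ω)) ω - X (min r (clip a t ω)) ω =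
        X r ω + X (clip a t ω) ω - 2 * X (min r (clip a t ω)) ω := by
      intro r
      rcases le_total r (clip a t ω) with h | h
      · rw [max_eq_right h, min_eq_left h]; ring
      · rw [max_eq_left h, min_eq_right h]; ring
    simp only [gain, after, clip_max, clip_clip]
    have k1 := key (clip (G.τ (n + 1)) t ω)
    have k2 := key (clip (G.τ n) t ω)
    have : X (max (clip (G.τ (n + 1)) t ω) (clip a t ω)) ω -
        X (max (clip (G.τ n) t ω) (clip a t ω)) ω =
        (X (clip (G.τ (n + 1)) t ω) ω - X (clip (G.τ n) t ω) ω) -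
        (X (min (clip (G.τ (n + 1)) t ω) (clip a t ω)) ω -
          X (min (clip (G.τ n) t ω) (clip a t ω)) ω) := by linarith
    rw [this]; ring
  have h0 : (G.after ha hg hb htop).gain X t ω 0 = 0 := by simp [gain, after]
  have h4 : ∑' n, (G.after ha hg hb htop).gain X t ω n =
      ∑' n, (G.after ha hg hb htop).gain X t ω (n + 1) := by
    rw [h2.summable.tsum_eq_zero_add, h0, zero_add]
  rw [integral_eq, h4, tsum_congr h3, h1.tsum_eq, integral_eq, integral_eq]
  simp [after]

lemma continuous_integral (G : SimpleStrategy ℱ) {X : ℝ≥0 → Ω → ℝ} {ω : Ω}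
    (hX : Continuous fun t => X t ω) : Continuous fun t => G.integral X t ω := by
  rw [continuous_iff_continuousAt]
  intro t
  obtain ⟨N, hN⟩ := G.exists_gain_eq_zero (t + 1) ω
  have h1 : ∀ s ≤ t + 1, G.integral X s ω = G.c + ∑ n ∈ Finset.range N, G.gain X s ω n := by
    intro s hs
    rw [integral_eq, tsum_eq_sum (s := Finset.range N) fun n hn =>
      hN n (by simpa using hn) s hs X]
  have h2 : Continuous fun s => G.c + ∑ n ∈ Finset.range N, G.gain X s ω n := by
    refine continuous_const.add (continuous_finsetSum _ fun n _ => continuous_const.mul ?_)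
    exact (hX.comp (continuous_clip _ ω)).sub (hX.comp (continuous_clip _ ω))
  refine h2.continuousAt.congr ?_
  filter_upwards [Iic_mem_nhds (show t < t + 1 by simp)] with s hs using (h1 s hs).symm

end SimpleStrategy

end ModelFree

namespace ModelFree

/-! ### Hitting times of levels -/

section HittingTimes

variable {Ω : Type*}

open Classical in
/-- The first time outside of `B` at which `U` is at least `a`. -/
def hitTime (B : Set (ℝ≥0 × Ω)) (U : ℝ≥0 → Ω → ℝ) (a : ℝ) (ω : Ω) : WithTop ℝ≥0 :=
  if ∃ s, (s, ω) ∉ B ∧ a ≤ U s ω then ((sInf {s | (s, ω) ∉ B ∧ a ≤ U s ω} : ℝ≥0) : WithTop ℝ≥0)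
  else ⊤

lemma hitTime_le {B : Set (ℝ≥0 × Ω)} {U : ℝ≥0 → Ω → ℝ} {a : ℝ} {s : ℝ≥0} {ω : Ω}
    (hs : (s, ω) ∉ B) (h : a ≤ U s ω) :
    hitTime B U a ω ≤ s := by
  unfold hitTime
  rw [if_pos ⟨s, hs, h⟩]
  exact WithTop.coe_le_coe.2 (csInf_le (OrderBot.bddBelow _) ⟨hs, h⟩)

end HittingTimes

section Measurability

variable {α : Type*} {mα : MeasurableSpace α}

lemma measurable_nnreal_of_Iic {f : α → ℝ≥0} (hf : ∀ s, MeasurableSet (f ⁻¹' Set.Iic s)) :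
    Measurable f := measurable_of_Iic hf

lemma measurable_const_add_of_hasSum (c : ℝ) {f : ℕ → α → ℝ} {g : α → ℝ}
    (hf : ∀ n, Measurable (f n)) (hg : ∀ x, HasSum (fun n => f n x) (g x)) :
    Measurable fun x => c + g x := by
  refine Measurable.const_add ?_ c
  refine measurable_of_tendsto_metrizable (f := fun N x => ∑ n ∈ Finset.range N, f n x)
    (fun N => Finset.measurable_fun_sum _ fun n _ => hf n) ?_
  rw [tendsto_pi_nhds]
  exact fun x => (hg x).tendsto_sum_nat

end Measurability

variable {Ω : Type*} [m : MeasurableSpace Ω] {d : ℕ}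

namespace MartingaleSpace

variable {𝓜 : MartingaleSpace Ω d}

/-! ### Exceptional sets and processes that are continuous outside of them -/

/-- Exceptional sets in their convenient form: instantly blockable, closed under passing to later
times, and with all subsets of the section at time `t` belonging to `F_t`. -/
structure IsExceptional (𝓜 : MartingaleSpace Ω d) (B : Set (ℝ≥0 × Ω)) : Prop where
  blockable : 𝓜.InstantlyBlockable B
  mono : ∀ {s t : ℝ≥0} {ω : Ω}, (s, ω) ∈ B → s ≤ t → (t, ω) ∈ B
  null : ∀ (t : ℝ≥0) (A : Set Ω), A ⊆ {ω | (t, ω) ∈ B} → MeasurableSet[𝓜.ℱ t] A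

/-- A real adapted process whose trajectories are continuous on `[0, t]` for `(t, ω)` outside the
exceptional set `B`. -/
structure ContOff (𝓜 : MartingaleSpace Ω d) (B : Set (ℝ≥0 × Ω)) (U : ℝ≥0 → Ω → ℝ) : Prop where
  meas : ∀ t, Measurable[𝓜.ℱ t] (U t)
  cont : ∀ {t : ℝ≥0} {ω : Ω}, (t, ω) ∉ B → ContinuousOn (fun s => U s ω) (Set.Iic t)

section ContOffLemmas

variable {B B' : Set (ℝ≥0 × Ω)} {U U' : ℝ≥0 → Ω → ℝ}

lemma IsExceptional.measurable_of_eq (hB : 𝓜.IsExceptional B) {t : ℝ≥0} {f g : Ω → ℝ}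
    (hg : Measurable[𝓜.ℱ t] g) (h : ∀ ω, (t, ω) ∉ B → f ω = g ω) : Measurable[𝓜.ℱ t] f := by
  intro s hs
  have hBt : MeasurableSet[𝓜.ℱ t] {ω | (t, ω) ∈ B} := hB.null t _ subset_rfl
  have : f ⁻¹' s = (g ⁻¹' s ∩ {ω | (t, ω) ∈ B}ᶜ) ∪ (f ⁻¹' s ∩ {ω | (t, ω) ∈ B}) := by
    ext ω
    by_cases hω : (t, ω) ∈ B
    · simp [hω]
    · simp [hω, h ω hω]
  rw [this]
  exact ((hg hs).inter hBt.compl).union (hB.null t _ Set.inter_subset_right)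

lemma ContOff.mono (hU : 𝓜.ContOff B U) (h : B ⊆ B') : 𝓜.ContOff B' U :=
  ⟨hU.meas, fun ht => hU.cont fun h' => ht (h h')⟩

/-- The restriction to `[0, t]` of a process agrees outside an exceptional set with a process all
of whose trajectories are continuous. -/
lemma ContOff.exists_continuous (hB : 𝓜.IsExceptional B) (hU : 𝓜.ContOff B U) (t : ℝ≥0) :
    ∃ Y : ℝ≥0 → Ω → ℝ, (∀ ω, Continuous fun s => Y s ω) ∧ (∀ s, Measurable[𝓜.ℱ t] (Y s)) ∧
      ∀ ω, (t, ω) ∉ B → ∀ s ≤ t, Y s ω = U s ω := by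
  classical
  refine ⟨fun s => {ω | (t, ω) ∉ B}.indicator (U (min s t)), fun ω => ?_, fun s => ?_, ?_⟩
  · by_cases hω : (t, ω) ∈ B
    · simpa [hω] using continuous_const
    · have h1 : ∀ s, {ω | (t, ω) ∉ B}.indicator (U (min s t)) ω = U (min s t) ω := fun s =>
        Set.indicator_of_mem (by exact hω) _
      simp only [h1]
      exact (hU.cont hω).comp_continuous (continuous_id.min continuous_const)
        fun s => Set.mem_Iic.2 (min_le_right _ _)
  · refine (((hU.meas (min s t)).mono (𝓜.ℱ.mono (min_le_right _ _)) le_rfl)).indicator ?_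
    exact (hB.null t _ subset_rfl).compl
  · intro ω hω s hs
    simp only [Set.mem_ofPred_eq, hω, not_false_eq_true, Set.indicator_of_mem, min_eq_left hs]

lemma measurable_clip {τ : Ω → WithTop ℝ≥0} (hτ : IsStoppingTime 𝓜.ℱ τ) (t : ℝ≥0) :
    Measurable[𝓜.ℱ t] (clip τ t) := by
  refine measurable_nnreal_of_Iic fun s => ?_
  by_cases h : t ≤ s
  · have : clip τ t ⁻¹' Set.Iic s = Set.univ :=
      Set.eq_univ_of_forall fun ω => clip_le.trans h
    rw [this]; exact MeasurableSet.univ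
  · have : clip τ t ⁻¹' Set.Iic s = {ω | τ ω ≤ s} := by
      ext ω; simp [clip_le_iff, h]
    rw [this]; exact 𝓜.ℱ.mono (not_le.1 h).le _ (hτ s)

lemma ContOff.stopped (hB : 𝓜.IsExceptional B) (hU : 𝓜.ContOff B U) {τ : Ω → WithTop ℝ≥0}
    (hτ : IsStoppingTime 𝓜.ℱ τ) : 𝓜.ContOff B (fun t ω => U (clip τ t ω) ω) := by
  refine ⟨fun t => ?_, fun {t ω} ht => ?_⟩
  · obtain ⟨Y, hYc, hYm, hYU⟩ := hU.exists_continuous hB t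
    have h1 := measurable_uncurry_of_continuous_of_measurable (m := 𝓜.ℱ t) hYc hYm
    have h2 : Measurable[𝓜.ℱ t] fun ω => Y (clip τ t ω) ω :=
      h1.comp ((measurable_clip hτ t).prodMk (@measurable_id _ (𝓜.ℱ t)))
    exact hB.measurable_of_eq h2 fun ω hω => (hYU ω hω _ clip_le).symm
  · refine (hU.cont ht).comp (continuous_clip τ ω).continuousOn fun s hs => ?_
    exact clip_le.trans hs

lemma ContOff.sub (hU : 𝓜.ContOff B U) (hU' : 𝓜.ContOff B U') :
    𝓜.ContOff B (fun t ω => U t ω - U' t ω) :=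
  ⟨fun t => (hU.meas t).sub (hU'.meas t), fun h => (hU.cont h).sub (hU'.cont h)⟩

lemma ContOff.pow (hU : 𝓜.ContOff B U) (n : ℕ) : 𝓜.ContOff B (fun t ω => U t ω ^ n) :=
  ⟨fun t => (hU.meas t).pow_const n, fun h => (hU.cont h).pow n⟩

lemma ContOff.abs (hU : 𝓜.ContOff B U) : 𝓜.ContOff B (fun t ω => |U t ω|) :=
  ⟨fun t => by
    have := @continuous_abs ℝ _ _ _ _ _
    exact this.measurable.comp (hU.meas t), fun h => (hU.cont h).abs⟩

lemma ContOff.sum {ι : Type*} (s : Finset ι) {V : ι → ℝ≥0 → Ω → ℝ}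
    (hV : ∀ i ∈ s, 𝓜.ContOff B (V i)) :
    𝓜.ContOff B (fun t ω => ∑ i ∈ s, V i t ω) :=
  ⟨fun t => Finset.measurable_sum s fun i hi => (hV i hi).meas t,
    fun h => continuousOn_finsetSum s fun i hi => (hV i hi).cont h⟩

/-- A gain between two stopping times at an `F_a`-measurable position. -/
lemma ContOff.gain (hB : 𝓜.IsExceptional B) (hU : 𝓜.ContOff B U) {a b : Ω → WithTop ℝ≥0}
    (ha : IsStoppingTime 𝓜.ℱ a) (hb : IsStoppingTime 𝓜.ℱ b) (hab : ∀ ω, a ω ≤ b ω) {g : Ω → ℝ}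
    (hg : Measurable[ha.measurableSpace] g) :
    𝓜.ContOff B (fun t ω => g ω * (U (clip b t ω) ω - U (clip a t ω) ω)) := by
  have h1 := (hU.stopped hB hb).sub (hU.stopped hB ha)
  refine ⟨fun t => ?_, fun h => (h1.cont h).const_mul _⟩
  have h2 : (fun ω => g ω * (U (clip b t ω) ω - U (clip a t ω) ω)) = fun ω =>
      {ω | a ω ≤ t}.indicator g ω * (U (clip b t ω) ω - U (clip a t ω) ω) := by
    ext ω
    by_cases h : a ω ≤ t
    · rw [Set.indicator_of_mem (by exact h)]
    · have h3 := (not_le.1 h).le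
      rw [clip_of_le h3, clip_of_le (h3.trans (hab ω)), sub_self, mul_zero, mul_zero]
  rw [h2]
  exact (measurable_indicator_stopping ha hg t).mul (h1.meas t)

/-! ### Hitting times as stopping times -/

lemma ContOff.hitTime_spec (hB : 𝓜.IsExceptional B) (hU : 𝓜.ContOff B U) {a : ℝ} {s : ℝ≥0} {ω : Ω}
    (h : hitTime B U a ω = s) : (s, ω) ∉ B ∧ a ≤ U s ω := by
  unfold hitTime at h
  split_ifs at h with hex
  swap
  · exact absurd h WithTop.top_ne_coe
  obtain ⟨r, hr, har⟩ := hex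
  rw [WithTop.coe_inj] at h
  have hc : IsCompact (Set.Iic r ∩ (fun s => U s ω) ⁻¹' Set.Ici a) := by
    refine IsCompact.of_isClosed_subset (isCompact_Icc (a := (0 : ℝ≥0)) (b := r)) ?_ ?_
    · exact (hU.cont hr).preimage_isClosed_of_isClosed isClosed_Iic isClosed_Ici
    · exact fun u hu => ⟨zero_le, hu.1⟩
  obtain ⟨x, ⟨hx1, hx2⟩, hx⟩ := hc.exists_isLeast ⟨r, Set.mem_Iic.2 le_rfl, har⟩
  have hxB : (x, ω) ∉ B := fun h' => hr (hB.mono h' hx1)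
  have hl : IsLeast {s | (s, ω) ∉ B ∧ a ≤ U s ω} x := by
    refine ⟨⟨hxB, hx2⟩, fun y hy => ?_⟩
    rcases le_total y r with hyr | hyr
    · exact hx ⟨hyr, hy.2⟩
    · exact (Set.mem_Iic.1 hx1).trans hyr
  rw [← h, hl.csInf_eq]
  exact ⟨hxB, hx2⟩

lemma ContOff.isStoppingTime_hitTime (hB : 𝓜.IsExceptional B) (hU : 𝓜.ContOff B U) (a : ℝ) :
    IsStoppingTime 𝓜.ℱ (hitTime B U a) := by
  intro t
  obtain ⟨Y, hYc, hYm, hYU⟩ := hU.exists_continuous hB t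
  have hBt : MeasurableSet[𝓜.ℱ t] {ω | (t, ω) ∈ B} := hB.null t _ subset_rfl
  -- by compactness, the level is reached as soon as it is approached along a dense sequence
  set A : Set Ω := ⋂ k : ℕ, ⋃ n : ℕ,
    {ω | a - 1 / (k + 1) < Y (min (TopologicalSpace.denseSeq ℝ≥0 n) t) ω}
  have hA : MeasurableSet[𝓜.ℱ t] A := by
    refine MeasurableSet.iInter fun k => MeasurableSet.iUnion fun n => ?_
    exact hYm _ measurableSet_Ioi
  have hA' : ∀ ω, ω ∈ A ↔ ∃ s ≤ t, a ≤ Y s ω := by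
    intro ω
    simp only [A, Set.mem_iInter, Set.mem_iUnion, Set.mem_ofPred_eq]
    constructor
    · intro h
      obtain ⟨x, hx, hmax⟩ := (isCompact_Icc (a := (0 : ℝ≥0)) (b := t)).exists_isMaxOn
        ⟨0, le_rfl, zero_le⟩ (hYc ω).continuousOn
      refine ⟨x, hx.2, le_of_forall_pos_lt_add fun ε hε => ?_⟩
      obtain ⟨k, hk⟩ := exists_nat_one_div_lt hε
      obtain ⟨n, hn⟩ := h k
      have : Y (min (TopologicalSpace.denseSeq ℝ≥0 n) t) ω ≤ Y x ω :=
        hmax ⟨zero_le, min_le_right _ _⟩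
      linarith
    · rintro ⟨s, hs, has⟩ k
      have ho : IsOpen {u : ℝ≥0 | a - 1 / (k + 1) < Y (min u t) ω} :=
        isOpen_lt continuous_const ((hYc ω).comp (continuous_id.min continuous_const))
      obtain ⟨_, hu, ⟨n, rfl⟩⟩ := (TopologicalSpace.denseRange_denseSeq ℝ≥0).inter_open_nonempty _
        ho ⟨s, by
          have : (0 : ℝ) < 1 / (k + 1) := Nat.one_div_pos_of_nat
          simp only [Set.mem_ofPred_eq, min_eq_left hs]; linarith⟩
      exact ⟨n, hu⟩
  have key : {ω | hitTime B U a ω ≤ t} =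
      (A ∩ {ω | (t, ω) ∈ B}ᶜ) ∪ ({ω | hitTime B U a ω ≤ t} ∩ {ω | (t, ω) ∈ B}) := by
    ext ω
    by_cases hω : (t, ω) ∈ B
    · simp [hω]
    · simp only [Set.mem_union, Set.mem_inter_iff, Set.mem_compl_iff, Set.mem_ofPred_eq, hω,
        not_false_eq_true, and_true, and_false, or_false, hA']
      constructor
      · intro h
        obtain ⟨s, hs⟩ := WithTop.ne_top_iff_exists.1 (ne_top_of_le_ne_top WithTop.coe_ne_top h)
        have hst : s ≤ t := by rw [← hs] at h; exact WithTop.coe_le_coe.1 h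
        exact ⟨s, hst, by rw [hYU ω hω s hst]; exact (hU.hitTime_spec hB hs.symm).2⟩
      · rintro ⟨s, hst, hs⟩
        rw [hYU ω hω s hst] at hs
        exact (hitTime_le (fun h' => hω (hB.mono h' hst)) hs).trans (WithTop.coe_le_coe.2 hst)
  rw [key]
  exact (hA.inter hBt.compl).union (hB.null t _ Set.inter_subset_right)

/-- Up to the hitting time of the level `a`, the process stays below `a`. -/
lemma ContOff.le_of_hitTime (hB : 𝓜.IsExceptional B) (hU : 𝓜.ContOff B U) {a : ℝ} {t : ℝ≥0} {ω : Ω}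
    (ht : (t, ω) ∉ B) (h0 : U 0 ω ≤ a) {u : ℝ≥0} (hu : u ≤ clip (hitTime B U a) t ω) :
    U u ω ≤ a := by
  by_contra! hlt
  have hut : u ≤ t := hu.trans clip_le
  have huB : (u, ω) ∉ B := fun h' => ht (hB.mono h' hut)
  obtain ⟨r, hr, har⟩ := intermediate_value_Icc (zero_le : (0 : ℝ≥0) ≤ u)
    ((hU.cont huB).mono fun s hs => hs.2) ⟨h0, hlt.le⟩
  have hrB : (r, ω) ∉ B := fun h' => huB (hB.mono h' hr.2)
  have h1 : hitTime B U a ω ≤ r := hitTime_le hrB har.ge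
  have h2 : u ≤ r := hu.trans (clip_le_iff.2 (Or.inr h1))
  rw [hr.2.antisymm h2] at har
  linarith

lemma clip_hitTime_of_lt (hB : 𝓜.IsExceptional B) (hU : 𝓜.ContOff B U) {a : ℝ} {t : ℝ≥0} {ω : Ω}
    (h : ∀ s ≤ t, U s ω < a) : clip (hitTime B U a) t ω = t := by
  refine clip_of_le ?_
  by_contra! hlt
  obtain ⟨s, hs⟩ := WithTop.ne_top_iff_exists.1 (ne_top_of_lt hlt)
  rw [← hs] at hlt
  exact absurd (hU.hitTime_spec hB hs.symm).2 (not_le.2 (h s (WithTop.coe_lt_coe.1 hlt).le))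

end ContOffLemmas

/-! ### Simple capital processes -/

/-- A process is a simple capital process. -/
def IsCapital (𝓜 : MartingaleSpace Ω d) (Y : ℝ≥0 → Ω → ℝ) : Prop := ∃ G, 𝓜.capital G = Y

section Capital

variable {Y : ℝ≥0 → Ω → ℝ}

lemma IsCapital.const [NeZero d] (c : ℝ) : 𝓜.IsCapital (fun _ _ => c) := by
  refine ⟨fun _ => .const _ (c / d), ?_⟩
  ext t ω
  simp only [capital, SimpleStrategy.integral_const, Finset.sum_const, Finset.card_univ,
    Fintype.card_fin, nsmul_eq_mul]
  have : (d : ℝ) ≠ 0 := Nat.cast_ne_zero.2 (NeZero.ne d)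
  field_simp

lemma IsCapital.scale (a : ℝ) (hY : 𝓜.IsCapital Y) : 𝓜.IsCapital (fun t ω => a * Y t ω) := by
  obtain ⟨G, rfl⟩ := hY
  refine ⟨fun j => .scale a (G j), ?_⟩
  ext t ω
  simp only [capital, SimpleStrategy.integral_scale, Finset.mul_sum]

lemma IsCapital.stopped (hY : 𝓜.IsCapital Y) {ρ : Ω → WithTop ℝ≥0} (hρ : IsStoppingTime 𝓜.ℱ ρ) :
    𝓜.IsCapital (fun t ω => Y (clip ρ t ω) ω) := by
  obtain ⟨G, rfl⟩ := hY
  refine ⟨fun j => (G j).stopped hρ, ?_⟩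
  ext t ω
  simp only [capital, SimpleStrategy.integral_stopped]

lemma IsCapital.after (hY : 𝓜.IsCapital Y) {a : Ω → WithTop ℝ≥0} (ha : IsStoppingTime 𝓜.ℱ a)
    {g : Ω → ℝ} (hg : Measurable[ha.measurableSpace] g) (hb : ∃ K : ℝ, ∀ ω, |g ω| ≤ K)
    (htop : ∀ ω, a ω = ⊤ → g ω = 0) :
    𝓜.IsCapital (fun t ω => g ω * (Y t ω - Y (clip a t ω) ω)) := by
  obtain ⟨G, rfl⟩ := hY
  refine ⟨fun j => (G j).after ha hg hb htop, ?_⟩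
  ext t ω
  simp only [capital, SimpleStrategy.integral_after, ← Finset.mul_sum, Finset.sum_sub_distrib]

lemma IsCapital.exists_initial (hY : 𝓜.IsCapital Y) : ∃ c : ℝ, ∀ ω, Y 0 ω = c := by
  obtain ⟨G, rfl⟩ := hY
  exact ⟨∑ j, (G j).c, fun ω => by simp [capital, SimpleStrategy.integral_zero]⟩

lemma isExceptional_empty [NeZero d] : 𝓜.IsExceptional ∅ := by
  refine ⟨?_, fun h => absurd h (Set.notMem_empty _), fun t A hA => ?_⟩
  · obtain ⟨G, hG⟩ := IsCapital.const (𝓜 := 𝓜) 1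
    refine ⟨_, .simple G fun t ω => by rw [hG]; exact zero_le_one, fun ω => by rw [hG]; rfl, ?_⟩
    simp
  · have : A = ∅ := Set.eq_empty_of_subset_empty hA
    rw [this]; exact @MeasurableSet.empty _ (𝓜.ℱ t)

lemma IsCapital.contOff [NeZero d] (hY : 𝓜.IsCapital Y) (B : Set (ℝ≥0 × Ω)) : 𝓜.ContOff B Y := by
  refine ContOff.mono (B := ∅) ?_ (Set.empty_subset _)
  obtain ⟨G, rfl⟩ := hY
  refine ContOff.sum _ fun j _ => ⟨fun t => ?_, fun _ => ?_⟩
  · have hS : 𝓜.ContOff ∅ (𝓜.S j) :=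
      ⟨𝓜.adapted j, fun _ => (𝓜.continuous_path j _).continuousOn⟩
    have h1 : ∀ n, Measurable[𝓜.ℱ t] fun ω => (G j).gain (𝓜.S j) t ω n := fun n =>
      (hS.gain isExceptional_empty ((G j).proper.stopping n) ((G j).proper.stopping (n + 1))
        ((G j).proper.mono n) ((G j).measurable n)).meas t
    exact measurable_const_add_of_hasSum _ h1 fun ω => (G j).hasSum_gain (𝓜.S j) t ω
  · exact ((G j).continuous_integral (𝓜.continuous_path j _)).continuousOn

end Capital

/-! ### The cone of nonnegative supermartingales -/

namespace NonnegSupermartingale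

variable {X Z : ℝ≥0 → Ω → EReal}

lemma of_capital {Y : ℝ≥0 → Ω → ℝ} (hY : 𝓜.IsCapital Y) (h : ∀ t ω, 0 ≤ Y t ω) :
    𝓜.NonnegSupermartingale fun t ω => (Y t ω : EReal) := by
  obtain ⟨G, rfl⟩ := hY
  exact .simple G h

lemma add_capital {Y : ℝ≥0 → Ω → ℝ} (hZ : 𝓜.NonnegSupermartingale Z) (hY : 𝓜.IsCapital Y)
    (h : ∀ t ω, 0 ≤ Z t ω + (Y t ω : EReal)) :
    𝓜.NonnegSupermartingale fun t ω => Z t ω + (Y t ω : EReal) := by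
  obtain ⟨G, rfl⟩ := hY
  exact .add Z G hZ h

lemma nonneg (hX : 𝓜.NonnegSupermartingale X) (t : ℝ≥0) (ω : Ω) : 0 ≤ X t ω := by
  induction hX with
  | simple G h => exact EReal.coe_nonneg.2 (h t ω)
  | add X G hX h ih => exact h t ω
  | liminf X hX ih => exact le_liminf_of_le (by isBoundedDefault) (.of_forall ih)

lemma ne_bot (hX : 𝓜.NonnegSupermartingale X) (t : ℝ≥0) (ω : Ω) : X t ω ≠ ⊥ :=
  ne_bot_of_le_ne_bot (by simp) (hX.nonneg t ω)

lemma exists_initial (hX : 𝓜.NonnegSupermartingale X) : ∃ x, ∀ ω, X 0 ω = x := by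
  induction hX with
  | simple G h =>
    obtain ⟨c, hc⟩ := IsCapital.exists_initial (𝓜 := 𝓜) ⟨G, rfl⟩
    exact ⟨c, fun ω => by simp only [hc]⟩
  | add X G hX h ih =>
    obtain ⟨c, hc⟩ := IsCapital.exists_initial (𝓜 := 𝓜) ⟨G, rfl⟩
    obtain ⟨x, hx⟩ := ih
    exact ⟨x + c, fun ω => by simp only [hx, hc]⟩
  | liminf X hX ih =>
    choose x hx using ih
    exact ⟨Filter.liminf x atTop, fun ω => by simp only [hx]⟩

lemma stopped (hX : 𝓜.NonnegSupermartingale X) {ρ : Ω → WithTop ℝ≥0} (hρ : IsStoppingTime 𝓜.ℱ ρ) :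
    𝓜.NonnegSupermartingale fun t ω => X (clip ρ t ω) ω := by
  induction hX with
  | simple G h => exact of_capital (.stopped ⟨G, rfl⟩ hρ) fun t ω => h _ _
  | add X G hX h ih => exact add_capital ih (.stopped ⟨G, rfl⟩ hρ) fun t ω => h _ _
  | liminf X hX ih => exact .liminf _ ih

lemma scale (hX : 𝓜.NonnegSupermartingale X) {a : ℝ} (ha : 0 ≤ a) :
    𝓜.NonnegSupermartingale fun t ω => (a : EReal) * X t ω := by
  have ha' : (0 : EReal) ≤ a := EReal.coe_nonneg.2 ha
  induction hX with
  | simple G h =>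
    simp only [← EReal.coe_mul]
    exact of_capital (.scale a ⟨G, rfl⟩) fun t ω => mul_nonneg ha (h t ω)
  | add X G hX h ih =>
    have e : ∀ t ω, (a : EReal) * (X t ω + (𝓜.capital G t ω : EReal)) =
        a * X t ω + ((a * 𝓜.capital G t ω : ℝ) : EReal) := fun t ω => by
      rw [EReal.left_distrib_of_nonneg_of_ne_top ha' (EReal.coe_ne_top a), EReal.coe_mul]
    simp only [e]
    exact add_capital ih (.scale a ⟨G, rfl⟩) fun t ω => by
      rw [← e]; exact mul_nonneg ha' (h t ω)
  | liminf X hX ih =>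
    have e : ∀ t ω, (a : EReal) * Filter.liminf (fun n => X n t ω) atTop =
        Filter.liminf (fun n => (a : EReal) * X n t ω) atTop := fun t ω =>
      (EReal.liminf_const_mul_of_nonneg_of_ne_top ha' (EReal.coe_ne_top a)).symm
    simp only [e]
    exact .liminf _ ih

lemma add_supermartingale (hX : 𝓜.NonnegSupermartingale X) (hZ : 𝓜.NonnegSupermartingale Z) :
    𝓜.NonnegSupermartingale fun t ω => X t ω + Z t ω := by
  induction hZ with
  | simple G h =>
    exact .add X G hX fun t ω => add_nonneg (hX.nonneg t ω)
      (EReal.coe_nonneg.2 (h t ω))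
  | add Z G hZ h ih =>
    simp only [← add_assoc]
    refine .add _ G ih fun t ω => ?_
    rw [add_assoc]
    exact add_nonneg (hX.nonneg t ω) (h t ω)
  | liminf Z hZ ih =>
    have e : ∀ t ω, X t ω + Filter.liminf (fun n => Z n t ω) atTop =
        Filter.liminf (fun n => X t ω + Z n t ω) atTop := fun t ω => by
      have h0 : (0 : EReal) ≤ Filter.liminf (fun n => Z n t ω) atTop :=
        (NonnegSupermartingale.liminf Z hZ).nonneg t ω
      refine Monotone.map_liminf_of_continuousAt (f := fun y => X t ω + y)
        (fun a b h => add_le_add_right h _) _ ?_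
      exact (EReal.continuousAt_add (p := (X t ω, Filter.liminf (fun n => Z n t ω) atTop))
        (Or.inr (ne_bot_of_le_ne_bot (by simp) h0)) (Or.inl (hX.ne_bot t ω))).comp
        (continuous_const.prodMk continuous_id).continuousAt
    simp only [e]
    exact .liminf _ ih

lemma const [NeZero d] {a : ℝ} (ha : 0 ≤ a) : 𝓜.NonnegSupermartingale fun _ _ => (a : EReal) :=
  of_capital (.const a) fun _ _ => ha

lemma sum [NeZero d] (n : ℕ) {N : ℕ → ℝ≥0 → Ω → EReal}
    (hN : ∀ k, 𝓜.NonnegSupermartingale (N k)) :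
    𝓜.NonnegSupermartingale fun t ω => ∑ k ∈ Finset.range n, N k t ω := by
  induction n with
  | zero => simpa using const (𝓜 := 𝓜) le_rfl
  | succ n ih => simpa only [Finset.sum_range_succ] using ih.add_supermartingale (hN n)

/-- Simple capital processes can be added several at a time: when the first is bounded, by stopping,
the partial sum becomes nonnegative after the addition of a constant. -/
lemma add_sum_capital [NeZero d] (n : ℕ) {Y : ℕ → ℝ≥0 → Ω → ℝ} (hY : ∀ k, 𝓜.IsCapital (Y k))
    (c : ℝ) (hZ : 𝓜.NonnegSupermartingale Z)
    (h : ∀ t ω, 0 ≤ Z t ω + ((c + ∑ k ∈ Finset.range n, Y k t ω : ℝ) : EReal)) :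
    𝓜.NonnegSupermartingale
      fun t ω => Z t ω + ((c + ∑ k ∈ Finset.range n, Y k t ω : ℝ) : EReal) := by
  induction n generalizing Z Y c with
  | zero =>
    simp only [Finset.range_zero, Finset.sum_empty, add_zero] at h ⊢
    exact add_capital hZ (.const c) h
  | succ n ih =>
    obtain ⟨y0, hy0⟩ := (hY n).exists_initial
    have hnice := ((hY n).contOff ∅).abs
    set ρ : ℕ → Ω → WithTop ℝ≥0 := fun K => hitTime ∅ (fun t ω => |Y n t ω|) (K + |y0|) with hρdef
    have hρ : ∀ K, IsStoppingTime 𝓜.ℱ (ρ K) := fun K =>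
      hnice.isStoppingTime_hitTime isExceptional_empty _
    have hbound : ∀ K t ω, |Y n (clip (ρ K) t ω) ω| ≤ K + |y0| := fun K t ω =>
      hnice.le_of_hitTime isExceptional_empty (t := t) (Set.notMem_empty _)
        (by rw [hy0]; linarith [Nat.cast_nonneg (α := ℝ) K]) le_rfl
    have hstep : ∀ K : ℕ, 𝓜.NonnegSupermartingale fun t ω => Z (clip (ρ K) t ω) ω +
        ((c + ∑ k ∈ Finset.range (n + 1), Y k (clip (ρ K) t ω) ω : ℝ) : EReal) := by
      intro K
      have h1 := add_capital
        ((hZ.stopped (hρ K)).add_supermartingale (const (a := K + |y0|) (by positivity)))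
        ((hY n).stopped (hρ K)) (fun t ω => by
          rw [add_assoc, ← EReal.coe_add]
          refine add_nonneg (hZ.nonneg _ _) (EReal.coe_nonneg.2 ?_)
          linarith [neg_le_of_abs_le (hbound K t ω)])
      have e : ∀ t ω, Z (clip (ρ K) t ω) ω + ((K + |y0| : ℝ) : EReal) +
          (Y n (clip (ρ K) t ω) ω : EReal) + ((c - (K + |y0|) +
            ∑ k ∈ Finset.range n, Y k (clip (ρ K) t ω) ω : ℝ) : EReal) = Z (clip (ρ K) t ω) ω +
          ((c + ∑ k ∈ Finset.range (n + 1), Y k (clip (ρ K) t ω) ω : ℝ) : EReal) := fun t ω => by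
        rw [add_assoc, add_assoc, ← EReal.coe_add, ← EReal.coe_add, Finset.sum_range_succ]
        congr 2; ring
      have h2 := ih (Y := fun k t ω => Y k (clip (ρ K) t ω) ω) (fun k => (hY k).stopped (hρ K))
        (c - (K + |y0|)) h1 (fun t ω => by rw [e]; exact h _ _)
      simpa only [e] using h2
    have hlim := NonnegSupermartingale.liminf _ hstep
    convert hlim using 3 with t ω
    refine (Tendsto.liminf_eq (tendsto_const_nhds.congr' ?_)).symm
    obtain ⟨b, hb⟩ := (isCompact_Icc (a := (0 : ℝ≥0)) (b := t)).exists_bound_of_continuousOn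
      (f := fun s => Y n s ω)
      ((((hY n).contOff ∅).cont (Set.notMem_empty (t, ω))).mono fun s hs => hs.2)
    obtain ⟨K0, hK0⟩ := exists_nat_gt b
    filter_upwards [eventually_ge_atTop K0] with K hK
    have hK' : (K0 : ℝ) ≤ K := Nat.cast_le.2 hK
    have : clip (ρ K) t ω = t := clip_hitTime_of_lt isExceptional_empty hnice fun s hs => by
      have := hb s ⟨zero_le, hs⟩
      rw [Real.norm_eq_abs] at this
      linarith [abs_nonneg y0]
    rw [this]

end NonnegSupermartingale

end MartingaleSpace

end ModelFree

namespace ModelFree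

variable {Ω : Type*} [m : MeasurableSpace Ω] {d : ℕ}

namespace MartingaleSpace

variable {𝓜 : MartingaleSpace Ω d}

/-! ### Instantly blockable sets -/

section Blockable

variable {B B' : Set (ℝ≥0 × Ω)}

lemma InstantlyBlockable.exists_blocking (hB : 𝓜.InstantlyBlockable B) :
    ∃ N, 𝓜.NonnegSupermartingale N ∧ (∀ ω, N 0 ω = 1) ∧ ∀ t ω, (t, ω) ∈ B → N t ω = ⊤ := by
  obtain ⟨N, hN, h0, h⟩ := hB
  exact ⟨N, hN, h0, fun t ω ht => h t ω (by simpa using ht)⟩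

lemma InstantlyBlockable.of_blocking {N : ℝ≥0 → Ω → EReal} (hN : 𝓜.NonnegSupermartingale N)
    (h0 : ∀ ω, N 0 ω = 1) (h : ∀ t ω, (t, ω) ∈ B → N t ω = ⊤) : 𝓜.InstantlyBlockable B :=
  ⟨N, hN, h0, fun t ω ht => h t ω (by simpa using ht)⟩

lemma InstantlyEnforceable.blockable_compl {E : Set (ℝ≥0 × Ω)} (h : 𝓜.InstantlyEnforceable E) :
    𝓜.InstantlyBlockable Eᶜ := by
  unfold InstantlyBlockable
  rwa [compl_compl]

lemma InstantlyBlockable.subset (hB : 𝓜.InstantlyBlockable B) (h : B' ⊆ B) :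
    𝓜.InstantlyBlockable B' := by
  obtain ⟨N, hN, h0, hN'⟩ := hB.exists_blocking
  exact .of_blocking hN h0 fun t ω ht => hN' t ω (h ht)

lemma InstantlyBlockable.iUnion [NeZero d] {B : ℕ → Set (ℝ≥0 × Ω)}
    (hB : ∀ n, 𝓜.InstantlyBlockable (B n)) : 𝓜.InstantlyBlockable (⋃ n, B n) := by
  choose N hN h0 hN' using fun n => (hB n).exists_blocking
  -- the last summand makes all initial values equal to `1`
  have hP : ∀ n : ℕ, 𝓜.NonnegSupermartingale fun t ω =>
      ∑ k ∈ Finset.range n, (((1 / 2) ^ (k + 1) : ℝ) : EReal) * N k t ω +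
        (((1 / 2) ^ n : ℝ) : EReal) := fun n =>
    (NonnegSupermartingale.sum n fun k => (hN k).scale (by positivity)).add_supermartingale
      (.const (by positivity))
  refine .of_blocking (.liminf _ hP) (fun ω => ?_) fun t ω ht => ?_
  · have : ∀ n : ℕ, ∑ k ∈ Finset.range n, (((1 / 2) ^ (k + 1) : ℝ) : EReal) * N k 0 ω +
        (((1 / 2) ^ n : ℝ) : EReal) = 1 := by
      intro n
      simp only [h0, mul_one]
      induction n with
      | zero => simp
      | succ n ih =>
        rw [Finset.sum_range_succ, add_assoc, ← EReal.coe_add, ← ih]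
        congr 2; ring
    simp only [this]
    exact liminf_const _
  · obtain ⟨j, hj⟩ := Set.mem_iUnion.1 ht
    refine (tendsto_const_nhds.congr' ?_).liminf_eq
    filter_upwards [eventually_gt_atTop j] with n hn
    have h1 : (((1 / 2) ^ (j + 1) : ℝ) : EReal) * N j t ω = ⊤ := by
      rw [hN' j t ω hj]
      exact EReal.coe_mul_top_of_pos (by positivity)
    have h2 : (⊤ : EReal) ≤ ∑ k ∈ Finset.range n, (((1 / 2) ^ (k + 1) : ℝ) : EReal) * N k t ω := by
      rw [← h1]
      exact Finset.single_le_sum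
        (f := fun k => (((1 / 2) ^ (k + 1) : ℝ) : EReal) * N k t ω)
        (fun k _ => ((hN k).scale (a := (1 / 2) ^ (k + 1)) (by positivity)).nonneg t ω)
        (Finset.mem_range.2 hn)
    rw [top_le_iff.1 h2, EReal.top_add_coe]

lemma InstantlyBlockable.union [NeZero d] (hB : 𝓜.InstantlyBlockable B)
    (hB' : 𝓜.InstantlyBlockable B') : 𝓜.InstantlyBlockable (B ∪ B') := by
  refine (InstantlyBlockable.iUnion (B := fun n => if n = 0 then B else B') fun n => ?_).subset ?_
  · split_ifs <;> assumption
  · rintro q (hq | hq)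
    · exact Set.mem_iUnion.2 ⟨0, by simpa using hq⟩
    · exact Set.mem_iUnion.2 ⟨1, by simpa using hq⟩

/-- Under Assumption A a blockable set stays blockable when it is closed under passing to later
times. The first entrance time need not be attained, but any selection of times from the sections
of the set is a stopping time, because its graph is itself blockable. -/
lemma InstantlyBlockable.exists_isExceptional (hA : 𝓜.AssumptionA) (hB : 𝓜.InstantlyBlockable B) :
    ∃ B', B ⊆ B' ∧ 𝓜.IsExceptional B' := by
  classical
  have hblock : 𝓜.InstantlyBlockable {q : ℝ≥0 × Ω | ∃ s ≤ q.1, (s, q.2) ∈ B} := by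
    obtain ⟨N, hN, h0, hN'⟩ := hB.exists_blocking
    -- times in the section of the set at `ω` that approach its infimum
    have hsel : ∀ ω, ∃ u : ℕ → WithTop ℝ≥0, (∀ n (s : ℝ≥0), u n = s → (s, ω) ∈ B) ∧
        ∀ s : ℝ≥0, (s, ω) ∈ B → ∀ᶠ n in atTop, u n ≤ s := by
      intro ω
      set S : Set ℝ≥0 := {s | (s, ω) ∈ B} with hS
      rcases S.eq_empty_or_nonempty with he | hne
      · refine ⟨fun _ => ⊤, fun n s h => absurd h WithTop.top_ne_coe, fun s hs => ?_⟩
        have : s ∈ S := hs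
        simp [he] at this
      by_cases hmem : sInf S ∈ S
      · refine ⟨fun _ => (sInf S : ℝ≥0), fun n s h => ?_, fun s hs => .of_forall fun n => ?_⟩
        · rw [WithTop.coe_inj] at h; rw [← h]; exact hmem
        · exact WithTop.coe_le_coe.2 (csInf_le (OrderBot.bddBelow _) hs)
      · obtain ⟨u, -, hu, huS⟩ := exists_seq_tendsto_sInf hne (OrderBot.bddBelow S)
        refine ⟨fun n => u n, fun n s h => ?_, fun s hs => ?_⟩
        · rw [WithTop.coe_inj] at h; rw [← h]; exact huS n
        · have hlt : sInf S < s := lt_of_le_of_ne (csInf_le (OrderBot.bddBelow _) hs)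
            fun h => hmem (h ▸ hs)
          filter_upwards [hu.eventually (gt_mem_nhds hlt)] with n hn
          exact WithTop.coe_le_coe.2 hn.le
    choose u hu1 hu2 using hsel
    have hstopping : ∀ n, IsStoppingTime 𝓜.ℱ fun ω => u ω n := by
      intro n t
      have h1 := hA t {q : ℝ≥0 × Ω | u q.2 n = q.1} (hB.subset fun q hq => hu1 _ n _ hq)
      convert h1 using 1
      ext ω
      simp only [Set.mem_ofPred_eq]
      constructor
      · intro h
        obtain ⟨s, hs⟩ := WithTop.ne_top_iff_exists.1 (ne_top_of_le_ne_top WithTop.coe_ne_top h)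
        exact ⟨s, by rw [← hs] at h; exact WithTop.coe_le_coe.1 h, hs.symm⟩
      · rintro ⟨s, hs, h⟩
        rw [h]; exact WithTop.coe_le_coe.2 hs
    refine .of_blocking (.liminf _ fun n => hN.stopped (hstopping n)) (fun ω => ?_) fun t ω ht => ?_
    · simp only [clip_zero_right, h0]
      exact liminf_const _
    · obtain ⟨s, hs, hsB⟩ := ht
      refine (tendsto_const_nhds.congr' ?_).liminf_eq
      filter_upwards [hu2 ω s hsB] with n hn
      obtain ⟨r, hr⟩ := WithTop.ne_top_iff_exists.1 (ne_top_of_le_ne_top WithTop.coe_ne_top hn)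
      have hrs : r ≤ s := by rw [← hr] at hn; exact WithTop.coe_le_coe.1 hn
      rw [clip_of_eq (τ := fun ω => u ω n) hr.symm (hrs.trans hs)]
      exact (hN' r ω (hu1 ω n r hr.symm)).symm
  refine ⟨{q | ∃ s ≤ q.1, (s, q.2) ∈ B}, fun q hq => ⟨q.1, le_rfl, hq⟩, hblock,
    fun ⟨r, hr, h⟩ hst => ⟨r, hr.trans hst, h⟩,
    fun t A hA' => ?_⟩
  have h1 := hA t {q : ℝ≥0 × Ω | q.1 = t ∧ q.2 ∈ A} (hblock.subset fun q hq => by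
    obtain ⟨s, hs, h⟩ := hA' hq.2
    exact ⟨s, by rw [hq.1]; exact hs, h⟩)
  convert h1 using 1
  ext ω
  exact ⟨fun h => ⟨t, le_rfl, rfl, h⟩, fun ⟨s, _, _, h⟩ => h⟩

end Blockable

/-! ### Elementary stochastic integrals -/

/-- The data of an elementary stochastic integral: finitely many periods `[a_k, b_k]` with bounded
positions that are known at time `a_k`. -/
structure Elementary (𝓜 : MartingaleSpace Ω d) where
  /-- the number of periods -/
  n : ℕ
  /-- the beginning of a period -/
  a : ℕ → Ω → WithTop ℝ≥0
  /-- the end of a period -/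
  b : ℕ → Ω → WithTop ℝ≥0
  /-- the positions -/
  g : ℕ → Ω → ℝ
  stopping_a : ∀ k, IsStoppingTime 𝓜.ℱ (a k)
  stopping_b : ∀ k, IsStoppingTime 𝓜.ℱ (b k)
  le : ∀ k ω, a k ω ≤ b k ω
  measurable : ∀ k, Measurable[(stopping_a k).measurableSpace] (g k)
  bounded : ∀ k, ∃ K : ℝ, ∀ ω, |g k ω| ≤ K
  zero_of_top : ∀ k ω, a k ω = ⊤ → g k ω = 0

namespace Elementary

/-- The elementary stochastic integral `∑_k g_k (X_{b_k ∧ t} - X_{a_k ∧ t})`. -/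
def integral (I : 𝓜.Elementary) (X : ℝ≥0 → Ω → ℝ) (t : ℝ≥0) (ω : Ω) : ℝ :=
  ∑ k ∈ Finset.range I.n, I.g k ω * (X (clip (I.b k) t ω) ω - X (clip (I.a k) t ω) ω)

/-- The integral stopped at `ρ`. -/
def stopped (I : 𝓜.Elementary) {ρ : Ω → WithTop ℝ≥0} (hρ : IsStoppingTime 𝓜.ℱ ρ) :
    𝓜.Elementary where
  n := I.n
  a k ω := min (I.a k ω) (ρ ω)
  b k ω := min (I.b k ω) (ρ ω)
  g k := {ω | I.a k ω ≤ ρ ω}.indicator (I.g k)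
  stopping_a k := (I.stopping_a k).min hρ
  stopping_b k := (I.stopping_b k).min hρ
  le k ω := min_le_min_right _ (I.le k ω)
  measurable k := measurable_indicator_le (I.stopping_a k) hρ (I.measurable k)
  bounded k := by
    obtain ⟨K, hK⟩ := I.bounded k
    refine ⟨K, fun ω => ?_⟩
    by_cases h : ω ∈ {ω | I.a k ω ≤ ρ ω}
    · rw [Set.indicator_of_mem h]; exact hK ω
    · rw [Set.indicator_of_notMem h, abs_zero]; exact (abs_nonneg _).trans (hK ω)
  zero_of_top k ω h := by
    rw [Set.indicator_apply_eq_zero]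
    exact fun _ => I.zero_of_top k ω (min_eq_top.1 h).1

lemma integral_stopped (I : 𝓜.Elementary) {ρ : Ω → WithTop ℝ≥0} (hρ : IsStoppingTime 𝓜.ℱ ρ)
    (X : ℝ≥0 → Ω → ℝ) (t : ℝ≥0) (ω : Ω) :
    (I.stopped hρ).integral X t ω = I.integral X (clip ρ t ω) ω := by
  refine Finset.sum_congr rfl fun k _ => ?_
  simp only [stopped, clip_min, clip_clip]
  by_cases h : I.a k ω ≤ ρ ω
  · rw [Set.indicator_of_mem (by exact h)]
  · have h1 : clip ρ t ω ≤ clip (I.a k) t ω := clip_mono (not_le.1 h).le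
    have h2 : clip ρ t ω ≤ clip (I.b k) t ω := h1.trans (clip_mono (I.le k ω))
    rw [min_eq_right h1, min_eq_right h2, sub_self, mul_zero, mul_zero]

lemma integral_zero (I : 𝓜.Elementary) (X : ℝ≥0 → Ω → ℝ) (ω : Ω) : I.integral X 0 ω = 0 :=
  Finset.sum_eq_zero fun k _ => by rw [clip_zero_right, clip_zero_right, sub_self, mul_zero]

lemma contOff_integral (I : 𝓜.Elementary) {B : Set (ℝ≥0 × Ω)} (hB : 𝓜.IsExceptional B)
    {U : ℝ≥0 → Ω → ℝ} (hU : 𝓜.ContOff B U) : 𝓜.ContOff B (I.integral U) :=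
  ContOff.sum _ fun k _ => hU.gain hB (I.stopping_a k) (I.stopping_b k) (I.le k) (I.measurable k)

lemma exists_abs_integral_sub_le (I : 𝓜.Elementary) : ∃ K : ℝ, 0 ≤ K ∧
    ∀ (U U' : ℝ≥0 → Ω → ℝ) (t : ℝ≥0) (ω : Ω) (e : ℝ), (∀ s ≤ t, |U s ω - U' s ω| ≤ e) →
      ∀ s ≤ t, |I.integral U s ω - I.integral U' s ω| ≤ K * e := by
  choose K hK using I.bounded
  refine ⟨∑ k ∈ Finset.range I.n, |K k| * 2, Finset.sum_nonneg fun k _ => by positivity, ?_⟩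
  intro U U' t ω e he s hs
  rw [integral, integral, ← Finset.sum_sub_distrib, Finset.sum_mul]
  refine (Finset.abs_sum_le_sum_abs _ _).trans (Finset.sum_le_sum fun k _ => ?_)
  rw [← mul_sub, abs_mul]
  have h1 := he _ ((clip_le (τ := I.b k) (t := s) (ω := ω)).trans hs)
  have h2 := he _ ((clip_le (τ := I.a k) (t := s) (ω := ω)).trans hs)
  have h3 : |I.g k ω| ≤ |K k| := (hK k ω).trans (le_abs_self _)
  rw [mul_assoc]
  refine mul_le_mul h3 ?_ (abs_nonneg _) (abs_nonneg _)
  calc _ = |(U (clip (I.b k) s ω) ω - U' (clip (I.b k) s ω) ω) -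
        (U (clip (I.a k) s ω) ω - U' (clip (I.a k) s ω) ω)| := by congr 1; ring
    _ ≤ _ := (abs_sub _ _).trans (by linarith)

/-- The summands of an elementary integral of a simple capital process are simple capital
processes. -/
lemma isCapital_gain (I : 𝓜.Elementary) {Y : ℝ≥0 → Ω → ℝ} (hY : 𝓜.IsCapital Y) (k : ℕ) :
    𝓜.IsCapital fun t ω => I.g k ω * (Y (clip (I.b k) t ω) ω - Y (clip (I.a k) t ω) ω) := by
  have h := (hY.stopped (I.stopping_b k)).after (I.stopping_a k) (I.measurable k) (I.bounded k)
    (I.zero_of_top k)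
  have e : ∀ t ω, clip (I.b k) (clip (I.a k) t ω) ω = clip (I.a k) t ω := fun t ω => by
    rw [clip_clip, min_eq_right (clip_mono (I.le k ω))]
  simpa only [e] using h

end Elementary

/-! ### Superhedging with martingales -/

/-- A process `Y` with `Y_0 = 0` whose gains can be superhedged at no cost, up to an arbitrarily
small amount: if adding `Y` keeps a nonnegative supermartingale nonnegative w.i.e., then
the sum is dominated by a nonnegative supermartingale. -/
def Hedgeable (𝓜 : MartingaleSpace Ω d) (Y : ℝ≥0 → Ω → ℝ) : Prop :=
  ∀ Z, 𝓜.NonnegSupermartingale Z → ∀ B, 𝓜.InstantlyBlockable B →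
    (∀ t ω, (t, ω) ∉ B → 0 ≤ Z t ω + (Y t ω : EReal)) → ∀ ε : ℝ, 0 < ε →
    ∃ Z', 𝓜.NonnegSupermartingale Z' ∧ (∀ ω, Z' 0 ω ≤ Z 0 ω + (ε : EReal)) ∧
      ∀ t ω, Z t ω + (Y t ω : EReal) ≤ Z' t ω

lemma hedgeable_integral_capital [NeZero d] (I : 𝓜.Elementary) {Y : ℝ≥0 → Ω → ℝ}
    (hY : 𝓜.IsCapital Y) : 𝓜.Hedgeable (I.integral Y) := by
  intro Z hZ B hB h ε hε
  obtain ⟨N, hN, h0, hN'⟩ := hB.exists_blocking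
  have hZN := hZ.add_supermartingale (hN.scale hε.le)
  have hεN : ∀ t ω, 0 ≤ (ε : EReal) * N t ω := (hN.scale hε.le).nonneg
  have hpos : ∀ t ω, 0 ≤ Z t ω + ε * N t ω + ((0 + I.integral Y t ω : ℝ) : EReal) := by
    intro t ω
    rw [zero_add]
    by_cases ht : (t, ω) ∈ B
    · rw [hN' t ω ht, EReal.coe_mul_top_of_pos hε, EReal.add_top_of_ne_bot (hZ.ne_bot t ω),
        EReal.top_add_coe]
      exact le_top
    · rw [add_right_comm]
      exact add_nonneg (h t ω ht) (hεN t ω)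
  refine ⟨_, NonnegSupermartingale.add_sum_capital I.n (I.isCapital_gain hY) 0 hZN hpos,
    fun ω => ?_, fun t ω => ?_⟩
  · change Z 0 ω + ε * N 0 ω + ((0 + I.integral Y 0 ω : ℝ) : EReal) ≤ _
    rw [I.integral_zero, h0]
    simp
  · change _ ≤ Z t ω + ε * N t ω + ((0 + I.integral Y t ω : ℝ) : EReal)
    rw [zero_add]
    exact add_le_add_left (le_add_of_nonneg_right (hεN t ω)) _

lemma eventually_abs_sub_lt {X : ℝ≥0 → EReal} {Xn : ℕ → ℝ≥0 → EReal} {x : ℝ≥0 → ℝ}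
    {xn : ℕ → ℝ≥0 → ℝ} {t : ℝ≥0}
    (h : Tendsto (fun n => ⨆ s ∈ Set.Icc 0 t, (X s - Xn n s).abs) atTop (𝓝 0))
    (hx : ∀ s ≤ t, X s = x s) (hxn : ∀ n, ∀ s ≤ t, Xn n s = xn n s) {e : ℝ} (he : 0 < e) :
    ∀ᶠ n in atTop, ∀ s ≤ t, |x s - xn n s| < e := by
  filter_upwards [h.eventually (gt_mem_nhds (ENNReal.ofReal_pos.2 he))] with n hn s hs
  have h1 : (X s - Xn n s).abs ≤ ⨆ s ∈ Set.Icc 0 t, (X s - Xn n s).abs :=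
    le_iSup₂ (f := fun s (_ : s ∈ Set.Icc 0 t) => (X s - Xn n s).abs) s ⟨zero_le, hs⟩
  have h2 := h1.trans_lt hn
  rw [hx s hs, hxn n s hs, ← EReal.coe_sub, EReal.abs_def, ENNReal.ofReal_lt_ofReal_iff he] at h2
  exact h2

/-- Every martingale is, outside of an exceptional set, a continuous real process, and all
elementary integrals with respect to it can be superhedged. For a limit of martingales, the
approximating integral hedges until it differs from the limit by `ε`. -/
theorem IsMartingale.exists_isExceptional [NeZero d] (hA : 𝓜.AssumptionA) {X : ℝ≥0 → Ω → EReal}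
    (hX : 𝓜.IsMartingale X) : ∃ B, 𝓜.IsExceptional B ∧ 𝓜.ContOff B (fun t ω => (X t ω).toReal) ∧
      (∀ t ω, (t, ω) ∉ B → X t ω = ((X t ω).toReal : EReal)) ∧
      ∀ I : 𝓜.Elementary, 𝓜.Hedgeable (I.integral fun t ω => (X t ω).toReal) := by
  induction hX with
  | simple G =>
    refine ⟨∅, isExceptional_empty, ?_, fun t ω _ => ?_, fun I => ?_⟩
    · simpa only [EReal.toReal_coe] using IsCapital.contOff ⟨G, rfl⟩ ∅
    · simp only [EReal.toReal_coe]
    · simpa only [EReal.toReal_coe] using hedgeable_integral_capital I ⟨G, rfl⟩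
  | lim Xn X hXn hX hreal hlim ih =>
    choose Bn hBn hnice heq hhedge using ih
    obtain ⟨B, hsub, hB⟩ := ((InstantlyBlockable.iUnion fun n => (hBn n).blockable).union
      (hreal.blockable_compl.union hlim.blockable_compl)).exists_isExceptional hA
    have hBle : ∀ {s t : ℝ≥0} {ω : Ω}, (t, ω) ∉ B → s ≤ t → (s, ω) ∉ B :=
      fun ht hst h => ht (hB.mono h hst)
    have hXreal : ∀ t ω, (t, ω) ∉ B → X t ω = ((X t ω).toReal : EReal) := by
      intro t ω ht
      have : (t, ω) ∈ {q : ℝ≥0 × Ω | X q.1 q.2 ≠ ⊥ ∧ X q.1 q.2 ≠ ⊤} := by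
        by_contra h
        exact ht (hsub (Or.inr (Or.inl h)))
      exact (EReal.coe_toReal this.2 this.1).symm
    have hXnreal : ∀ n t ω, (t, ω) ∉ B → Xn n t ω = ((Xn n t ω).toReal : EReal) :=
      fun n t ω ht => heq n t ω fun h => ht (hsub (Or.inl (Set.mem_iUnion.2 ⟨n, h⟩)))
    have hXn' : ∀ n, 𝓜.ContOff B (fun t ω => (Xn n t ω).toReal) := fun n =>
      (hnice n).mono ((Set.subset_iUnion Bn n).trans (Set.subset_union_left.trans hsub))
    have hconv : ∀ t ω, (t, ω) ∉ B → ∀ e : ℝ, 0 < e →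
        ∀ᶠ n in atTop, ∀ s ≤ t, |(X s ω).toReal - (Xn n s ω).toReal| < e := by
      intro t ω ht e he
      have h1 : (t, ω) ∈ {q : ℝ≥0 × Ω | Tendsto (fun n => ⨆ s ∈ Set.Icc 0 q.1,
          (X s q.2 - Xn n s q.2).abs) atTop (𝓝 0)} := by
        by_contra h
        exact ht (hsub (Or.inr (Or.inr h)))
      exact eventually_abs_sub_lt h1 (fun s hs => hXreal s ω (hBle ht hs))
        (fun n s hs => hXnreal n s ω (hBle ht hs)) he
    have hX' : 𝓜.ContOff B (fun t ω => (X t ω).toReal) := by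
      refine ⟨fun t => measurable_ereal_toReal.comp (hX t), fun {t ω} ht => ?_⟩
      refine TendstoUniformlyOn.continuousOn (F := fun n s => (Xn n s ω).toReal) (p := atTop) ?_
        (.of_forall fun n => (hXn' n).cont ht)
      rw [Metric.tendstoUniformlyOn_iff]
      intro e he
      filter_upwards [hconv t ω ht e he] with n hn s hs
      rw [Real.dist_eq]
      exact hn s hs
    refine ⟨B, hB, hX', hXreal, fun I Z hZ B' hB' hpos ε hε => ?_⟩
    set x : ℝ≥0 → Ω → ℝ := fun t ω => (X t ω).toReal with hxdef
    set xn : ℕ → ℝ≥0 → Ω → ℝ := fun n t ω => (Xn n t ω).toReal with hxndef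
    obtain ⟨D, hsubD, hD⟩ := (hB.blockable.union hB').exists_isExceptional hA
    have hDB : ∀ {t : ℝ≥0} {ω : Ω}, (t, ω) ∉ D → (t, ω) ∉ B :=
      fun ht h => ht (hsubD (Or.inl h))
    have hBD : B ⊆ D := Set.subset_union_left.trans hsubD
    obtain ⟨N, hN, hN0, hN'⟩ := hD.blockable.exists_blocking
    have hε3 : 0 < ε / 3 := by positivity
    have hU : ∀ n, 𝓜.ContOff D (fun t ω => |I.integral x t ω - I.integral (xn n) t ω|) := fun n =>
      (((I.contOff_integral hB hX').mono hBD).sub ((I.contOff_integral hB (hXn' n)).mono hBD)).abs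
    set ρ : ℕ → Ω → WithTop ℝ≥0 := fun n =>
      hitTime D (fun t ω => |I.integral x t ω - I.integral (xn n) t ω|) (ε / 3) with hρdef
    have hρ : ∀ n, IsStoppingTime 𝓜.ℱ (ρ n) := fun n => (hU n).isStoppingTime_hitTime hD _
    -- up to the time `ρ n` the endowment `Z + ε / 3` covers the difference of the two integrals
    have hstep : ∀ n, ∃ Z', 𝓜.NonnegSupermartingale Z' ∧
        (∀ ω, Z' 0 ω ≤ Z 0 ω + ((ε / 3 : ℝ) : EReal) + ((ε / 3 : ℝ) : EReal)) ∧
        ∀ t ω, Z (clip (ρ n) t ω) ω + ((ε / 3 : ℝ) : EReal) +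
          (I.integral (xn n) (clip (ρ n) t ω) ω : EReal) ≤ Z' t ω := by
      intro n
      obtain ⟨Z', h1, h2, h3⟩ := hhedge n (I.stopped (hρ n)) _
        ((hZ.stopped (hρ n)).add_supermartingale (.const hε3.le)) D hD.blockable (fun t ω ht => by
          rw [Elementary.integral_stopped, add_assoc, ← EReal.coe_add]
          set u := clip (ρ n) t ω with hu
          have hut : u ≤ t := clip_le
          have huD : (u, ω) ∉ D := fun h => ht (hD.mono h hut)
          have h4 : |I.integral x u ω - I.integral (xn n) u ω| ≤ ε / 3 :=
            (hU n).le_of_hitTime hD ht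
              (by rw [I.integral_zero, I.integral_zero, sub_self, abs_zero]; exact hε3.le) le_rfl
          refine (hpos u ω fun h => huD (hsubD (Or.inr h))).trans ?_
          refine add_le_add_right (EReal.coe_le_coe_iff.2 ?_) _
          linarith [le_of_abs_le h4]) (ε / 3) hε3
      refine ⟨Z', h1, fun ω => ?_, fun t ω => ?_⟩
      · simpa only [clip_zero_right] using h2 ω
      · have := h3 t ω
        rwa [Elementary.integral_stopped] at this
    choose Z' hZ' hZ'0 hZ'le using hstep
    refine ⟨_, (NonnegSupermartingale.liminf _ hZ').add_supermartingale (hN.scale hε3.le),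
      fun ω => ?_, fun t ω => ?_⟩
    · have h1 : liminf (fun n => Z' n 0 ω) atTop ≤
          Z 0 ω + ((ε / 3 : ℝ) : EReal) + ((ε / 3 : ℝ) : EReal) :=
        liminf_le_of_le (by isBoundedDefault) fun b hb => by
          obtain ⟨n, hn⟩ := hb.exists
          exact hn.trans (hZ'0 n ω)
      rw [hN0, mul_one]
      refine (add_le_add_left h1 _).trans (le_of_eq ?_)
      rw [add_assoc, add_assoc, ← EReal.coe_add, ← EReal.coe_add]
      congr 2; ring
    · have hlim0 : 0 ≤ liminf (fun n => Z' n t ω) atTop :=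
        (NonnegSupermartingale.liminf _ hZ').nonneg t ω
      by_cases ht : (t, ω) ∈ D
      · rw [hN' t ω ht, EReal.coe_mul_top_of_pos hε3,
          EReal.add_top_of_ne_bot (ne_bot_of_le_ne_bot (by simp) hlim0)]
        exact le_top
      · refine le_trans ?_ (le_add_of_nonneg_right ((hN.scale hε3.le).nonneg t ω))
        obtain ⟨K, hK0, hK⟩ := I.exists_abs_integral_sub_le
        refine le_liminf_of_le (by isBoundedDefault) ?_
        filter_upwards [hconv t ω (hDB ht) (ε / 3 / (K + 1)) (by positivity)] with n hn
        have hlt : ∀ s ≤ t, |I.integral x s ω - I.integral (xn n) s ω| < ε / 3 := fun s hs => by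
          refine (hK x (xn n) t ω _ (fun s hs => (hn s hs).le) s hs).trans_lt ?_
          rw [mul_div_assoc', div_lt_iff₀ (by positivity)]
          nlinarith
        have hclip : clip (ρ n) t ω = t := clip_hitTime_of_lt hD (hU n) hlt
        have h5 := hZ'le n t ω
        rw [hclip, add_assoc, ← EReal.coe_add] at h5
        refine le_trans (add_le_add_right (EReal.coe_le_coe_iff.2 ?_) _) h5
        linarith [le_of_abs_le (hlt t le_rfl).le]

end MartingaleSpace

end ModelFree

namespace ModelFree

/-! ### Fine covers and sampling along them -/

section FineTimes

variable {Ω : Type*}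

/-- The times at which `x` has moved by `r` since the last one, as long as this happens
outside of `B`. -/
def fineTimes (B : Set (ℝ≥0 × Ω)) (x : ℝ≥0 → Ω → ℝ) (r : ℝ) : ℕ → Ω → WithTop ℝ≥0
  | 0 => fun _ => ((0 : ℝ≥0) : WithTop ℝ≥0)
  | n + 1 => hitTime B (fun t ω => |x t ω - x (clip (fineTimes B x r n) t ω) ω|) r

/-- The increments from time `0` of `x`, sampled at the times `σ_k ∧ t`. -/
def sampled (x : ℝ≥0 → Ω → ℝ) (σ : ℕ → Ω → WithTop ℝ≥0) (t : ℝ≥0) (ω : Ω) (k : ℕ) : ℝ :=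
  x (clip (σ k) t ω) ω - x 0 ω

lemma sampled_zero {x : ℝ≥0 → Ω → ℝ} {σ : ℕ → Ω → WithTop ℝ≥0} {ω : Ω} (hσ : σ 0 ω = 0)
    (t : ℝ≥0) : sampled x σ t ω 0 = 0 := by
  rw [sampled, clip_of_eq_zero hσ, sub_self]

lemma sampled_succ_sub (x : ℝ≥0 → Ω → ℝ) (σ : ℕ → Ω → WithTop ℝ≥0) (t : ℝ≥0) (ω : Ω) (k : ℕ) :
    sampled x σ t ω (k + 1) - sampled x σ t ω k =
      x (clip (σ (k + 1)) t ω) ω - x (clip (σ k) t ω) ω := by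
  rw [sampled, sampled, sub_sub_sub_cancel_right]

end FineTimes

lemma exists_runMax_eq (x : ℕ → ℝ) (n : ℕ) : ∃ k ≤ n, runMax x n = |x k| := by
  induction n with
  | zero => exact ⟨0, le_rfl, rfl⟩
  | succ n ih =>
    obtain ⟨k, hk, h⟩ := ih
    rcases max_choice (runMax x n) |x (n + 1)| with h' | h'
    · exact ⟨k, hk.trans n.le_succ, h'.trans h⟩
    · exact ⟨n + 1, le_rfl, h'⟩

variable {Ω : Type*} [m : MeasurableSpace Ω] {d : ℕ}

namespace MartingaleSpace

variable {𝓜 : MartingaleSpace Ω d} {B : Set (ℝ≥0 × Ω)} {x : ℝ≥0 → Ω → ℝ} {r : ℝ}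

section Cover

variable (hB : 𝓜.IsExceptional B) (hx : 𝓜.ContOff B x)

include hB hx

lemma ContOff.fineTimes_stopping (n : ℕ) : IsStoppingTime 𝓜.ℱ (fineTimes B x r n) := by
  induction n with
  | zero => exact isStoppingTime_const _ _
  | succ n ih => exact (hx.sub (hx.stopped hB ih)).abs.isStoppingTime_hitTime hB r

lemma ContOff.contOff_fineTimes (n : ℕ) :
    𝓜.ContOff B (fun t ω => |x t ω - x (clip (fineTimes B x r n) t ω) ω|) :=
  (hx.sub (hx.stopped hB (hx.fineTimes_stopping hB n))).abs

lemma ContOff.fineTimes_succ_spec {n : ℕ} {s : ℝ≥0} {ω : Ω} (h : fineTimes B x r (n + 1) ω = s) :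
    (s, ω) ∉ B ∧ r ≤ |x s ω - x (clip (fineTimes B x r n) s ω) ω| :=
  (hx.contOff_fineTimes hB n).hitTime_spec hB h

lemma ContOff.fineTimes_mono (hr : 0 < r) (n : ℕ) (ω : Ω) :
    fineTimes B x r n ω ≤ fineTimes B x r (n + 1) ω := by
  rcases eq_or_ne (fineTimes B x r (n + 1) ω) ⊤ with h | h
  · rw [h]; exact le_top
  · obtain ⟨s, hs⟩ := WithTop.ne_top_iff_exists.1 h
    have h1 := (hx.fineTimes_succ_spec hB hs.symm).2
    rw [← hs]
    by_contra! hlt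
    rw [clip_of_le hlt.le, sub_self, abs_zero] at h1
    linarith

lemma ContOff.abs_sub_le_of_fineTimes (hr : 0 < r) {t u : ℝ≥0} {ω : Ω} (ht : (t, ω) ∉ B) {n : ℕ}
    (h1 : clip (fineTimes B x r n) t ω ≤ u) (h2 : u ≤ clip (fineTimes B x r (n + 1)) t ω) :
    |x u ω - x (clip (fineTimes B x r n) t ω) ω| ≤ r := by
  have h3 := (hx.contOff_fineTimes (r := r) hB n).le_of_hitTime hB ht
    (by simp only [clip_zero_right, sub_self, abs_zero]; exact hr.le) h2
  have hut : u ≤ t := h2.trans clip_le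
  have h4 : clip (fineTimes B x r n) u ω = clip (fineTimes B x r n) t ω :=
    (monotone_clip _ ω hut).antisymm (le_clip_iff.2 ⟨h1, coe_clip_le⟩)
  rwa [h4] at h3

lemma ContOff.abs_sampled_succ_sub_le (hr : 0 < r) {t : ℝ≥0} {ω : Ω} (ht : (t, ω) ∉ B) (n : ℕ) :
    |sampled x (fineTimes B x r) t ω (n + 1) - sampled x (fineTimes B x r) t ω n| ≤ r := by
  rw [sampled_succ_sub]
  exact hx.abs_sub_le_of_fineTimes hB hr ht (clip_mono (hx.fineTimes_mono hB hr n ω)) le_rfl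

/-- By uniform continuity, only finitely many times occur before `t`. -/
lemma ContOff.finite_fineTimes_le (hr : 0 < r) {t : ℝ≥0} {ω : Ω} (ht : (t, ω) ∉ B) :
    {n | fineTimes B x r n ω ≤ (t : WithTop ℝ≥0)}.Finite := by
  have huc : UniformContinuousOn (fun s => x s ω) (Set.Icc 0 t) :=
    isCompact_Icc.uniformContinuousOn_of_continuous ((hx.cont ht).mono fun s hs => hs.2)
  obtain ⟨η, hη, h⟩ := Metric.uniformContinuousOn_iff.1 huc r hr
  -- consecutive times are at least `η` apart
  have key : ∀ (n : ℕ) (s : ℝ≥0), fineTimes B x r n ω = s → s ≤ t → n * η ≤ (s : ℝ) := by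
    intro n
    induction n with
    | zero => intro s _ _; simp
    | succ n ih =>
      intro s hs hst
      have hle := hx.fineTimes_mono hB hr n ω
      rw [hs] at hle
      obtain ⟨s', hs'⟩ := WithTop.ne_top_iff_exists.1 (ne_top_of_le_ne_top WithTop.coe_ne_top hle)
      have hss : s' ≤ s := by rw [← hs'] at hle; exact WithTop.coe_le_coe.1 hle
      have h1 := ih s' hs'.symm (hss.trans hst)
      have h2 := (hx.fineTimes_succ_spec hB hs).2
      rw [clip_of_eq hs'.symm hss] at h2
      have h3 : η ≤ dist s s' := by
        by_contra! hlt
        have := h s ⟨zero_le, hst⟩ s' ⟨zero_le, hss.trans hst⟩ hlt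
        rw [Real.dist_eq] at this
        linarith
      rw [NNReal.dist_eq, abs_of_nonneg (sub_nonneg.2 (NNReal.coe_le_coe.2 hss))] at h3
      push_cast
      linarith
  obtain ⟨N, hN⟩ := exists_nat_gt ((t : ℝ) / η)
  refine (Set.finite_Iic N).subset fun n hn => ?_
  have hn' : fineTimes B x r n ω ≤ (t : WithTop ℝ≥0) := hn
  obtain ⟨s, hs⟩ := WithTop.ne_top_iff_exists.1 (ne_top_of_le_ne_top WithTop.coe_ne_top hn')
  have hst : s ≤ t := by rw [← hs] at hn'; exact WithTop.coe_le_coe.1 hn'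
  have h1 := key n s hs.symm hst
  rw [div_lt_iff₀ hη] at hN
  have h2 : (s : ℝ) ≤ t := NNReal.coe_le_coe.2 hst
  have h3 : (n : ℝ) < N := lt_of_mul_lt_mul_right (by linarith) hη.le
  exact Set.mem_Iic.2 (Nat.cast_lt.1 h3).le

lemma ContOff.exists_lt_fineTimes (hr : 0 < r) {t : ℝ≥0} {ω : Ω} (ht : (t, ω) ∉ B) :
    ∃ N, ∀ n ≥ N, (t : WithTop ℝ≥0) < fineTimes B x r n ω := by
  obtain ⟨N, hN⟩ := (hx.finite_fineTimes_le hB hr ht).exists_notMem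
  refine ⟨N, fun n hn => ?_⟩
  have hmono : Monotone fun n => fineTimes B x r n ω :=
    monotone_nat_of_le_succ fun n => hx.fineTimes_mono hB hr n ω
  exact (not_le.1 hN).trans_le (hmono hn)

lemma ContOff.isFineCover {X : ℝ≥0 → Ω → EReal}
    (hX : ∀ t ω, (t, ω) ∉ B → X t ω = (x t ω : EReal)) (hr : 0 < r) :
    𝓜.IsFineCover X (2 * r) (fineTimes B x r) := by
  refine ⟨hx.fineTimes_stopping hB, hx.fineTimes_mono hB hr, fun _ => rfl, Bᶜ, hB.blockable, ?_⟩
  rintro ⟨t, ω⟩ ht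
  refine ⟨hx.finite_fineTimes_le hB hr ht, fun n => ?_⟩
  set c := x (clip (fineTimes B x r n) t ω) ω with hc
  have hs : ∀ s ∈ {s : ℝ≥0 | min (fineTimes B x r n ω) (t : WithTop ℝ≥0) ≤ s ∧
      s ≤ min (fineTimes B x r (n + 1) ω) (t : WithTop ℝ≥0)},
      X s ω = (x s ω : EReal) ∧ |x s ω - c| ≤ r := by
    rintro s ⟨h1, h2⟩
    rw [min_comm, ← coe_clip, WithTop.coe_le_coe] at h1
    rw [min_comm, ← coe_clip, WithTop.coe_le_coe] at h2
    exact ⟨hX s ω fun h => ht (hB.mono h (h2.trans clip_le)),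
      hx.abs_sub_le_of_fineTimes hB hr ht h1 h2⟩
  refine (EReal.sub_le_sub (iSup₂_le (a := ((c + r : ℝ) : EReal)) fun s h => ?_)
    (le_iInf₂ (a := ((c - r : ℝ) : EReal)) fun s h => ?_)).trans (le_of_eq ?_)
  · rw [(hs s h).1]
    exact EReal.coe_le_coe_iff.2 (by linarith [le_of_abs_le (hs s h).2])
  · rw [(hs s h).1]
    exact EReal.coe_le_coe_iff.2 (by linarith [neg_le_of_abs_le (hs s h).2])
  · rw [← EReal.coe_sub]; congr 1; ring

/-- Between two sampling times the process stays within `r` of its last sampled value. -/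
lemma ContOff.exists_abs_sub_le_runMax (hr : 0 < r) {t : ℝ≥0} {ω : Ω} (ht : (t, ω) ∉ B) :
    ∃ N, ∀ n ≥ N, ∀ s ≤ t,
      |x s ω - x 0 ω| ≤ runMax (sampled x (fineTimes B x r) t ω) n + r := by
  obtain ⟨N, hN⟩ := hx.exists_lt_fineTimes hB hr ht
  refine ⟨N, fun n hn s hs => ?_⟩
  have hex : ∃ k, (s : WithTop ℝ≥0) < fineTimes B x r k ω :=
    ⟨N, (WithTop.coe_le_coe.2 hs).trans_lt (hN N le_rfl)⟩
  classical
  obtain ⟨k, hk⟩ : ∃ k, Nat.find hex = k + 1 := by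
    refine Nat.exists_eq_succ_of_ne_zero fun h0 => ?_
    have h1 := Nat.find_spec hex
    rw [h0] at h1
    exact absurd h1 (not_lt.2 bot_le)
  have h1 : (s : WithTop ℝ≥0) < fineTimes B x r (k + 1) ω := hk ▸ Nat.find_spec hex
  have h2 : fineTimes B x r k ω ≤ s := not_lt.1 (Nat.find_min hex (by omega))
  have hkn : k ≤ n := by
    have : Nat.find hex ≤ N := Nat.find_min' hex ((WithTop.coe_le_coe.2 hs).trans_lt (hN N le_rfl))
    omega
  have h3 := hx.abs_sub_le_of_fineTimes hB hr ht (u := s) (n := k)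
    (clip_le_iff.2 (Or.inr h2)) (le_clip_iff.2 ⟨hs, h1.le⟩)
  have h4 := abs_le_runMax_of_le (sampled x (fineTimes B x r) t ω) hkn
  have h5 : |x s ω - x 0 ω| ≤ |x s ω - x (clip (fineTimes B x r k) t ω) ω| +
      |sampled x (fineTimes B x r) t ω k| := by
    have := abs_add_le (x s ω - x (clip (fineTimes B x r k) t ω) ω)
      (sampled x (fineTimes B x r) t ω k)
    rw [sampled, sub_add_sub_cancel] at this
    exact this
  linarith

lemma ContOff.runQV_sampled (n : ℕ) :
    𝓜.ContOff B fun t ω => runQV (sampled x (fineTimes B x r) t ω) n := by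
  simp only [runQV, sampled_succ_sub]
  exact ContOff.sum _ fun k _ => ((hx.stopped hB (hx.fineTimes_stopping hB _)).sub
    (hx.stopped hB (hx.fineTimes_stopping hB _))).pow 2

lemma ContOff.measurable_sampled (t : ℝ≥0) (k : ℕ) :
    Measurable[𝓜.ℱ t] fun ω => sampled x (fineTimes B x r) t ω k :=
  ((hx.stopped hB (hx.fineTimes_stopping hB k)).meas t).sub
    ((hx.meas 0).mono (𝓜.ℱ.mono zero_le) le_rfl)

lemma ContOff.measurable_runMax_sampled (t : ℝ≥0) (k : ℕ) :
    Measurable[𝓜.ℱ t] fun ω => runMax (sampled x (fineTimes B x r) t ω) k := by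
  induction k with
  | zero => exact measurable_abs.comp (hx.measurable_sampled hB t 0)
  | succ k ih => exact ih.max (measurable_abs.comp (hx.measurable_sampled hB t (k + 1)))

lemma ContOff.simpleQV_eq {X : ℝ≥0 → Ω → EReal}
    (hX : ∀ t ω, (t, ω) ∉ B → X t ω = (x t ω : EReal)) (hr : 0 < r) {t : ℝ≥0} {ω : Ω}
    (ht : (t, ω) ∉ B) : ∃ N, ∀ n ≥ N, ∀ s ≤ t, (simpleQV X (fineTimes B x r) s ω : EReal) =
      ((runQV (sampled x (fineTimes B x r) s ω) n : ℝ) : EReal) := by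
  obtain ⟨N, hN⟩ := hx.exists_lt_fineTimes hB hr ht
  refine ⟨N, fun n hn s hs => ?_⟩
  have hsB : ∀ k, (clip (fineTimes B x r k) s ω, ω) ∉ B := fun k h =>
    ht (hB.mono h (clip_le.trans hs))
  have hterm : ∀ k, (stoppedProcess X (fineTimes B x r (k + 1)) s ω -
      stoppedProcess X (fineTimes B x r k) s ω).abs ^ 2 =
      ENNReal.ofReal ((sampled x (fineTimes B x r) s ω (k + 1) -
        sampled x (fineTimes B x r) s ω k) ^ 2) := by
    intro k
    rw [stoppedProcess_apply, stoppedProcess_apply, hX _ _ (hsB _), hX _ _ (hsB _),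
      ← EReal.coe_sub, EReal.abs_def, sampled_succ_sub, ← ENNReal.ofReal_pow (abs_nonneg _),
      sq_abs]
  have hzero : ∀ k ∉ Finset.range n, ENNReal.ofReal ((sampled x (fineTimes B x r) s ω (k + 1) -
        sampled x (fineTimes B x r) s ω k) ^ 2) = 0 := by
    intro k hk
    have hk' : n ≤ k := by simpa using hk
    have hs' : (s : WithTop ℝ≥0) ≤ t := WithTop.coe_le_coe.2 hs
    rw [sampled_succ_sub, clip_of_le (hs'.trans (hN _ (by omega)).le),
      clip_of_le (hs'.trans (hN _ (by omega)).le)]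
    simp
  rw [simpleQV, tsum_congr hterm, tsum_eq_sum hzero,
    ← ENNReal.ofReal_sum_of_nonneg fun _ _ => sq_nonneg _, EReal.coe_ennreal_ofReal]
  change ((max (runQV _ n) 0 : ℝ) : EReal) = _
  rw [max_eq_left (runQV_nonneg _ _)]

/-- The discrete stochastic integrals along a fine cover, with weights that are continuous functions
of the sampled path, are elementary integrals. The positions are bounded because the process
moves by `r` between sampling times. -/
lemma ContOff.exists_elementary (hr : 0 < r) {H : ℝ × ℝ × ℝ → ℝ} (hH : Continuous H) (n : ℕ) :
    ∃ I : 𝓜.Elementary, ∀ t ω, I.integral x t ω = ∑ k ∈ Finset.range n,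
      H (sampled x (fineTimes B x r) t ω k, runMax (sampled x (fineTimes B x r) t ω) k,
        runQV (sampled x (fineTimes B x r) t ω) k) *
      (sampled x (fineTimes B x r) t ω (k + 1) - sampled x (fineTimes B x r) t ω k) := by
  classical
  set σ := fineTimes B x r with hσ
  have hmono : ∀ ω, Monotone fun n => σ n ω := fun ω =>
    monotone_nat_of_le_succ fun n => hx.fineTimes_mono hB hr n ω
  let F : ℕ → ℝ≥0 → Ω → ℝ := fun k t ω => H (sampled x σ t ω k, runMax (sampled x σ t ω) k,
    runQV (sampled x σ t ω) k)
  have hF : ∀ k t, Measurable[𝓜.ℱ t] (F k t) := fun k t =>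
    hH.measurable.comp ((hx.measurable_sampled hB t k).prodMk
      ((hx.measurable_runMax_sampled hB t k).prodMk ((hx.runQV_sampled hB k).meas t)))
  -- the value of the weight at the time `σ k`
  let g : ℕ → Ω → ℝ := fun k ω => if σ k ω = ⊤ then 0 else F k ((σ k ω).untopD 0) ω
  have hgF : ∀ k (t : ℝ≥0) ω, σ k ω ≤ t → g k ω = F k t ω := by
    intro k t ω h
    have hne := ne_top_of_le_ne_top WithTop.coe_ne_top h
    obtain ⟨s, hs⟩ := WithTop.ne_top_iff_exists.1 hne
    have hst : s ≤ t := by rw [← hs] at h; exact WithTop.coe_le_coe.1 h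
    have hsam : ∀ j ≤ k, sampled x σ s ω j = sampled x σ t ω j := by
      intro j hj
      have : clip (σ j) s ω = clip (σ j) t ω := by
        refine (monotone_clip _ ω hst).antisymm (le_clip_iff.2 ⟨?_, coe_clip_le⟩)
        exact clip_le_iff.2 (Or.inr ((hmono ω hj).trans hs.ge))
      rw [sampled, sampled, this]
    simp only [g, if_neg hne, ← hs, WithTop.untopD_coe]
    simp only [F]
    rw [hsam k le_rfl, runMax_congr hsam, runQV_congr hsam]
  have hbound : ∀ k, ∃ K : ℝ, ∀ ω, |g k ω| ≤ K := by
    intro k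
    set R : ℝ := max (k * r) (k * r ^ 2) with hR
    have hcomp : IsCompact (Set.Icc (-R) R ×ˢ Set.Icc (-R) R ×ˢ Set.Icc (-R) R) :=
      isCompact_Icc.prod (isCompact_Icc.prod isCompact_Icc)
    obtain ⟨K, hK⟩ := hcomp.exists_bound_of_continuousOn hH.continuousOn
    refine ⟨max K 0, fun ω => ?_⟩
    rcases eq_or_ne (σ k ω) ⊤ with h | h
    · simp only [g, if_pos h, abs_zero]; exact le_max_right _ _
    obtain ⟨s, hs⟩ := WithTop.ne_top_iff_exists.1 h
    rw [hgF k s ω hs.ge]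
    have hstep : ∀ j < k, |sampled x σ s ω (j + 1) - sampled x σ s ω j| ≤ r := by
      intro j hj
      obtain ⟨l, rfl⟩ : ∃ l, k = l + 1 := ⟨k - 1, by omega⟩
      exact hx.abs_sampled_succ_sub_le hB hr (hx.fineTimes_succ_spec hB hs.symm).1 j
    have hsam : ∀ j ≤ k, |sampled x σ s ω j| ≤ k * r := by
      have : ∀ j ≤ k, |sampled x σ s ω j| ≤ j * r := by
        intro j
        induction j with
        | zero => intro _; rw [sampled_zero rfl]; simp
        | succ j ih =>
          intro hj
          have h1 := hstep j hj
          have h2 := ih (by omega)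
          have h3 := abs_sub_abs_le_abs_sub (sampled x σ s ω (j + 1)) (sampled x σ s ω j)
          push_cast
          linarith
      intro j hj
      have h1 : (j : ℝ) ≤ k := Nat.cast_le.2 hj
      exact (this j hj).trans (by gcongr)
    have hqv : runQV (sampled x σ s ω) k ≤ k * r ^ 2 := by
      have : runQV (sampled x σ s ω) k ≤ ∑ _j ∈ Finset.range k, r ^ 2 := by
        refine Finset.sum_le_sum fun j hj => ?_
        exact sq_le_sq' (by linarith [neg_le_of_abs_le (hstep j (Finset.mem_range.1 hj))])
          (le_of_abs_le (hstep j (Finset.mem_range.1 hj)))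
      simpa using this
    have hR1 : k * r ≤ R := le_max_left _ _
    have hR2 : k * r ^ 2 ≤ R := le_max_right _ _
    have hR0 : 0 ≤ R := le_trans (by positivity) hR1
    refine (hK _ ⟨abs_le.1 ((hsam k le_rfl).trans hR1), ⟨?_, ?_⟩, ⟨?_, ?_⟩⟩).trans
      (le_max_left _ _)
    · exact (neg_nonpos.2 hR0).trans (runMax_nonneg _ _)
    · exact (runMax_le hsam).trans hR1
    · exact (neg_nonpos.2 hR0).trans (runQV_nonneg _ _)
    · exact hqv.trans hR2
  refine ⟨{ n := n, a := σ, b := fun k => σ (k + 1), g := g,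
            stopping_a := hx.fineTimes_stopping hB
            stopping_b := fun k => hx.fineTimes_stopping hB (k + 1)
            le := hx.fineTimes_mono hB hr
            measurable := fun k => measurable_stopping_of_local _ (F k) (hF k) (hgF k)
              fun ω h => if_pos h
            bounded := hbound
            zero_of_top := fun k ω h => if_pos h }, fun t ω => ?_⟩
  refine Finset.sum_congr rfl fun k _ => ?_
  rw [sampled_succ_sub]
  dsimp only
  rcases le_or_gt (σ k ω) t with h | h
  · rw [hgF k t ω h]
  · rw [clip_of_le h.le, clip_of_le (h.le.trans (hx.fineTimes_mono hB hr k ω)), sub_self, mul_zero,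
      mul_zero]

end Cover

end MartingaleSpace

end ModelFree

namespace ModelFree

/-! ### Comparison of upper expectations -/

/-- A power of `Q` exceeds the power of `v` at most by a factor close to `1` and a small constant if
`Q` exceeds `v` at most by a small constant. -/
lemma exists_rpow_le {q c η : ℝ} (hq : 0 < q) (hc : 1 < c) (hη : 0 < η) :
    ∃ a > 0, ∀ v Q : ℝ, 0 ≤ v → 0 ≤ Q → Q ≤ v + a → Q ^ q ≤ c * v ^ q + η := by
  have hc0 : 0 < c := one_pos.trans hc
  -- below the level `b`, where `c * b ^ q = η`, the constant `η` suffices; above it the factor `c`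
  set l : ℝ := c ^ (1 / q) with hl
  set b : ℝ := (η / c) ^ (1 / q) with hb
  have hl1 : 1 < l := Real.one_lt_rpow hc (by positivity)
  have hb0 : 0 < b := Real.rpow_pos_of_pos (by positivity) _
  have hlq : l ^ q = c := by
    rw [hl, ← Real.rpow_mul hc0.le, one_div_mul_cancel hq.ne', Real.rpow_one]
  have hbq : c * b ^ q = η := by
    rw [hb, ← Real.rpow_mul (by positivity), one_div_mul_cancel hq.ne', Real.rpow_one]
    field_simp
  have key : ∀ w Q : ℝ, 0 ≤ w → 0 ≤ Q → Q ≤ l * w → Q ^ q ≤ c * w ^ q := fun w Q hw hQ h => by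
    have := Real.rpow_le_rpow hQ h hq.le
    rwa [Real.mul_rpow (by linarith) hw, hlq] at this
  refine ⟨(l - 1) * b, mul_pos (by linarith) hb0, fun v Q hv hQ h => ?_⟩
  rcases le_total b v with hbv | hbv
  · have := key v Q hv hQ (by nlinarith)
    linarith
  · have h1 := key b Q hb0.le hQ (by nlinarith)
    have h2 : 0 ≤ c * v ^ q := by positivity
    linarith

variable {Ω : Type*} [m : MeasurableSpace Ω] {d : ℕ}

namespace MartingaleSpace

variable {𝓜 : MartingaleSpace Ω d} {B D : Set (ℝ≥0 × Ω)} {x : ℝ≥0 → Ω → ℝ} {X V : ℝ≥0 → Ω → EReal}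

/-- To compare upper expectations, the dominating supermartingales may be transformed with a loss of
a factor arbitrarily close to `1` and an arbitrarily small constant. -/
lemma upperExpectation_le_mul [Nonempty Ω] {Y Y' : ℝ≥0 → Ω → EReal} {K : ℝ} (hK : 0 < K)
    (h : ∀ Z, 𝓜.NonnegSupermartingale Z → (∀ t ω, Y' t ω ≤ Z t ω) → ∀ c : ℝ, 1 < c →
      ∀ ε : ℝ, 0 < ε → ∃ Z', 𝓜.NonnegSupermartingale Z' ∧
        (∀ ω, Z' 0 ω ≤ ((K * c : ℝ) : EReal) * Z 0 ω + (ε : EReal)) ∧ ∀ t ω, Y t ω ≤ Z' t ω) :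
    𝓜.upperExpectation Y ≤ (K : EReal) * 𝓜.upperExpectation Y' := by
  obtain ⟨ω₀⟩ := ‹Nonempty Ω›
  have key : ∀ z Z, 𝓜.NonnegSupermartingale Z → (∀ ω, Z 0 ω = z) → (∀ t ω, Y' t ω ≤ Z t ω) →
      𝓜.upperExpectation Y ≤ (K : EReal) * z := by
    intro z Z hZ hz hY
    have hz0 : 0 ≤ z := hz ω₀ ▸ hZ.nonneg 0 ω₀
    induction z with
    | bot => simp at hz0
    | top => rw [EReal.coe_mul_top_of_pos hK]; exact le_top
    | coe z =>
      have hle : ∀ e : ℝ, 0 < e → 𝓜.upperExpectation Y ≤ ((K * (1 + e) * z + e : ℝ) : EReal) := by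
        intro e he
        obtain ⟨Z', h1, h2, h3⟩ := h Z hZ hY (1 + e) (by linarith) e he
        obtain ⟨z', hz'⟩ := h1.exists_initial
        have hmem : 𝓜.upperExpectation Y ≤ z' := sInf_le ⟨Z', h1, hz', h3⟩
        refine hmem.trans ?_
        have := h2 ω₀
        rwa [hz', hz, ← EReal.coe_mul, ← EReal.coe_add] at this
      have hlim : Tendsto (fun e : ℝ => ((K * (1 + e) * z + e : ℝ) : EReal)) (𝓝[>] 0)
          (𝓝 ((K : EReal) * (z : EReal))) := by
        rw [← EReal.coe_mul]
        refine (continuous_coe_real_ereal.tendsto _).comp (tendsto_nhdsWithin_of_tendsto_nhds ?_)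
        have hc : Continuous fun e : ℝ => K * (1 + e) * z + e := by fun_prop
        simpa using hc.tendsto 0
      exact ge_of_tendsto hlim (eventually_mem_nhdsWithin.mono hle)
  have hKK : (K : EReal) * ((K⁻¹ : ℝ) : EReal) = 1 := by
    rw [← EReal.coe_mul, mul_inv_cancel₀ hK.ne', EReal.coe_one]
  have h1 : ((K⁻¹ : ℝ) : EReal) * 𝓜.upperExpectation Y ≤ 𝓜.upperExpectation Y' := by
    refine le_sInf fun z ⟨Z, hZ, hz, hY⟩ => ?_
    refine (mul_le_mul_of_nonneg_left (key z Z hZ hz hY)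
      (EReal.coe_nonneg.2 (inv_nonneg.2 hK.le))).trans (le_of_eq ?_)
    rw [← mul_assoc, mul_comm _ (K : EReal), hKK, one_mul]
  calc 𝓜.upperExpectation Y = (K : EReal) * (((K⁻¹ : ℝ) : EReal) * 𝓜.upperExpectation Y) := by
        rw [← mul_assoc, hKK, one_mul]
    _ ≤ _ := mul_le_mul_of_nonneg_left h1 (EReal.coe_nonneg.2 hK.le)

/-- A double sequence of nonnegative supermartingales whose iterated lower limit dominates `Y`
w.i.e. yields one that dominates `Y` everywhere, up to an arbitrarily small initial value. -/
lemma exists_dominating_of_liminf (hD : 𝓜.InstantlyBlockable D) {Z : ℕ → ℕ → ℝ≥0 → Ω → EReal}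
    (hZ : ∀ k n, 𝓜.NonnegSupermartingale (Z k n)) {z : Ω → EReal} (hz : ∀ k n ω, Z k n 0 ω ≤ z ω)
    {Y : ℝ≥0 → Ω → EReal} (hY : ∀ t ω, (t, ω) ∉ D →
      Y t ω ≤ liminf (fun k => liminf (fun n => Z k n t ω) atTop) atTop) {ε : ℝ} (hε : 0 < ε) :
    ∃ Z', 𝓜.NonnegSupermartingale Z' ∧ (∀ ω, Z' 0 ω ≤ z ω + (ε : EReal)) ∧
      ∀ t ω, Y t ω ≤ Z' t ω := by
  obtain ⟨N, hN, hN0, hN'⟩ := hD.exists_blocking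
  have hL := NonnegSupermartingale.liminf _ fun k => NonnegSupermartingale.liminf _ (hZ k)
  have hle : ∀ {u : ℕ → EReal} {c : EReal}, (∀ n, u n ≤ c) → liminf u atTop ≤ c := fun h =>
    liminf_le_of_le (by isBoundedDefault) fun b hb => by
      obtain ⟨n, hn⟩ := hb.exists
      exact hn.trans (h n)
  refine ⟨_, hL.add_supermartingale (hN.scale hε.le), fun ω => ?_, fun t ω => ?_⟩
  · rw [hN0, mul_one]
    exact add_le_add_left (hle fun k => hle fun n => hz k n ω) _
  · by_cases ht : (t, ω) ∈ D
    · rw [hN' t ω ht, EReal.coe_mul_top_of_pos hε, EReal.add_top_of_ne_bot (hL.ne_bot t ω)]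
      exact le_top
    · exact (hY t ω ht).trans (le_add_of_nonneg_right ((hN.scale hε.le).nonneg t ω))

/-- Outside of an exceptional set, a quadratic variation is a nonnegative continuous process and the
locally uniform limit of the sums of squares along the fine covers of accuracies `r_k`. -/
lemma IsQuadraticVariation.exists_isExceptional [NeZero d] (hA : 𝓜.AssumptionA)
    (hB : 𝓜.IsExceptional B) (hx : 𝓜.ContOff B x) (hX : ∀ t ω, (t, ω) ∉ B → X t ω = (x t ω : EReal))
    (hV : 𝓜.IsQuadraticVariation X V) {r : ℕ → ℝ} (hr : ∀ k, 0 < r k) (hsum : Summable r) :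
    ∃ D, B ⊆ D ∧ 𝓜.IsExceptional D ∧ 𝓜.ContOff D (fun t ω => (V t ω).toReal) ∧
      (∀ t ω, (t, ω) ∉ D → V t ω = ((V t ω).toReal : EReal) ∧ 0 ≤ (V t ω).toReal) ∧
      ∀ t ω, (t, ω) ∉ D → ∀ e : ℝ, 0 < e → ∀ᶠ k in atTop, ∃ N, ∀ n ≥ N, ∀ s ≤ t,
        |(V s ω).toReal - runQV (sampled x (fineTimes B x (r k)) s ω) n| < e := by
  have hlim := hV.tendsto (fun k => 2 * r k) (fun k => fineTimes B x (r k))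
    (fun k => mul_pos two_pos (hr k)) (hsum.mul_left 2) fun k => hx.isFineCover hB hX (hr k)
  obtain ⟨D, hsub, hD⟩ := (hB.blockable.union
    (hV.continuous.blockable_compl.union hlim.blockable_compl)).exists_isExceptional hA
  have hDB : ∀ {t : ℝ≥0} {ω : Ω}, (t, ω) ∉ D → (t, ω) ∉ B := fun ht h => ht (hsub (Or.inl h))
  have hDle : ∀ {s t : ℝ≥0} {ω : Ω}, (t, ω) ∉ D → s ≤ t → (s, ω) ∉ D :=
    fun ht hst h => ht (hD.mono h hst)
  have hcont : ∀ t ω, (t, ω) ∉ D → (V t ω ≠ ⊥ ∧ V t ω ≠ ⊤) ∧ ContinuousAt (fun s => V s ω) t := by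
    intro t ω ht
    by_contra h
    exact ht (hsub (Or.inr (Or.inl h)))
  have hreal : ∀ t ω, (t, ω) ∉ D → V t ω = ((V t ω).toReal : EReal) := fun t ω ht =>
    (EReal.coe_toReal (hcont t ω ht).1.2 (hcont t ω ht).1.1).symm
  have happrox : ∀ t ω, (t, ω) ∉ D → ∀ e : ℝ, 0 < e → ∀ᶠ k in atTop, ∃ N, ∀ n ≥ N, ∀ s ≤ t,
      |(V s ω).toReal - runQV (sampled x (fineTimes B x (r k)) s ω) n| < e := by
    intro t ω ht e he
    have h1 : (t, ω) ∈ {q : ℝ≥0 × Ω | Tendsto (fun k => ⨆ s ∈ Set.Icc 0 q.1, (V s q.2 -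
        (simpleQV X (fineTimes B x (r k)) s q.2 : EReal)).abs) atTop (𝓝 0)} := by
      by_contra h
      exact ht (hsub (Or.inr (Or.inr h)))
    choose N hN using fun k => hx.simpleQV_eq hB hX (hr k) (hDB ht)
    filter_upwards [eventually_abs_sub_lt h1 (fun s hs => hreal s ω (hDle ht hs))
      (fun k s hs => hN k (N k) le_rfl s hs) he] with k hk
    refine ⟨N k, fun n hn s hs => ?_⟩
    have h2 := hN k n hn s hs
    rw [hN k (N k) le_rfl s hs, EReal.coe_eq_coe_iff] at h2
    rw [← h2]
    exact hk s hs
  refine ⟨D, Set.subset_union_left.trans hsub, hD,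
    ⟨fun t => measurable_ereal_toReal.comp (hV.process t), fun {t ω} ht s hs => ?_⟩,
    fun t ω ht => ⟨hreal t ω ht, ?_⟩, happrox⟩
  · have h := hcont s ω (hDle ht hs)
    exact (ContinuousAt.comp (f := fun s => V s ω) (EReal.tendsto_toReal h.1.2 h.1.1)
      h.2).continuousWithinAt
  · refine le_of_forall_pos_le_add fun e he => ?_
    obtain ⟨k, N, hN⟩ := (happrox t ω ht e he).exists
    have h1 := hN N le_rfl t le_rfl
    have h2 := runQV_nonneg (sampled x (fineTimes B x (r k)) t ω) N
    linarith [(abs_lt.1 h1).1]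

lemma runMax_rpow_le_supProcess (hB : 𝓜.IsExceptional B)
    (hX : ∀ t ω, (t, ω) ∉ B → X t ω = (x t ω : EReal)) {σ : ℕ → Ω → WithTop ℝ≥0} {t : ℝ≥0} {ω : Ω}
    (ht : (t, ω) ∉ B) (n : ℕ) {p : ℝ} (hp : 0 ≤ p) :
    ((runMax (sampled x σ t ω) n ^ p : ℝ) : EReal) ≤
      ((supProcess (fun s ω => X s ω - X 0 ω) t ω ^ p : ℝ≥0∞) : EReal) := by
  obtain ⟨k, -, hk⟩ := exists_runMax_eq (sampled x σ t ω) n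
  have hu : (clip (σ k) t ω, ω) ∉ B := fun h => ht (hB.mono h clip_le)
  have h1 : ENNReal.ofReal |sampled x σ t ω k| ≤ supProcess (fun s ω => X s ω - X 0 ω) t ω := by
    refine le_iSup₂_of_le (clip (σ k) t ω) ⟨zero_le, clip_le⟩ (le_of_eq ?_)
    dsimp only
    rw [hX _ _ hu, hX 0 ω fun h => ht (hB.mono h zero_le), ← EReal.coe_sub, EReal.abs_def]
    rfl
  have h2 := ENNReal.rpow_le_rpow h1 hp
  rw [ENNReal.ofReal_rpow_of_nonneg (abs_nonneg _) hp, ← hk] at h2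
  have h3 := EReal.coe_ennreal_le_coe_ennreal_iff.2 h2
  rwa [EReal.coe_ennreal_ofReal,
    max_eq_left (Real.rpow_nonneg (runMax_nonneg _ _) _)] at h3

lemma ContOff.supProcess_le_runMax (hB : 𝓜.IsExceptional B) (hx : 𝓜.ContOff B x)
    (hX : ∀ t ω, (t, ω) ∉ B → X t ω = (x t ω : EReal)) {r : ℝ} (hr : 0 < r) {t : ℝ≥0} {ω : Ω}
    (ht : (t, ω) ∉ B) : ∃ N, ∀ n ≥ N, supProcess (fun s ω => X s ω - X 0 ω) t ω ≤
      ENNReal.ofReal (runMax (sampled x (fineTimes B x r) t ω) n) + ENNReal.ofReal r := by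
  obtain ⟨N, hN⟩ := hx.exists_abs_sub_le_runMax hB hr ht
  refine ⟨N, fun n hn => iSup₂_le fun s hs => ?_⟩
  dsimp only
  rw [hX s ω fun h => ht (hB.mono h hs.2), hX 0 ω fun h => ht (hB.mono h zero_le),
    ← EReal.coe_sub, EReal.abs_def, ← ENNReal.ofReal_add (runMax_nonneg _ _) hr.le]
  exact ENNReal.ofReal_le_ofReal (hN n hn s hs.2)

/-- Summable positive accuracies below a given bound. -/
lemma exists_accuracies {δ : ℝ} (hδ : 0 < δ) : ∃ r : ℕ → ℝ, (∀ k, 0 < r k) ∧ (∀ k, r k ≤ δ) ∧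
    Summable r := by
  have h : ∀ k : ℕ, 0 < min δ ((1 / 2) ^ k) := fun k => lt_min hδ (by positivity)
  exact ⟨fun k => min δ ((1 / 2) ^ k), h, fun k => min_le_left _ _,
    summable_geometric_two.of_nonneg_of_le (fun k => (h k).le) fun k => min_le_right _ _⟩

lemma coe_toENNReal_rpow {v q : ℝ} (hv : 0 ≤ v) (hq : 0 ≤ q) :
    ((((v : EReal).toENNReal) ^ q : ℝ≥0∞) : EReal) = ((v ^ q : ℝ) : EReal) := by
  rw [EReal.toENNReal_of_ne_top (EReal.coe_ne_top v), EReal.toReal_coe,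
    ENNReal.ofReal_rpow_of_nonneg hv hq, EReal.coe_ennreal_ofReal,
    max_eq_left (Real.rpow_nonneg hv q)]

section BDG

variable [NeZero d] [Nonempty Ω] (hA : 𝓜.AssumptionA) (hX : 𝓜.IsMartingale X)
  (hV : 𝓜.IsQuadraticVariation X V) {p : ℝ} (hp : 1 ≤ p)

include hA hX hV hp

/-- The discrete inequality along each fine cover is superhedged by the elementary integral that
occurs in it; the sums of squares converge to the quadratic variation. -/
theorem upperExpectation_qv_le :
    𝓜.upperExpectation (fun t ω => (((V t ω).toENNReal ^ (p / 2) : ℝ≥0∞) : EReal)) ≤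
      (((bdgLower p)⁻¹ : ℝ) : EReal) * 𝓜.upperExpectation (fun t ω =>
        ((supProcess (fun s ω => X s ω - X 0 ω) t ω ^ p : ℝ≥0∞) : EReal)) := by
  have hK : 0 < (bdgLower p)⁻¹ := inv_pos.2 (bdgLower_pos hp)
  refine upperExpectation_le_mul hK fun Z hZ hdom c hc ε hε => ?_
  have hp0 : 0 ≤ p := by linarith
  have hq : 0 < p / 2 := by linarith
  have hε3 : 0 < ε / 3 := by linarith
  obtain ⟨B, hB, hx, hXx, hhedge⟩ := hX.exists_isExceptional hA
  set x : ℝ≥0 → Ω → ℝ := fun t ω => (X t ω).toReal with hxdef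
  obtain ⟨δ, hδ, H, hH, hdisc⟩ := exists_weight_qv_le hp hε3
  obtain ⟨r, hr, hrδ, hsum⟩ := exists_accuracies hδ
  obtain ⟨D, hBD, hD, -, hVreal, happrox⟩ := hV.exists_isExceptional hA hB hx hXx hr hsum
  choose I hI using fun k n => hx.exists_elementary hB (hr k) hH n
  have hKc : 0 ≤ (bdgLower p)⁻¹ * c := by positivity
  have hZ1 := (hZ.scale hKc).add_supermartingale (NonnegSupermartingale.const hε3.le)
  have hineq : ∀ k n t ω, (t, ω) ∉ B →
      ((runQV (sampled x (fineTimes B x (r k)) t ω) n ^ (p / 2) : ℝ) : EReal) ≤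
        (((bdgLower p)⁻¹ * c : ℝ) : EReal) * Z t ω + ((ε / 3 : ℝ) : EReal) +
          ((I k n).integral x t ω : EReal) := by
    intro k n t ω ht
    have h1 := hdisc (sampled x (fineTimes B x (r k)) t ω) (sampled_zero rfl t)
      (fun j => (hx.abs_sampled_succ_sub_le hB (hr k) ht j).trans (hrδ k)) n
    rw [← hI k n t ω] at h1
    have h2 := (runMax_rpow_le_supProcess (σ := fineTimes B x (r k)) hB hXx ht n hp0).trans
      (hdom t ω)
    have h3 : (bdgLower p)⁻¹ * runMax (sampled x (fineTimes B x (r k)) t ω) n ^ p ≤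
        (bdgLower p)⁻¹ * c * runMax (sampled x (fineTimes B x (r k)) t ω) n ^ p :=
      mul_le_mul_of_nonneg_right (le_mul_of_one_le_right hK.le hc.le)
        (Real.rpow_nonneg (runMax_nonneg _ _) _)
    refine (EReal.coe_le_coe_iff.2 (h1.trans (add_le_add_left (add_le_add_left h3 _) _))).trans ?_
    rw [EReal.coe_add, EReal.coe_add, EReal.coe_mul _ (_ ^ p)]
    exact add_le_add_left (add_le_add_left
      (mul_le_mul_of_nonneg_left h2 (EReal.coe_nonneg.2 hKc)) _) _
  have hstep := fun k n => hhedge (I k n) _ hZ1 B hB.blockable (fun t ω ht =>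
    (EReal.coe_nonneg.2 (Real.rpow_nonneg (runQV_nonneg _ _) _)).trans (hineq k n t ω ht)) _ hε3
  choose Z' hZ' hZ'0 hZ'le using hstep
  suffices hY : ∀ t ω, (t, ω) ∉ D → (((V t ω).toENNReal ^ (p / 2) : ℝ≥0∞) : EReal) ≤
      liminf (fun k => liminf (fun n => Z' k n t ω) atTop) atTop by
    obtain ⟨Z'', h1, h2, h3⟩ := exists_dominating_of_liminf hD.blockable hZ' hZ'0 hY hε3
    refine ⟨Z'', h1, fun ω => (h2 ω).trans (le_of_eq ?_), h3⟩
    rw [add_assoc, add_assoc, ← EReal.coe_add, ← EReal.coe_add]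
    congr 2; ring
  intro t ω ht
  obtain ⟨hv, hv0⟩ := hVreal t ω ht
  rw [hv, coe_toENNReal_rpow hv0 hq.le]
  refine le_of_forall_lt fun b hb => ?_
  obtain ⟨b', hbb', hb'⟩ := exists_between hb
  refine hbb'.trans_le (le_liminf_of_le (by isBoundedDefault) ?_)
  have hc' : ContinuousAt (fun w : ℝ => ((w ^ (p / 2) : ℝ) : EReal)) (V t ω).toReal :=
    continuous_coe_real_ereal.continuousAt.comp
      (Real.continuousAt_rpow_const _ _ (Or.inr hq.le))
  obtain ⟨e, he, hball⟩ := Metric.eventually_nhds_iff.1 (hc'.eventually (lt_mem_nhds hb'))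
  filter_upwards [happrox t ω ht e he] with k hk
  obtain ⟨N, hN⟩ := hk
  refine le_liminf_of_le (by isBoundedDefault) ?_
  filter_upwards [eventually_ge_atTop N] with n hn
  have h4 := hball (y := runQV (sampled x (fineTimes B x (r k)) t ω) n) (by
    rw [dist_comm, Real.dist_eq]; exact hN n hn t le_rfl)
  exact h4.le.trans ((hineq k n t ω fun h => ht (hBD h)).trans (hZ'le k n t ω))

/-- The discrete inequality along each fine cover is superhedged by the elementary integral that
occurs in it, up to the time when the sum of squares exceeds the quadratic variation too much. -/
theorem upperExpectation_max_le :
    𝓜.upperExpectation (fun t ω =>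
        ((supProcess (fun s ω => X s ω - X 0 ω) t ω ^ p : ℝ≥0∞) : EReal)) ≤
      (bdgUpper p : EReal) *
        𝓜.upperExpectation (fun t ω => (((V t ω).toENNReal ^ (p / 2) : ℝ≥0∞) : EReal)) := by
  have hK : 0 < bdgUpper p := bdgUpper_pos hp
  refine upperExpectation_le_mul hK fun Z hZ hdom c hc ε hε => ?_
  have hp0 : 0 < p := by linarith
  have hq : 0 < p / 2 := by linarith
  have hε4 : 0 < ε / 4 := by linarith
  obtain ⟨B, hB, hx, hXx, hhedge⟩ := hX.exists_isExceptional hA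
  set x : ℝ≥0 → Ω → ℝ := fun t ω => (X t ω).toReal with hxdef
  obtain ⟨δ, hδ, H, hH, hdisc⟩ := exists_weight_max_le hp hε4
  obtain ⟨r, hr, hrδ, hsum⟩ := exists_accuracies hδ
  obtain ⟨D, hBD, hD, hVnice, hVreal, happrox⟩ := hV.exists_isExceptional hA hB hx hXx hr hsum
  -- the power of the sum of squares is controlled by `Z` until this sum exceeds `[X]` by `a`
  obtain ⟨a, ha, hpow⟩ := exists_rpow_le hq hc (div_pos hε4 hK)
  choose I hI using fun k n => hx.exists_elementary hB (hr k) hH n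
  have hKc : 0 ≤ bdgUpper p * c := by positivity
  have hU : ∀ k n, 𝓜.ContOff D fun t ω =>
      runQV (sampled x (fineTimes B x (r k)) t ω) n - (V t ω).toReal := fun k n =>
    ((hx.runQV_sampled hB n).mono hBD).sub hVnice
  set ρ : ℕ → ℕ → Ω → WithTop ℝ≥0 := fun k n => hitTime D (fun t ω =>
    runQV (sampled x (fineTimes B x (r k)) t ω) n - (V t ω).toReal) a with hρdef
  have hρ : ∀ k n, IsStoppingTime 𝓜.ℱ (ρ k n) := fun k n => (hU k n).isStoppingTime_hitTime hD a
  have hineq : ∀ k n t ω, (t, ω) ∉ D →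
      ((runMax (sampled x (fineTimes B x (r k)) (clip (ρ k n) t ω) ω) n ^ p : ℝ) : EReal) ≤
        ((bdgUpper p * c : ℝ) : EReal) * Z (clip (ρ k n) t ω) ω + ((ε / 2 : ℝ) : EReal) +
          (((I k n).stopped (hρ k n)).integral x t ω : EReal) := by
    intro k n t ω ht
    rw [Elementary.integral_stopped]
    set u := clip (ρ k n) t ω with hu
    have hut : u ≤ t := clip_le
    have huD : (u, ω) ∉ D := fun h => ht (hD.mono h hut)
    obtain ⟨hv, hv0⟩ := hVreal u ω huD
    have h0 : runQV (sampled x (fineTimes B x (r k)) 0 ω) n = 0 :=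
      Finset.sum_eq_zero fun j _ => by
        rw [sampled_succ_sub, clip_zero_right, clip_zero_right, sub_self]; simp
    have h1 := hdisc (sampled x (fineTimes B x (r k)) u ω) (sampled_zero rfl u)
      (fun j => (hx.abs_sampled_succ_sub_le hB (hr k) (fun h => huD (hBD h)) j).trans (hrδ k)) n
    rw [← hI k n u ω] at h1
    have h2 : runQV (sampled x (fineTimes B x (r k)) u ω) n - (V u ω).toReal ≤ a :=
      (hU k n).le_of_hitTime hD ht (by
        have := (hVreal 0 ω fun h => ht (hD.mono h zero_le)).2
        rw [h0]; linarith) le_rfl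
    have h3 := mul_le_mul_of_nonneg_left
      (hpow (V u ω).toReal _ hv0 (runQV_nonneg _ _) (by linarith)) hK.le
    rw [mul_add, mul_div_cancel₀ _ hK.ne', ← mul_assoc] at h3
    have h4 : ((((V u ω).toReal) ^ (p / 2) : ℝ) : EReal) ≤ Z u ω := by
      have := hdom u ω
      rwa [hv, coe_toENNReal_rpow hv0 hq.le] at this
    have h5 : runMax (sampled x (fineTimes B x (r k)) u ω) n ^ p ≤
        bdgUpper p * c * (V u ω).toReal ^ (p / 2) + ε / 2 + (I k n).integral x u ω := by linarith
    refine (EReal.coe_le_coe_iff.2 h5).trans ?_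
    rw [EReal.coe_add, EReal.coe_add, EReal.coe_mul _ (_ ^ (p / 2))]
    exact add_le_add_left (add_le_add_left
      (mul_le_mul_of_nonneg_left h4 (EReal.coe_nonneg.2 hKc)) _) _
  have hstep := fun k n => hhedge ((I k n).stopped (hρ k n)) _ (((hZ.stopped (hρ k n)).scale
    hKc).add_supermartingale (NonnegSupermartingale.const (half_pos hε).le)) D hD.blockable
    (fun t ω ht => (EReal.coe_nonneg.2 (Real.rpow_nonneg (runMax_nonneg _ _) _)).trans
      (hineq k n t ω ht)) _ hε4
  choose Z' hZ' hZ'0 hZ'le using hstep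
  simp only [clip_zero_right] at hZ'0
  suffices hY : ∀ t ω, (t, ω) ∉ D →
      ((supProcess (fun s ω => X s ω - X 0 ω) t ω ^ p : ℝ≥0∞) : EReal) ≤
        liminf (fun k => liminf (fun n => Z' k n t ω) atTop) atTop by
    obtain ⟨Z'', h1, h2, h3⟩ := exists_dominating_of_liminf hD.blockable hZ' hZ'0 hY hε4
    refine ⟨Z'', h1, fun ω => (h2 ω).trans (le_of_eq ?_), h3⟩
    rw [add_assoc, add_assoc, ← EReal.coe_add, ← EReal.coe_add]
    congr 2; ring
  intro t ω ht
  set S := supProcess (fun s ω => X s ω - X 0 ω) t ω with hS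
  have htB : (t, ω) ∉ B := fun h => ht (hBD h)
  -- the maximum along the `k`-th fine cover is at least `S - r k`
  have hlim : Tendsto (fun k => (((S - ENNReal.ofReal (r k)) ^ p : ℝ≥0∞) : EReal)) atTop
      (𝓝 ((S ^ p : ℝ≥0∞) : EReal)) := by
    have h4 : Tendsto (fun k => ENNReal.ofReal (r k)) atTop (𝓝 0) := by
      simpa using ENNReal.tendsto_ofReal hsum.tendsto_atTop_zero
    have h5 : Tendsto (fun k => S - ENNReal.ofReal (r k)) atTop (𝓝 (S - 0)) :=
      ENNReal.Tendsto.sub tendsto_const_nhds h4 (Or.inr ENNReal.zero_ne_top)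
    rw [tsub_zero] at h5
    exact (continuous_coe_ennreal_ereal.tendsto _).comp
      ((ENNReal.continuous_rpow_const.tendsto _).comp h5)
  refine le_of_forall_lt fun b hb => ?_
  obtain ⟨b', hbb', hb'⟩ := exists_between hb
  refine hbb'.trans_le (le_liminf_of_le (by isBoundedDefault) ?_)
  filter_upwards [happrox t ω ht a ha, hlim.eventually (lt_mem_nhds hb')] with k hk hbk
  obtain ⟨N, hN⟩ := hk
  obtain ⟨N', hN'⟩ := hx.supProcess_le_runMax hB hXx (hr k) htB
  refine le_liminf_of_le (by isBoundedDefault) ?_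
  filter_upwards [eventually_ge_atTop N, eventually_ge_atTop N'] with n hn hn'
  -- up to time `t` the sum of squares does not reach `[X] + a`
  have hclip : clip (ρ k n) t ω = t := clip_hitTime_of_lt hD (hU k n) fun s hs => by
    linarith [(abs_lt.1 (hN n hn s hs)).1]
  have h6 : (S - ENNReal.ofReal (r k)) ^ p ≤
      ENNReal.ofReal (runMax (sampled x (fineTimes B x (r k)) t ω) n ^ p) := by
    rw [← ENNReal.ofReal_rpow_of_nonneg (runMax_nonneg _ _) hp0.le]
    exact ENNReal.rpow_le_rpow (tsub_le_iff_right.2 (hN' n hn')) hp0.le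
  have h7 := EReal.coe_ennreal_le_coe_ennreal_iff.2 h6
  rw [EReal.coe_ennreal_ofReal, max_eq_left (Real.rpow_nonneg (runMax_nonneg _ _) _)] at h7
  have h8 := hineq k n t ω ht
  have h9 := hZ'le k n t ω
  refine (hbk.le.trans h7).trans (le_trans ?_ h9)
  rw [hclip] at h8 ⊢
  exact h8

end BDG

end MartingaleSpace

end ModelFree

end

theorem proposition104 {Ω : Type*} [MeasurableSpace Ω] [Nonempty Ω] {d : ℕ} (hd : 0 < d)
    (𝓜 : ModelFree.MartingaleSpace Ω d) (hA : 𝓜.AssumptionA)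
    (X V : ℝ≥0 → Ω → EReal) (hX : 𝓜.IsMartingale X) (hV : 𝓜.IsQuadraticVariation X V)
    (p : ℝ) (hp : 1 ≤ p) :
    0 < ModelFree.bdgLower p ∧ 0 < ModelFree.bdgUpper p ∧
    (ModelFree.bdgLower p : EReal) *
        𝓜.upperExpectation (fun t ω => (((V t ω).toENNReal ^ (p / 2) : ℝ≥0∞) : EReal)) ≤
      𝓜.upperExpectation (fun t ω =>
        ((ModelFree.supProcess (fun s ω => X s ω - X 0 ω) t ω ^ p : ℝ≥0∞) : EReal)) ∧
    𝓜.upperExpectation (fun t ω =>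
        ((ModelFree.supProcess (fun s ω => X s ω - X 0 ω) t ω ^ p : ℝ≥0∞) : EReal)) ≤
      (ModelFree.bdgUpper p : EReal) *
        𝓜.upperExpectation (fun t ω => (((V t ω).toENNReal ^ (p / 2) : ℝ≥0∞) : EReal)) := by
  have : NeZero d := ⟨hd.ne'⟩
  have hc := ModelFree.bdgLower_pos hp
  refine ⟨hc, ModelFree.bdgUpper_pos hp, ?_,
    ModelFree.MartingaleSpace.upperExpectation_max_le hA hX hV hp⟩
  refine (mul_le_mul_of_nonneg_left
    (ModelFree.MartingaleSpace.upperExpectation_qv_le hA hX hV hp)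
    (EReal.coe_nonneg.2 hc.le)).trans (le_of_eq ?_)
  rw [← mul_assoc, ← EReal.coe_mul, mul_inv_cancel₀ hc.ne', EReal.coe_one, one_mul]
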